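/- For an integer \(n \ge 0\), let \(p(n)\) denote the number of partitions of \(n\), and let \(\mathrm{spt}(n)\) denote the total number of appearances of smallest parts in the partitions of \(n\) (so \(\mathrm{spt}(4)=10\)). An integer \(a\) is called a quadratic residue mod a prime \(t\) if \(t \nmid a\) and \(a \equiv x^2 \pmod t\) for some integer \(x\). Let \(t = 5\), \(7\) or \(13\). Then for every integer \(n \ge 0\) such that \(1-24n\) is not a quadratic residue mod \(t\) (in particular, whenever \(1-24n \equiv 0 \pmod t\)), \[ \mathrm{spt}(n) \equiv -2\left(n + \frac{t^2-1}{24}\right) p(n) \pmod t . \] In particular, for all integers \(n \ge 0\), \(\mathrm{spt}(5n+4) \equiv 0 \pmod 5\), \(\mathrm{spt}(7n+5) \equiv 0 \pmod 7\) and \(\mathrm{spt}(13n+6) \equiv 0 \pmod{13}\). -/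

import Mathlib

/-- `spt n` is the total number of appearances of smallest parts in the partitions of `n`:
for each partition, count with multiplicity the parts that are at most every part. -/
def spt (n : ℕ) : ℕ :=
  ∑ π : n.Partition, (π.parts.filter (fun i => ∀ j ∈ π.parts, i ≤ j)).card

/-- `partitionCount n` is `p(n)`, the number of partitions of `n`. -/
def partitionCount (n : ℕ) : ℕ := Fintype.card n.Partition

/-- `a` is a quadratic residue mod `m`: it is coprime to `m` and congruent to a square mod `m`.
In particular multiples of a prime `m` are not quadratic residues mod `m`. -/
def IsQuadraticResidue (a : ℤ) (m : ℕ) : Prop :=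
  IsCoprime a (m : ℤ) ∧ ∃ x : ℤ, x ^ 2 ≡ a [ZMOD (m : ℤ)]

/-! Write D = q d/dq, e = ∏(1 - q^n), P = 1/e, so that DP = l₀P with l₀ = Σ σ₁(n)q^n. The quantity
to study is a(n) = 12 spt(n) + (24n - 1)p(n): modulo t it vanishes exactly when the asserted
congruence holds, because (t² - 1)/24 is an inverse of -24 times 1. Its generating function is P·f₀
with f₀ = 12β₀ + 36l₀ - 1, where β₀ is an Appell sum (`mk_spt_mul_pentagonalSeries`). Applying 6D +
j(j+1) for j < J multiplies a(n) by ∏(6n + j(j+1)) (`coeff_mul_twistedIter`). Since 4(6n + j(j+1)) =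
(2j+1)² - (1 - 24n), for J = (t - 1)/2 a vanishing factor makes 1 - 24n a quadratic residue. It
therefore suffices that the J-th iterate f_J, stripped of P, is zero modulo t
(`dvd_of_twistedIter_eq_zero`).

This comes from the rank-crank differential equation. The rank function, an Appell sum in z and q,
is mapped by the heat operator to a series V with θ³V = c(q)z, θ being Jacobi's theta series
(`thetaSeries_pow_three_mul_heatRankSeries`); hence V has a logarithmic z-derivative expressible by
L = (z d/dz θ)/θ. The heat equation of θ makes L satisfy a Burgers equation. In the variable X = z -
2 + z⁻¹ both equations become recursions for the X-coefficients β_j of the rank function and l_j of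
L (`exists_rankMoment_recursion`, `two_mul_eulerD_logLambert_succ`).

In the recursion β_{j+1} carries the factor (2j+2)(2j+3), so f_j is a multiple of β_j plus a
polynomial in the l_i, and at 2j + 3 = t the β-term disappears modulo t. What remains is a
differential polynomial in divisor sums. It vanishes by the Burgers recursion, Fermat's theorem in
the form Dσ_{t-2} ≡ D^{t-1}σ₁, and, for 7 and 13, the identity E₄² = E₈ (`twisted_identity_five`,
`twisted_identity_seven`, `twisted_identity_thirteen`). -/

/-! ### The Eisenstein identity E₄² = E₈ and its divisor-sum form. -/

open UpperHalfPlane ModularForm ModularFormClass MatrixGroups EisensteinSeries in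
/-- The q-expansion form of `E₈ = E₄ ^ 2`. -/
theorem qExpansion_weight_four_sq :
    qExpansion 1 (E (k := 4) (by norm_num)) * qExpansion 1 (E (k := 4) (by norm_num)) =
      qExpansion 1 (E (k := 8) (by norm_num)) := by
  have h4 : (qExpansion 1 (E (k := 4) (by norm_num))).coeff 0 = 1 :=
    E_qExpansion_coeff_zero _ ⟨2, rfl⟩
  have h8 : (qExpansion 1 (E (k := 8) (by norm_num))).coeff 0 = 1 :=
    E_qExpansion_coeff_zero _ ⟨4, rfl⟩
  set f : ModularForm 𝒮ℒ 8 :=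
    ModularForm.mcast (by decide) ((E (k := 4) (by norm_num)).mul (E (k := 4) (by norm_num))) -
      E (k := 8) (by norm_num) with hf
  have hq : qExpansion 1 f = qExpansion 1 (E (k := 4) (by norm_num)) *
      qExpansion 1 (E (k := 4) (by norm_num)) - qExpansion 1 (E (k := 8) (by norm_num)) := by
    rw [hf]
    simp only [FunLike.coe_sub, coe_mcast,
      ModularForm.qExpansion_sub one_pos one_mem_strictPeriods_SL,
      ModularForm.qExpansion_mul one_pos one_mem_strictPeriods_SL]
  -- The Sturm bound in weight 8 is ⌊8/12⌋ = 0, so only the constant term has to be compared.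
  have h0 : f = 0 := by
    refine sturm_bound_levelOne_nat (k := 8) ?_
    have : (qExpansion 1 f).coeff 0 = 0 := by
      rw [hq, map_sub, PowerSeries.coeff_mul]
      simp [-PowerSeries.coeff_zero_eq_constantCoeff, h4, h8]
    rw [show 8 / 12 = 0 from rfl, Nat.cast_zero, pos_iff_ne_zero]
    intro h
    exact (PowerSeries.order_eq_nat.mp (h.trans Nat.cast_zero.symm)).1 this
  rw [← sub_eq_zero, ← hq]
  exact (ModularForm.qExpansion_eq_zero_iff one_pos one_mem_strictPeriods_SL f).mpr h0

/-- The power series whose `n`-th coefficient is the sum of the `r`-th powers of the divisors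
of `n`. -/
noncomputable def divisorSeries (R : Type*) [CommSemiring R] (r : ℕ) : PowerSeries R :=
  PowerSeries.mk fun n => ∑ d ∈ n.divisors, (d : R) ^ r

theorem map_divisorSeries {R S : Type*} [CommSemiring R] [CommSemiring S] (f : R →+* S) (r : ℕ) :
    PowerSeries.map f (divisorSeries R r) = divisorSeries S r := by
  ext n
  simp [divisorSeries]

-- Since B₄ = B₈ = -1/30, the normalizing constants of E₄ and E₈ are 240 and 480; dividing E₄² = E₈
-- by 480 leaves integer coefficients, which later allows reduction to any ring.
open UpperHalfPlane ModularForm EisensteinSeries in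
theorem divisorSeries_seven_complex :
    divisorSeries ℂ 7 = divisorSeries ℂ 3 + 120 * divisorSeries ℂ 3 ^ 2 := by
  have h4 : qExpansion 1 (E (k := 4) (by norm_num)) = 1 + 240 * divisorSeries ℂ 3 := by
    ext n
    rw [E_qExpansion_coeff _ ⟨2, rfl⟩, show bernoulli 4 = -1 / 30 by decide +kernel,
      show (240 : PowerSeries ℂ) = PowerSeries.C 240 from (map_ofNat _ _).symm]
    rcases eq_or_ne n 0 with rfl | hn
    · simp [divisorSeries]
    · simp only [hn, if_false, ArithmeticFunction.sigma_apply, map_add, PowerSeries.coeff_one,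
        PowerSeries.coeff_C_mul, divisorSeries, PowerSeries.coeff_mk]
      push_cast
      norm_num
  have h8 : qExpansion 1 (E (k := 8) (by norm_num)) = 1 + 480 * divisorSeries ℂ 7 := by
    ext n
    rw [E_qExpansion_coeff _ ⟨4, rfl⟩, show bernoulli 8 = -1 / 30 by decide +kernel,
      show (480 : PowerSeries ℂ) = PowerSeries.C 480 from (map_ofNat _ _).symm]
    rcases eq_or_ne n 0 with rfl | hn
    · simp [divisorSeries]
    · simp only [hn, if_false, ArithmeticFunction.sigma_apply, map_add, PowerSeries.coeff_one,
        PowerSeries.coeff_C_mul, divisorSeries, PowerSeries.coeff_mk]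
      push_cast
      norm_num
  have h := qExpansion_weight_four_sq
  rw [h4, h8] at h
  have h480 : (480 : PowerSeries ℂ) ≠ 0 := by
    rw [show (480 : PowerSeries ℂ) = PowerSeries.C 480 from (map_ofNat _ _).symm]
    simp
  apply mul_left_cancel₀ h480
  linear_combination -h

/-- Convolution identity between sums of cubes and of seventh powers of divisors. -/
theorem divisorSeries_seven (R : Type*) [CommRing R] :
    divisorSeries R 7 = divisorSeries R 3 + 120 * divisorSeries R 3 ^ 2 := by
  have hZ : divisorSeries ℤ 7 = divisorSeries ℤ 3 + 120 * divisorSeries ℤ 3 ^ 2 := by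
    apply PowerSeries.map_injective (Int.castRingHom ℂ) Int.cast_injective
    simpa only [map_add, map_mul, map_pow, map_ofNat, map_divisorSeries] using
      divisorSeries_seven_complex
  simpa only [map_add, map_mul, map_pow, map_ofNat, map_divisorSeries] using
    congrArg (PowerSeries.map (Int.castRingHom R)) hZ


/-! ### Derivations on power series -/

section Derivations

open PowerSeries

/-- The Leibniz rule for an additive endomorphism of a commutative ring. -/
def IsLeibniz {R : Type*} [CommRing R] (d : R →+ R) : Prop :=
  ∀ a b, d (a * b) = a * d b + b * d a

namespace IsLeibniz

variable {R : Type*} [CommRing R] {d : R →+ R}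

theorem map_one_eq_zero (h : IsLeibniz d) : d 1 = 0 := by
  have := h 1 1
  simpa using this

theorem map_intCast_eq_zero (h : IsLeibniz d) (n : ℤ) : d n = 0 := by
  rw [← zsmul_one, map_zsmul, h.map_one_eq_zero, smul_zero]

theorem map_natCast_eq_zero (h : IsLeibniz d) (n : ℕ) : d n = 0 := by
  simpa using h.map_intCast_eq_zero n

theorem map_ofNat_eq_zero (h : IsLeibniz d) (n : ℕ) [n.AtLeastTwo] : d ofNat(n) = 0 :=
  h.map_natCast_eq_zero n

theorem map_pow_succ (h : IsLeibniz d) (a : R) (n : ℕ) :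
    d (a ^ (n + 1)) = (n + 1) * a ^ n * d a := by
  induction n with
  | zero => simp
  | succ n ih =>
    rw [pow_succ, h, ih]
    push_cast
    ring

theorem map_natCast_mul (h : IsLeibniz d) (n : ℕ) (a : R) : d (n * a) = n * d a := by
  rw [h, h.map_natCast_eq_zero]; ring

theorem map_ofNat_mul (h : IsLeibniz d) (n : ℕ) [n.AtLeastTwo] (a : R) :
    d (ofNat(n) * a) = ofNat(n) * d a :=
  h.map_natCast_mul n a

end IsLeibniz

/-- The derivation `q d/dq` on power series in `q`. -/
noncomputable def eulerD (R : Type*) [CommRing R] : R⟦X⟧ →+ R⟦X⟧ where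
  toFun f := PowerSeries.mk fun n => (n : R) * coeff n f
  map_zero' := by ext n; simp
  map_add' f g := by ext n; simp [mul_add]

theorem coeff_eulerD {R : Type*} [CommRing R] (f : R⟦X⟧) (n : ℕ) :
    coeff n (eulerD R f) = n * coeff n f := by
  simp [eulerD]

theorem isLeibniz_eulerD (R : Type*) [CommRing R] : IsLeibniz (eulerD R) := by
  intro f g
  ext n
  rw [mul_comm g, map_add, coeff_eulerD]
  simp only [coeff_eulerD, coeff_mul, Finset.mul_sum]
  rw [← Finset.sum_add_distrib]
  refine Finset.sum_congr rfl fun p hp => ?_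
  rw [← Finset.HasAntidiagonal.mem_antidiagonal.mp hp]
  push_cast
  ring

/-- An additive endomorphism of the coefficient ring, applied to each coefficient of a power
series. -/
noncomputable def coeffD {R : Type*} [CommRing R] (d : R →+ R) : R⟦X⟧ →+ R⟦X⟧ where
  toFun f := PowerSeries.mk fun n => d (coeff n f)
  map_zero' := by ext n; simp
  map_add' f g := by ext n; simp

theorem coeff_coeffD {R : Type*} [CommRing R] (d : R →+ R) (f : R⟦X⟧) (n : ℕ) :
    coeff n (coeffD d f) = d (coeff n f) := by
  simp [coeffD]

theorem IsLeibniz.coeffD {R : Type*} [CommRing R] {d : R →+ R} (h : IsLeibniz d) :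
    IsLeibniz (coeffD d) := by
  intro f g
  ext n
  rw [mul_comm g, map_add, coeff_coeffD]
  simp only [coeff_coeffD, coeff_mul, map_sum]
  rw [← Finset.sum_add_distrib]
  refine Finset.sum_congr rfl fun p _ => ?_
  rw [h]
  ring

theorem coeffD_C {R : Type*} [CommRing R] (d : R →+ R) (a : R) :
    coeffD d (C a) = C (d a) := by
  ext n
  rw [coeff_coeffD, coeff_C, coeff_C]
  split_ifs <;> simp

theorem eulerD_C {R : Type*} [CommRing R] (a : R) : eulerD R (C a) = 0 := by
  ext n
  rw [coeff_eulerD, coeff_C]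
  split_ifs with h <;> simp [h]

theorem eulerD_coeffD {R : Type*} [CommRing R] (d : R →+ R) (f : R⟦X⟧) :
    eulerD R (coeffD d f) = coeffD d (eulerD R f) := by
  ext n
  simp only [coeff_eulerD, coeff_coeffD]
  rw [← nsmul_eq_mul, ← nsmul_eq_mul, map_nsmul]

theorem eulerD_map {R S : Type*} [CommRing R] [CommRing S] (φ : R →+* S) (f : R⟦X⟧) :
    eulerD S (PowerSeries.map φ f) = PowerSeries.map φ (eulerD R f) := by
  ext n
  simp [coeff_eulerD]

theorem coeffD_map {R S : Type*} [CommRing R] [CommRing S] (φ : R →+* S) (d : S →+ S)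
    (d' : R →+ R) (c : S) (h : ∀ a, d (φ a) = c * φ (d' a)) (f : R⟦X⟧) :
    coeffD d (PowerSeries.map φ f) = C c * PowerSeries.map φ (coeffD d' f) := by
  ext n
  simp [coeff_coeffD, h]

/-- The derivation `z d/dz` on Laurent series in `z`. -/
noncomputable def laurentD (k : Type*) [Field k] : LaurentSeries k →+ LaurentSeries k where
  toFun f := ⟨fun m => m * f.coeff m, f.isPWO_support.mono (by
        intro m hm; rw [Function.mem_support] at hm; exact right_ne_zero_of_mul hm)⟩
  map_zero' := by ext n; simp
  map_add' f g := by ext n; simp [mul_add]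

theorem coeff_laurentD {k : Type*} [Field k] (f : LaurentSeries k) (m : ℤ) :
    (laurentD k f).coeff m = m * f.coeff m := by
  simp [laurentD]

theorem isLeibniz_laurentD (k : Type*) [Field k] : IsLeibniz (laurentD k) := by
  intro f g
  ext n
  have hs : ∀ f : LaurentSeries k, (laurentD k f).support ⊆ f.support := by
    intro f m hm
    rw [HahnSeries.mem_support, coeff_laurentD] at hm
    exact right_ne_zero_of_mul hm
  rw [mul_comm g, HahnSeries.coeff_add, coeff_laurentD,
    HahnSeries.coeff_mul_right' g.isPWO_support (hs g),
    HahnSeries.coeff_mul_left' f.isPWO_support (hs f),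
    HahnSeries.coeff_mul, Finset.mul_sum, ← Finset.sum_add_distrib]
  refine Finset.sum_congr rfl fun p hp => ?_
  simp only [Finset.mem_antidiagonal] at hp
  rw [← hp.2.2, coeff_laurentD, coeff_laurentD]
  push_cast
  ring

theorem laurentD_single {k : Type*} [Field k] (m : ℤ) (a : k) :
    laurentD k (HahnSeries.single m a) = HahnSeries.single m (m * a) := by
  ext n
  rw [coeff_laurentD, HahnSeries.coeff_single, HahnSeries.coeff_single]
  split_ifs with h <;> simp [h]

end Derivations


/-! ### Multiplication by the theta series on arrays of coefficients. -/

section ThetaOperator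

open PowerSeries

variable {k : Type*} [Field k]

/-- The sign `(-1) ^ a` of an integer exponent, in a field. -/
def altSign (k : Type*) [Field k] (a : ℤ) : k := ((Int.negOnePow a : ℤˣ) : ℤ)

theorem altSign_zero : altSign k 0 = 1 := by simp [altSign]

theorem altSign_succ (a : ℤ) : altSign k (a + 1) = -altSign k a := by
  simp [altSign, Int.negOnePow_succ]

theorem altSign_neg (a : ℤ) : altSign k (-a) = altSign k a := by
  simp [altSign, Int.negOnePow_neg]

theorem altSign_one_sub (a : ℤ) : altSign k (1 - a) = -altSign k a := by
  rw [show 1 - a = -a + 1 by ring, altSign_succ, altSign_neg]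

/-- The triangular number `a (a - 1) / 2`. -/
def triangular (a : ℤ) : ℤ := a * (a - 1) / 2

theorem two_mul_triangular (a : ℤ) : 2 * triangular a = a * (a - 1) :=
  Int.mul_ediv_cancel' (Int.even_mul_pred_self a).two_dvd

theorem triangular_succ (a : ℤ) : triangular (a + 1) = triangular a + a := by
  have h1 := two_mul_triangular a
  have h2 := two_mul_triangular (a + 1)
  linarith

theorem triangular_one_sub (a : ℤ) : triangular (1 - a) = triangular a := by
  have h1 := two_mul_triangular a
  have h2 := two_mul_triangular (1 - a)
  linarith

theorem triangular_nonneg (a : ℤ) : 0 ≤ triangular a := by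
  have h1 := two_mul_triangular a
  rcases le_or_gt a 0 with h | h <;> nlinarith

theorem mem_Icc_of_triangular_le {a : ℤ} {n : ℕ} (h : triangular a ≤ n) :
    a ∈ Finset.Icc (-(n : ℤ)) (n + 1) := by
  have h1 := two_mul_triangular a
  rw [Finset.mem_Icc]
  constructor
  · by_contra! h2
    nlinarith
  · by_contra! h2
    nlinarith

/-- The coefficient of `z ^ m q ^ N`, for integers `m` and `N`. -/
noncomputable def bicoeff (f : (LaurentSeries k)⟦X⟧) (m N : ℤ) : k :=
  if N < 0 then 0 else (coeff N.toNat f).coeff m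

theorem bicoeff_of_neg (f : (LaurentSeries k)⟦X⟧) (m : ℤ) {N : ℤ} (h : N < 0) :
    bicoeff f m N = 0 := if_pos h

theorem bicoeff_natCast (f : (LaurentSeries k)⟦X⟧) (m : ℤ) (n : ℕ) :
    bicoeff f m n = (coeff n f).coeff m := by simp [bicoeff]

theorem ext_bicoeff {f g : (LaurentSeries k)⟦X⟧} (h : ∀ m N, bicoeff f m N = bicoeff g m N) :
    f = g := by
  ext n m
  rw [← bicoeff_natCast, h, bicoeff_natCast]

/-- The theta series `∑ (-1) ^ a z ^ a q ^ (a (a - 1) / 2)`. -/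
noncomputable def thetaSeries (k : Type*) [Field k] : (LaurentSeries k)⟦X⟧ :=
  PowerSeries.mk fun n => ∑ a ∈ Finset.Icc (-(n : ℤ)) (n + 1),
    if triangular a = n then HahnSeries.single a (altSign k a) else 0

theorem coeff_thetaSeries {i n : ℕ} (h : i ≤ n) :
    coeff i (thetaSeries k) = ∑ a ∈ Finset.Icc (-(n : ℤ)) (n + 1),
      if triangular a = i then HahnSeries.single a (altSign k a) else 0 := by
  rw [thetaSeries, coeff_mk]
  refine Finset.sum_subset (Finset.Icc_subset_Icc (by omega) (by omega)) fun a _ ha => ?_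
  rw [if_neg]
  intro h'
  exact ha (mem_Icc_of_triangular_le h'.le)

/-- The action of multiplication by `thetaSeries` on arrays of coefficients. -/
noncomputable def thetaOp (F : ℤ → ℤ → k) (m N : ℤ) : k :=
  ∑ᶠ a : ℤ, altSign k a * F (m - a) (N - triangular a)

/-- Arrays supported on nonnegative powers of `q`. -/
def IsBounded (F : ℤ → ℤ → k) : Prop := ∀ m N, N < 0 → F m N = 0

theorem isBounded_bicoeff (f : (LaurentSeries k)⟦X⟧) : IsBounded (bicoeff f) :=
  fun m _ h => bicoeff_of_neg f m h

theorem IsBounded.thetaOp_eq_sum {F : ℤ → ℤ → k} (hF : IsBounded F) {N : ℤ} {n : ℕ}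
    (h : N ≤ n) (m' : ℤ → ℤ) :
    ∑ᶠ a : ℤ, altSign k a * F (m' a) (N - triangular a) =
      ∑ a ∈ Finset.Icc (-(n : ℤ)) (n + 1), altSign k a * F (m' a) (N - triangular a) := by
  apply finsum_eq_sum_of_support_subset
  intro a ha
  rw [Function.mem_support] at ha
  rw [Finset.mem_coe]
  apply mem_Icc_of_triangular_le
  by_contra! h'
  exact ha (by rw [hF _ _ (by omega), mul_zero])

theorem finite_support_thetaOp {F : ℤ → ℤ → k} (hF : IsBounded F) (N : ℤ) (c : ℤ → k)
    (m' : ℤ → ℤ) :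
    (Function.support fun a : ℤ => c a * F (m' a) (N - triangular a)).Finite := by
  refine (Finset.finite_toSet (Finset.Icc (-(N.toNat : ℤ)) (N.toNat + 1))).subset ?_
  intro a ha
  rw [Function.mem_support] at ha
  rw [Finset.mem_coe]
  apply mem_Icc_of_triangular_le
  by_contra! h'
  exact ha (by rw [hF _ _ (by omega), mul_zero])

theorem IsBounded.thetaOp {F : ℤ → ℤ → k} (hF : IsBounded F) : IsBounded (thetaOp F) := by
  intro m N hN
  rw [_root_.thetaOp, ← finsum_zero (α := ℤ)]
  refine finsum_congr fun a => ?_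
  rw [hF _ _ (by have := triangular_nonneg a; omega), mul_zero]

theorem bicoeff_thetaSeries_mul (f : (LaurentSeries k)⟦X⟧) :
    bicoeff (thetaSeries k * f) = thetaOp (bicoeff f) := by
  funext m N
  rcases lt_or_ge N 0 with hN | hN
  · rw [bicoeff_of_neg _ _ hN, (isBounded_bicoeff f).thetaOp m N hN]
  lift N to ℕ using hN
  rw [bicoeff_natCast, thetaOp, (isBounded_bicoeff f).thetaOp_eq_sum le_rfl, coeff_mul]
  rw [HahnSeries.coeff_sum]
  have h1 : ∀ p ∈ Finset.HasAntidiagonal.antidiagonal N, (coeff p.1 (thetaSeries k) * coeff p.2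
    f).coeff m =
      ∑ a ∈ Finset.Icc (-(N : ℤ)) (N + 1),
        if triangular a = p.1 then altSign k a * (coeff p.2 f).coeff (m - a) else 0 := by
    intro p hp
    have hle : p.1 ≤ N := by
      have := Finset.HasAntidiagonal.mem_antidiagonal.mp hp
      omega
    rw [coeff_thetaSeries hle, Finset.sum_mul, HahnSeries.coeff_sum]
    refine Finset.sum_congr rfl fun a _ => ?_
    split_ifs
    · rw [HahnSeries.coeff_single_mul]
    · simp
  rw [Finset.sum_congr rfl h1, Finset.sum_comm]
  refine Finset.sum_congr rfl fun a _ => ?_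
  rcases lt_or_ge ((N : ℤ) - triangular a) 0 with h | h
  · rw [bicoeff_of_neg _ _ h, mul_zero]
    refine Finset.sum_eq_zero fun p hp => if_neg ?_
    have := Finset.HasAntidiagonal.mem_antidiagonal.mp hp
    omega
  · obtain ⟨t, ht⟩ := Int.eq_ofNat_of_zero_le (triangular_nonneg a)
    obtain ⟨s, rfl⟩ : ∃ s, N = t + s := ⟨N - t, by omega⟩
    rw [Finset.sum_eq_single (t, s)]
    · rw [if_pos ht, ht]
      push_cast
      rw [add_sub_cancel_left, bicoeff_natCast]
    · intro p hp hne
      have := Finset.HasAntidiagonal.mem_antidiagonal.mp hp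
      rw [if_neg]
      intro h'
      apply hne
      ext <;> simp only <;> omega
    · intro h'
      exact absurd (Finset.HasAntidiagonal.mem_antidiagonal.mpr (by rfl)) h'

/-- This is θ(zq) = -z⁻¹θ(z): on arrays the substitution z ↦ zq reads (m, N) ↦ (m, N - m). Arrays
are used because a substituted series need not be a power series in q. -/
theorem thetaOp_shear (F : ℤ → ℤ → k) (m N : ℤ) :
    thetaOp F m (N - m) = -thetaOp (fun m N => F m (N - m)) (m + 1) N := by
  rw [thetaOp, thetaOp, ← finsum_neg_distrib]
  rw [← finsum_comp_equiv (Equiv.addRight (1 : ℤ))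
    (f := fun a => -(altSign k a * F (m + 1 - a) (N - triangular a - (m + 1 - a))))]
  refine finsum_congr fun a => ?_
  rw [Equiv.coe_addRight, altSign_succ, triangular_succ]
  rw [show m + 1 - (a + 1) = m - a by ring,
    show N - (triangular a + a) - (m - a) = N - m - triangular a by ring]
  ring

theorem thetaOp_sub {F G : ℤ → ℤ → k} (hF : IsBounded F) (hG : IsBounded G) :
    thetaOp (fun m N => F m N - G m N) = fun m N => thetaOp F m N - thetaOp G m N := by
  funext m N
  rw [thetaOp, thetaOp, thetaOp, ← finsum_sub_distrib (finite_support_thetaOp hF _ _ _)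
    (finite_support_thetaOp hG _ _ _)]
  simp only [mul_sub]

theorem thetaOp_neg (F : ℤ → ℤ → k) :
    thetaOp (fun m N => -F m N) = fun m N => -thetaOp F m N := by
  funext m N
  rw [thetaOp, thetaOp, ← finsum_neg_distrib]
  simp only [mul_neg]

theorem thetaOp_shift (F : ℤ → ℤ → k) (u v : ℤ) :
    thetaOp (fun m N => F (m + u) (N + v)) = fun m N => thetaOp F (m + u) (N + v) := by
  funext m N
  rw [thetaOp, thetaOp]
  refine finsum_congr fun a => ?_
  rw [show m - a + u = m + u - a by ring,
    show N - triangular a + v = N + v - triangular a by ring]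

end ThetaOperator


/-! ### What powers of the theta series annihilate. -/

section ThetaVanishing

open PowerSeries

variable {k : Type*} [Field k]

theorem finsum_triangular_eq_sum {β : ℤ → k} (hβ : ∀ N < 0, β N = 0) (c : ℤ → k) (N : ℤ) :
    ∑ᶠ a : ℤ, c a * β (N - triangular a) =
      ∑ a ∈ Finset.Icc (-(N.toNat : ℤ)) (N.toNat + 1), c a * β (N - triangular a) := by
  apply finsum_eq_sum_of_support_subset
  intro a ha
  rw [Function.mem_support] at ha
  rw [Finset.mem_coe]
  apply mem_Icc_of_triangular_le
  by_contra! h'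
  exact ha (by rw [hβ _ (by omega), mul_zero])

theorem finsum_triangular_of_neg {β : ℤ → k} (hβ : ∀ N < 0, β N = 0) (c : ℤ → k) {N : ℤ}
    (hN : N < 0) : ∑ᶠ a : ℤ, c a * β (N - triangular a) = 0 := by
  rw [← finsum_zero (α := ℤ)]
  refine finsum_congr fun a => ?_
  rw [hβ _ (by have := triangular_nonneg a; omega), mul_zero]

/-- The reflection a ↦ 1 - a preserves the triangular number and flips the sign, so the sum equals
its own negative. This expresses θ(1) = 0. -/
theorem finsum_altSign_triangular (h2 : (2 : k) ≠ 0) (β : ℤ → k) (N : ℤ) :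
    ∑ᶠ a : ℤ, altSign k a * β (N - triangular a) = 0 := by
  have h : ∑ᶠ a : ℤ, altSign k a * β (N - triangular a) =
      -∑ᶠ a : ℤ, altSign k a * β (N - triangular a) := by
    rw [← finsum_neg_distrib, ← finsum_comp_equiv (Equiv.subLeft (1 : ℤ))]
    refine finsum_congr fun a => ?_
    rw [Equiv.subLeft_apply, altSign_one_sub, triangular_one_sub]
    ring
  have h' : (2 : k) * ∑ᶠ a : ℤ, altSign k a * β (N - triangular a) = 0 := by
    linear_combination h
  exact (mul_eq_zero.mp h').resolve_left h2

theorem thetaOp_const (h2 : (2 : k) ≠ 0) (α : ℤ → k) :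
    thetaOp (fun _ N => α N) = fun _ _ => 0 := by
  funext m N
  exact finsum_altSign_triangular h2 α N

/-- An array polynomial in m is a combination of derivatives of the formal delta function Σ z^m at z
= 1. As θ vanishes there, each multiplication by θ lowers the degree in m by one, and θ³ kills
degree two. -/
theorem thetaOp_quadratic (h2 : (2 : k) ≠ 0) {α β γ : ℤ → k} (hα : ∀ N < 0, α N = 0)
    (hβ : ∀ N < 0, β N = 0) (hγ : ∀ N < 0, γ N = 0) :
    thetaOp (fun (m : ℤ) N => α N + m * β N + m ^ 2 * γ N) = fun (m : ℤ) N =>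
      (∑ᶠ a : ℤ, (altSign k a * a ^ 2) * γ (N - triangular a) -
        ∑ᶠ a : ℤ, (altSign k a * a) * β (N - triangular a)) +
      m * (-2 * ∑ᶠ a : ℤ, (altSign k a * a) * γ (N - triangular a)) := by
  funext m N
  have hF : IsBounded (fun (m : ℤ) N => α N + m * β N + m ^ 2 * γ N) := by
    intro m N hN
    simp only [hα N hN, hβ N hN, hγ N hN]
    ring
  have ea := finsum_altSign_triangular h2 α N
  have eb := finsum_altSign_triangular h2 β N
  have ec := finsum_altSign_triangular h2 γ N
  rw [finsum_triangular_eq_sum hα] at ea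
  rw [finsum_triangular_eq_sum hβ] at eb
  rw [finsum_triangular_eq_sum hγ] at ec
  rw [finsum_triangular_eq_sum hβ, finsum_triangular_eq_sum hγ, finsum_triangular_eq_sum hγ,
    thetaOp, hF.thetaOp_eq_sum (Int.self_le_toNat N)]
  trans ∑ a ∈ Finset.Icc (-(N.toNat : ℤ)) (N.toNat + 1),
    (altSign k a * α (N - triangular a) + m * (altSign k a * β (N - triangular a)) +
      m ^ 2 * (altSign k a * γ (N - triangular a)) -
      altSign k a * a * β (N - triangular a) +
      altSign k a * a ^ 2 * γ (N - triangular a) +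
      m * -2 * (altSign k a * a * γ (N - triangular a)))
  · refine Finset.sum_congr rfl fun a _ => ?_
    push_cast
    ring
  · simp only [Finset.sum_add_distrib, Finset.sum_sub_distrib, ← Finset.mul_sum]
    rw [ea, eb, ec]
    ring

theorem thetaOp_thetaOp_thetaOp_quadratic (h2 : (2 : k) ≠ 0) {α β γ : ℤ → k}
    (hα : ∀ N < 0, α N = 0) (hβ : ∀ N < 0, β N = 0) (hγ : ∀ N < 0, γ N = 0) :
    thetaOp (thetaOp (thetaOp (fun (m : ℤ) N => α N + m * β N + m ^ 2 * γ N))) = fun _ _ => 0 := by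
  have aux : ∀ {α β : ℤ → k}, (∀ N < 0, α N = 0) → (∀ N < 0, β N = 0) →
      ∃ δ : ℤ → k, thetaOp (fun (m : ℤ) N => α N + m * β N) = fun _ N => δ N := by
    intro α β hα hβ
    refine ⟨fun N => 0 - ∑ᶠ a : ℤ, (altSign k a * a) * β (N - triangular a), ?_⟩
    have := thetaOp_quadratic h2 hα hβ (γ := fun _ => 0) (fun _ _ => rfl)
    simp only [mul_zero, add_zero, finsum_zero] at this
    exact this
  rw [thetaOp_quadratic h2 hα hβ hγ]
  obtain ⟨δ, hδ⟩ := aux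
    (α := fun N => ∑ᶠ a : ℤ, (altSign k a * a ^ 2) * γ (N - triangular a) -
        ∑ᶠ a : ℤ, (altSign k a * a) * β (N - triangular a))
    (β := fun N => -2 * ∑ᶠ a : ℤ, (altSign k a * a) * γ (N - triangular a))
    (fun N hN => by
      simp only [finsum_triangular_of_neg hγ _ hN, finsum_triangular_of_neg hβ _ hN, sub_zero])
    (fun N hN => by simp only [finsum_triangular_of_neg hγ _ hN, mul_zero])
  rw [hδ, thetaOp_const h2]

/-- If the shear of the array of `V` reproduces it up to a quadratic polynomial with the index
of the third power of the theta series, then the product is concentrated on the powers of `q`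
times `z`. -/
theorem thetaSeries_pow_three_mul (h2 : (2 : k) ≠ 0) (V : (LaurentSeries k)⟦X⟧) {α β γ : ℤ → k}
    (hα : ∀ N < 0, α N = 0) (hβ : ∀ N < 0, β N = 0) (hγ : ∀ N < 0, γ N = 0)
    (hV : ∀ m N, bicoeff V m (N - m) + bicoeff V (m - 3) (N - 1) =
      α N + m * β N + m ^ 2 * γ N) {m : ℤ} (hm : m ≠ 1) (N : ℤ) :
    bicoeff (thetaSeries k ^ 3 * V) m N = 0 := by
  have hB := isBounded_bicoeff V
  set U := thetaOp (thetaOp (thetaOp (bicoeff V))) with hU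
  have hUV : bicoeff (thetaSeries k ^ 3 * V) = U := by
    rw [show thetaSeries k ^ 3 * V = thetaSeries k * (thetaSeries k * (thetaSeries k * V)) by ring,
      bicoeff_thetaSeries_mul, bicoeff_thetaSeries_mul, bicoeff_thetaSeries_mul]
  have hp : IsBounded (fun (m : ℤ) N => α N + m * β N + m ^ 2 * γ N) := by
    intro m N hN
    simp only [hα N hN, hβ N hN, hγ N hN]
    ring
  have hW : IsBounded (fun m N => bicoeff V (m + -3) (N + -1)) :=
    fun m N hN => hB _ _ (by omega)
  have hs : (fun m N => bicoeff V m (N - m)) =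
      fun m N => (α N + m * β N + m ^ 2 * γ N) - bicoeff V (m + -3) (N + -1) := by
    funext m N
    rw [← hV m N, ← sub_eq_add_neg, ← sub_eq_add_neg, add_sub_cancel_right]
  have e1 : ∀ F : ℤ → ℤ → k, (fun m N => thetaOp F m (N - m)) =
      fun m N => -thetaOp (fun m N => F m (N - m)) (m + 1) (N + 0) := by
    intro F
    funext m N
    rw [thetaOp_shear, add_zero]
  -- That is, U(zq) = qU(z): the factor -z⁻³ of θ³ meets the term -z³qV from `hV`, while the
  -- quadratic part is annihilated by θ³.
  have key : ∀ m N, U m (N - m) = U m (N - 1) := by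
    intro m N
    have : (fun m N => U m (N - m)) = fun m N =>
        -(thetaOp (thetaOp (thetaOp (fun m N => bicoeff V m (N - m)))) (m + 3) N) := by
      rw [hU, e1, e1, thetaOp_neg, thetaOp_shift, e1, thetaOp_neg, thetaOp_shift, thetaOp_neg,
        thetaOp_shift]
      funext m N
      simp only [add_zero, neg_neg]
      rw [show m + 1 + 1 + 1 = m + 3 by ring]
    have h3 := congrFun (congrFun this m) N
    rw [h3, hs, thetaOp_sub hp hW, thetaOp_sub hp.thetaOp hW.thetaOp,
      thetaOp_sub hp.thetaOp.thetaOp hW.thetaOp.thetaOp,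
      thetaOp_thetaOp_thetaOp_quadratic h2 hα hβ hγ, thetaOp_shift, thetaOp_shift, thetaOp_shift]
    simp only [zero_sub, neg_neg]
    rw [show m + 3 + -3 = m by ring, ← sub_eq_add_neg]
  have hUb : IsBounded U := hB.thetaOp.thetaOp.thetaOp
  rw [hUV]
  -- For m ≠ 1 the entry may be moved down by |m - 1| ≥ 1 in N as often as desired, until N is
  -- negative and boundedness forces zero.
  have hstep : ∀ N, U m N = U m (N - |m - 1|) := by
    intro N
    rcases lt_or_gt_of_ne hm with h | h
    · have := key m (N + m)
      rw [add_sub_cancel_right] at this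
      rw [this, abs_of_neg (by omega)]
      congr 1
      ring
    · have := key m (N + 1)
      rw [add_sub_cancel_right] at this
      rw [← this, abs_of_pos (by omega)]
      congr 1
      ring
  have hiter : ∀ (j : ℕ) N, U m N = U m (N - j * |m - 1|) := by
    intro j
    induction j with
    | zero => intro N; simp
    | succ j ih =>
      intro N
      rw [ih N, hstep]
      congr 1
      push_cast
      ring
  rw [hiter (N.toNat + 1) N]
  apply hUb
  have h1 : 1 ≤ |m - 1| := Int.one_le_abs (by omega)
  push_cast
  nlinarith [Int.self_le_toNat N]

/-- An array with the shear symmetry of the theta series which vanishes for `m = 0` is zero. -/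
theorem eq_zero_of_shear {F : ℤ → ℤ → k} (hF : ∀ m N, F m (N - m) = -F (m + 1) N)
    (h0 : ∀ N, F 0 N = 0) (m N : ℤ) : F m N = 0 := by
  induction m using Int.induction_on generalizing N with
  | zero => exact h0 N
  | succ i ih =>
    have := hF i N
    rw [ih, eq_comm, neg_eq_zero] at this
    exact this
  | pred i ih =>
    have := hF (-(i : ℤ) - 1) (N + (-(i : ℤ) - 1))
    rw [add_sub_cancel_right, show -(i : ℤ) - 1 + 1 = -i by ring, ih, neg_zero] at this
    exact this

end ThetaVanishing


/-! ### The Appell sum of the rank function and its quasi-periodicity. -/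

section AppellSums

open PowerSeries

/-- The series `∑_{j ≥ 1, i ≥ 0} (-1) ^ j f i q ^ (j (3 j + 1) / 2 + j i)`. -/
noncomputable def appellSeries {R : Type*} [CommRing R] (f : ℕ → R) : R⟦X⟧ :=
  PowerSeries.mk fun N => ∑ j ∈ Finset.range N, ∑ i ∈ Finset.range (N + 1),
    if (j + 1) * (3 * (j + 1) + 1) + 2 * (j + 1) * i = 2 * N then (-1) ^ (j + 1) * f i else 0

/-- The Lambert series `∑_{i, j ≥ 1} f i q ^ (i j)`. -/
noncomputable def lambertSeries {R : Type*} [CommRing R] (f : ℕ → R) : R⟦X⟧ :=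
  PowerSeries.mk fun N => ∑ i ∈ N.divisors, f i

theorem map_appellSeries {R S : Type*} [CommRing R] [CommRing S] (φ : R →+* S) (f : ℕ → R) :
    PowerSeries.map φ (appellSeries f) = appellSeries fun i => φ (f i) := by
  ext N
  simp only [appellSeries, coeff_map, coeff_mk, map_sum]
  refine Finset.sum_congr rfl fun j _ => Finset.sum_congr rfl fun i _ => ?_
  split_ifs <;> simp

theorem C_mul_appellSeries {R : Type*} [CommRing R] (c : R) (f : ℕ → R) :
    C c * appellSeries f = appellSeries fun i => c * f i := by
  ext N
  simp only [appellSeries, coeff_C_mul, coeff_mk, Finset.mul_sum]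
  refine Finset.sum_congr rfl fun j _ => Finset.sum_congr rfl fun i _ => ?_
  split_ifs <;> ring

theorem map_lambertSeries {R S : Type*} [CommRing R] [CommRing S] (φ : R →+* S) (f : ℕ → R) :
    PowerSeries.map φ (lambertSeries f) = lambertSeries fun i => φ (f i) := by
  ext N
  simp [lambertSeries]

theorem C_mul_lambertSeries {R : Type*} [CommRing R] (c : R) (f : ℕ → R) :
    C c * lambertSeries f = lambertSeries fun i => c * f i := by
  ext N
  simp [lambertSeries, Finset.mul_sum]

variable {k : Type*} [Field k]

theorem altSign_natCast (j : ℕ) : altSign k j = (-1) ^ j := by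
  induction j with
  | zero => simp [altSign]
  | succ j ih => rw [Nat.cast_succ, altSign_succ, ih, pow_succ]; ring

theorem coeff_neg_one_pow_mul (j : ℕ) (x : LaurentSeries k) (m : ℤ) :
    ((-1) ^ j * x).coeff m = (-1) ^ j * x.coeff m := by
  rcases neg_one_pow_eq_or (LaurentSeries k) j with h | h <;>
  rcases Nat.even_or_odd j with h' | h' <;> simp [h'.neg_one_pow]

/-- The expansion of `1 / (1 - z)`. -/
noncomputable def geomLaurent (k : Type*) [Field k] : LaurentSeries k :=
  HahnSeries.ofPowerSeries ℤ k (PowerSeries.mk 1)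

theorem geomLaurent_mul : geomLaurent k * (1 - HahnSeries.single 1 1) = 1 := by
  have := congrArg (HahnSeries.ofPowerSeries ℤ k) (PowerSeries.mk_one_mul_one_sub_eq_one k)
  simpa [geomLaurent] using this

theorem coeff_geomLaurent (m : ℤ) : (geomLaurent k).coeff m = if 0 ≤ m then 1 else 0 := by
  split_ifs with h
  · lift m to ℕ using h
    rw [geomLaurent, HahnSeries.ofPowerSeries_apply_coeff]
    simp
  · rw [geomLaurent, HahnSeries.ofPowerSeries_apply]
    apply HahnSeries.embDomain_of_notMem_range
    rintro ⟨n, hn⟩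
    simp at hn
    omega

/-- The sign of the summand of index `n` in the coefficient of `z ^ m` of `∑ q ^ _ / (1 - z q ^ n)`.
-/
def hookSign (k : Type*) [Field k] (n m : ℤ) : k :=
  if 0 ≤ n ∧ 0 ≤ m then 1 else if n < 0 ∧ m < 0 then -1 else 0

/-- The index shift (n + 1, m - 3) ↔ (n, m) matches exponents under z ↦ zq. The two expansions of
the geometric series differ only on the strip 0 ≤ m ≤ 2 and in the row n = -1, up to their overlap.
-/
theorem hookSign_sub (n m : ℤ) :
    hookSign k n m - hookSign k (n + 1) (m - 3) =
      (if 0 ≤ m ∧ m ≤ 2 then 1 else 0) - if n = -1 then 1 else 0 := by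
  unfold hookSign
  split_ifs <;> first | omega | simp

/-- The coefficients of the generating function of the ranks of partitions, without its
infinite product. -/
noncomputable def rankCoeff (k : Type*) [Field k] (m N : ℤ) : k :=
  ∑ᶠ n : ℤ, hookSign k n m * if n * (3 * n + 1) + 2 * n * m = 2 * N then altSign k n else 0

/-- The coefficients of the pentagonal series, extended to integers. -/
noncomputable def eulerCoeff (k : Type*) [Field k] (N : ℤ) : k :=
  if N < 0 then 0 else coeff N.toNat (pentagonalSeries k)

theorem eulerCoeff_eq_finsum (N : ℤ) :
    eulerCoeff k N = ∑ᶠ n : ℤ, if n * (3 * n + 1) = 2 * N then altSign k n else 0 := by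
  have hp := fun n : ℤ => two_mul_natCast_pentagonal_neg n
  by_cases h : ∃ n, n * (3 * n + 1) = 2 * N
  · obtain ⟨n, hn⟩ := h
    have hN : N = pentagonal (-n) := by have := hp n; omega
    rw [finsum_eq_single _ n]
    · rw [if_pos hn, eulerCoeff, if_neg (by omega), hN, Int.toNat_natCast,
        coeff_pentagonalSeries_pentagonal, Int.negOnePow_neg, altSign]
    · intro n' hne
      rw [if_neg]
      intro h'
      have : pentagonal (-n') = pentagonal (-n) := by have := hp n'; omega
      exact hne (neg_injective (pentagonal_injective this))
  · rw [eulerCoeff]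
    push Not at h
    simp only [h, if_false, finsum_zero]
    split_ifs with hN
    · rfl
    · apply coeff_pentagonalSeries_eq_zero
      rintro ⟨n, hn⟩
      apply h (-n)
      have := hp (-n)
      rw [neg_neg, hn] at this
      omega

theorem finite_setOf_hook (c : ℤ → k) (m N : ℤ) :
    Function.HasFiniteSupport fun n : ℤ =>
      c n * if n * (3 * n + 1) + 2 * n * m = 2 * N then altSign k n else 0 := by
  refine (Set.finite_Icc (-(2 * |N| + 2 * |m| + 2)) (2 * |N| + 2 * |m| + 2)).subset ?_
  intro n hn
  have h : n * (3 * n + 1) + 2 * n * m = 2 * N := by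
    by_contra h
    simp [h] at hn
  have h1 := le_abs_self N
  have h2 := neg_abs_le m
  have h3 := le_abs_self m
  have h4 := abs_nonneg N
  constructor
  · by_contra! h'
    nlinarith
  · by_contra! h'
    nlinarith

/-- The quasi-periodicity of the rank function under z ↦ zq. The row n = -1 gives the term
independent of m; the strip gives one pentagonal-type sum for each of m = 0, 1, 2. For m = 1 the
exponent 3n(n+1)/2 is invariant under n ↦ -1 - n while the sign flips, so that sum is zero. -/
theorem rankCoeff_add (h2 : (2 : k) ≠ 0) (m N : ℤ) :
    rankCoeff k m (N - m) + rankCoeff k (m - 3) (N - 1) =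
      (if N = 1 then 1 else 0) + (if m = 0 then eulerCoeff k N else 0) -
        if m = 2 then eulerCoeff k (N - 1) else 0 := by
  have e2 : rankCoeff k (m - 3) (N - 1) = ∑ᶠ n : ℤ, -(hookSign k (n + 1) (m - 3) *
      if n * (3 * n + 1) + 2 * n * m = 2 * (N - m) then altSign k n else 0) := by
    rw [rankCoeff, ← finsum_comp_equiv (Equiv.addRight (1 : ℤ))]
    refine finsum_congr fun n => ?_
    rw [Equiv.coe_addRight, altSign_succ]
    have : (n + 1) * (3 * (n + 1) + 1) + 2 * (n + 1) * (m - 3) = 2 * (N - 1) ↔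
        n * (3 * n + 1) + 2 * n * m = 2 * (N - m) := by
      constructor <;> intro h <;> linarith
    rw [if_congr this rfl rfl]
    split_ifs <;> ring
  have e3 : ∑ᶠ n : ℤ, (if n = -1 then (1 : k) else 0) *
      (if n * (3 * n + 1) + 2 * n * m = 2 * (N - m) then altSign k n else 0) =
      -if N = 1 then 1 else 0 := by
    rw [finsum_eq_single _ (-1) (fun n hn => by simp [hn])]
    have h1 : altSign k (-1) = -1 := by simp [altSign]
    rw [if_pos rfl, one_mul, h1]
    split_ifs <;> first | omega | simp
  have e4 : (if 0 ≤ m ∧ m ≤ 2 then (1 : k) else 0) *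
      ∑ᶠ n : ℤ, (if n * (3 * n + 1) + 2 * n * m = 2 * (N - m) then altSign k n else 0) =
      (if m = 0 then eulerCoeff k N else 0) - if m = 2 then eulerCoeff k (N - 1) else 0 := by
    by_cases h0 : m = 0
    · subst h0
      simp [eulerCoeff_eq_finsum]
    by_cases h1 : m = 1
    · subst h1
      rw [if_neg h0, if_neg (by norm_num : ¬ (1 : ℤ) = 2), sub_zero, if_pos (by norm_num), one_mul]
      have h : ∑ᶠ n : ℤ, (if n * (3 * n + 1) + 2 * n * 1 = 2 * (N - 1) then altSign k n else 0) =
          -∑ᶠ n : ℤ, (if n * (3 * n + 1) + 2 * n * 1 = 2 * (N - 1) then altSign k n else 0) := by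
        rw [← finsum_neg_distrib, ← finsum_comp_equiv (Equiv.subLeft (-1 : ℤ))]
        refine finsum_congr fun n => ?_
        rw [Equiv.subLeft_apply, show -1 - n = -(n + 1) by ring, altSign_neg, altSign_succ]
        have : -(n + 1) * (3 * -(n + 1) + 1) + 2 * -(n + 1) * 1 = 2 * (N - 1) ↔
            n * (3 * n + 1) + 2 * n * 1 = 2 * (N - 1) := by
          constructor <;> intro h <;> linarith
        rw [if_congr this rfl rfl]
        split_ifs <;> simp
      rw [eq_neg_iff_add_eq_zero, ← two_mul] at h
      exact (mul_eq_zero.mp h).resolve_left h2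
    by_cases h2' : m = 2
    · subst h2'
      rw [if_neg h0, if_pos (by norm_num), one_mul, if_pos rfl, eulerCoeff_eq_finsum, zero_sub,
        ← finsum_neg_distrib, ← finsum_comp_equiv (Equiv.subLeft (-1 : ℤ))]
      refine finsum_congr fun n => ?_
      rw [Equiv.subLeft_apply, show -1 - n = -(n + 1) by ring, altSign_neg, altSign_succ]
      have : -(n + 1) * (3 * -(n + 1) + 1) + 2 * -(n + 1) * 2 = 2 * (N - 2) ↔
          n * (3 * n + 1) = 2 * (N - 1) := by
        constructor <;> intro h <;> linarith
      rw [if_congr this rfl rfl]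
      split_ifs <;> simp
    · rw [if_neg h0, if_neg h2', if_neg (by omega)]
      simp
  rw [e2, rankCoeff, finsum_neg_distrib, ← sub_eq_add_neg,
    ← finsum_sub_distrib (finite_setOf_hook _ _ _) (finite_setOf_hook _ _ _)]
  simp only [← sub_mul, hookSign_sub]
  simp only [sub_mul]
  rw [finsum_sub_distrib
    (finite_setOf_hook (fun _ => if 0 ≤ m ∧ m ≤ 2 then 1 else 0) m (N - m))
    (finite_setOf_hook (fun n => if n = -1 then 1 else 0) m (N - m)), e3, ← mul_finsum, e4]
  ring

/-- The sum over nonzero `n` of `(-1) ^ n q ^ (n (3 n + 1) / 2) / (1 - z q ^ n)`, together with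
the term of index zero. -/
noncomputable def rankSeries (k : Type*) [Field k] : (LaurentSeries k)⟦X⟧ :=
  C (geomLaurent k) +
    appellSeries fun i => HahnSeries.single (i : ℤ) 1 - HahnSeries.single (-(i : ℤ) - 1) 1

theorem finsum_int_eq_sum {M : Type*} [AddCommMonoid M] (f : ℤ → M) (N : ℕ)
    (hf : ∀ n : ℤ, f n ≠ 0 → n ∈ Finset.Icc (-(N : ℤ)) N) :
    ∑ᶠ n : ℤ, f n = f 0 + ∑ j ∈ Finset.range N, (f (j + 1) + f (-(j + 1))) := by
  rw [finsum_eq_sum_of_support_subset (s := Finset.Icc (-(N : ℤ)) N) f (fun n hn => hf n hn)]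
  clear hf
  induction N with
  | zero => simp
  | succ N ih =>
    have : Finset.Icc (-((N + 1 : ℕ) : ℤ)) ((N + 1 : ℕ) : ℤ) =
        insert ((N : ℤ) + 1) (insert (-((N : ℤ) + 1)) (Finset.Icc (-(N : ℤ)) N)) := by
      ext x
      simp only [Finset.mem_Icc, Finset.mem_insert]
      omega
    rw [this, Finset.sum_insert (by simp; omega), Finset.sum_insert (by simp), ih,
      Finset.sum_range_succ]
    abel

theorem bounds_of_hookSign_ne_zero {n m N : ℤ} (h : hookSign k n m ≠ 0)
    (e : n * (3 * n + 1) + 2 * n * m = 2 * N) : -N ≤ n ∧ n ≤ N := by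
  unfold hookSign at h
  split_ifs at h with h1 h2
  · have := mul_nonneg h1.1 h1.2
    have := Int.le_self_sq n
    constructor <;> nlinarith [h1.1]
  · have := mul_pos_of_neg_of_neg h2.1 h2.2
    have := Int.le_self_sq (-n)
    constructor <;> nlinarith [h2.1]
  · exact absurd rfl h

/-- The terms n = j + 1 and n = -(j + 1) are expanded in opposite directions; at m = i and m = -i -
1 respectively their q-exponents coincide, so one Appell series carries both. -/
theorem bicoeff_rankSeries : bicoeff (rankSeries k) = rankCoeff k := by
  funext m N
  rcases lt_or_ge N 0 with hN | hN
  · rw [bicoeff_of_neg _ _ hN, rankCoeff, eq_comm, ← finsum_zero (α := ℤ)]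
    refine finsum_congr fun n => ?_
    by_contra h
    have e : n * (3 * n + 1) + 2 * n * m = 2 * N := by
      by_contra e
      simp [e] at h
    have := bounds_of_hookSign_ne_zero (left_ne_zero_of_mul h) e
    omega
  lift N to ℕ using hN
  rw [bicoeff_natCast, rankCoeff, finsum_int_eq_sum _ N]
  · rw [rankSeries, map_add, HahnSeries.coeff_add]
    congr 1
    · rw [coeff_C]
      unfold hookSign
      rcases eq_or_ne N 0 with rfl | hN
      · simp [coeff_geomLaurent, altSign_zero]
      · simp [hN, eq_comm]
    · rw [appellSeries, coeff_mk, HahnSeries.coeff_sum]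
      refine Finset.sum_congr rfl fun j hj => ?_
      rw [HahnSeries.coeff_sum]
      have hs : ∀ (i : ℕ) (m : ℤ), (if (j + 1) * (3 * (j + 1) + 1) + 2 * (j + 1) * i = 2 * N then
          (-1) ^ (j + 1) * (HahnSeries.single (i : ℤ) (1 : k) -
            HahnSeries.single (-(i : ℤ) - 1) 1) else 0).coeff m =
          if (j + 1) * (3 * (j + 1) + 1) + 2 * (j + 1) * i = 2 * N then (-1) ^ (j + 1) *
            ((if m = i then 1 else 0) - if m = -(i : ℤ) - 1 then 1 else 0) else 0 := by
        intro i m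
        split_ifs <;> simp_all [coeff_neg_one_pow_mul]
      have hj1 : altSign k ((j : ℤ) + 1) = (-1) ^ (j + 1) := by
        rw [← altSign_natCast]; push_cast; rfl
      have hle : ∀ i : ℕ, (j + 1) * (3 * (j + 1) + 1) + 2 * (j + 1) * i = 2 * N → i < N + 1 := by
        intro i hi
        nlinarith
      simp only [hs]
      rcases le_or_gt 0 m with hm | hm
      · lift m to ℕ using hm
        have h1 : hookSign k ((j : ℤ) + 1) (m : ℤ) = 1 := if_pos (by omega)
        have h2 : hookSign k (-((j : ℤ) + 1)) (m : ℤ) = 0 := by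
          rw [hookSign, if_neg (by omega), if_neg (by omega)]
        have h3 : ¬ (m : ℤ) = -(m : ℤ) - 1 := by omega
        rw [Finset.sum_eq_single m, h1, h2, hj1, zero_mul, add_zero, one_mul, if_pos rfl, if_neg h3,
          sub_zero, mul_one]
        · refine if_congr ?_ rfl rfl
          norm_cast
        · intro i _ hi
          rw [if_neg (show ¬ (m : ℤ) = (i : ℤ) by omega),
            if_neg (show ¬ (m : ℤ) = -(i : ℤ) - 1 by omega)]
          simp
        · intro hi
          rw [if_neg]
          intro h
          exact hi (Finset.mem_range.mpr (hle m h))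
      · obtain ⟨i, rfl⟩ : ∃ i : ℕ, m = -i - 1 := ⟨(-m - 1).toNat, by omega⟩
        have h1 : hookSign k ((j : ℤ) + 1) (-(i : ℤ) - 1) = 0 := by
          rw [hookSign, if_neg (by omega), if_neg (by omega)]
        have h2 : hookSign k (-((j : ℤ) + 1)) (-(i : ℤ) - 1) = -1 := by
          rw [hookSign, if_neg (by omega), if_pos (by omega)]
        have h3 : ¬ -(i : ℤ) - 1 = (i : ℤ) := by omega
        rw [Finset.sum_eq_single i, h1, h2, altSign_neg, hj1, zero_mul, zero_add,
          if_pos rfl, if_neg h3, zero_sub, mul_neg_one, neg_one_mul]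
        · have : (-((j : ℤ) + 1)) * (3 * (-((j : ℤ) + 1)) + 1) +
              2 * (-((j : ℤ) + 1)) * (-(i : ℤ) - 1) = 2 * N ↔
              (j + 1) * (3 * (j + 1) + 1) + 2 * (j + 1) * i = 2 * N := by
            zify
            constructor <;> intro h <;> linarith
          rw [if_congr this rfl rfl]
          split_ifs <;> simp
        · intro i' _ hi
          rw [if_neg (show ¬ -(i : ℤ) - 1 = (i' : ℤ) by omega),
            if_neg (show ¬ -(i : ℤ) - 1 = -(i' : ℤ) - 1 by omega)]
          simp
        · intro hi
          rw [if_neg]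
          intro h
          exact hi (Finset.mem_range.mpr (hle i h))
  · intro n h
    have e : n * (3 * n + 1) + 2 * n * m = 2 * N := by
      by_contra e
      simp [e] at h
    exact Finset.mem_Icc.mpr (bounds_of_hookSign_ne_zero (left_ne_zero_of_mul h) e)

end AppellSums


/-! ### The heat operator on the rank function. -/

section ThetaProducts

open PowerSeries

variable {k : Type*} [Field k]

theorem bicoeff_add (f g : (LaurentSeries k)⟦X⟧) (m N : ℤ) :
    bicoeff (f + g) m N = bicoeff f m N + bicoeff g m N := by
  unfold bicoeff; split_ifs <;> simp

theorem bicoeff_neg (f : (LaurentSeries k)⟦X⟧) (m N : ℤ) :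
    bicoeff (-f) m N = -bicoeff f m N := by
  unfold bicoeff; split_ifs <;> simp

theorem bicoeff_sub (f g : (LaurentSeries k)⟦X⟧) (m N : ℤ) :
    bicoeff (f - g) m N = bicoeff f m N - bicoeff g m N := by
  rw [sub_eq_add_neg, bicoeff_add, bicoeff_neg, sub_eq_add_neg]

theorem bicoeff_map_C_mul (a : k⟦X⟧) (f : (LaurentSeries k)⟦X⟧) (m : ℤ) {N : ℤ} {n : ℕ}
    (h : N ≤ n) : bicoeff (PowerSeries.map HahnSeries.C a * f) m N =
      ∑ i ∈ Finset.range (n + 1), coeff i a * bicoeff f m (N - i) := by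
  rcases lt_or_ge N 0 with hN | hN
  · rw [bicoeff_of_neg _ _ hN, eq_comm]
    refine Finset.sum_eq_zero fun i _ => ?_
    rw [bicoeff_of_neg _ _ (by omega), mul_zero]
  lift N to ℕ using hN
  rw [bicoeff_natCast, coeff_mul, HahnSeries.coeff_sum]
  rw [Finset.Nat.sum_antidiagonal_eq_sum_range_succ (fun i j =>
    (coeff i (PowerSeries.map HahnSeries.C a) * coeff j f).coeff m)]
  trans ∑ i ∈ Finset.range (N + 1), coeff i a * bicoeff f m (N - i)
  · refine Finset.sum_congr rfl fun i hi => ?_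
    rw [Finset.mem_range] at hi
    rw [coeff_map, HahnSeries.C_mul_eq_smul, HahnSeries.coeff_smul, smul_eq_mul,
      ← Nat.cast_sub (by omega), bicoeff_natCast]
  · refine Finset.sum_subset (Finset.range_subset_range.mpr (by omega)) fun i _ hi => ?_
    rw [Finset.mem_range] at hi
    rw [bicoeff_of_neg _ _ (by omega), mul_zero]

theorem natCast_mul_coeff (n : ℕ) (x : LaurentSeries k) (m : ℤ) :
    ((n : LaurentSeries k) * x).coeff m = n * x.coeff m := by
  rw [← map_natCast HahnSeries.C, HahnSeries.C_mul_eq_smul, HahnSeries.coeff_smul, smul_eq_mul]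

theorem bicoeff_ofNat_mul (a : ℕ) [a.AtLeastTwo] (f : (LaurentSeries k)⟦X⟧) (m N : ℤ) :
    bicoeff (ofNat(a) * f) m N = ofNat(a) * bicoeff f m N := by
  unfold bicoeff
  split_ifs
  · simp
  · rw [← Nat.cast_ofNat (R := (LaurentSeries k)⟦X⟧), ← nsmul_eq_mul, map_nsmul, nsmul_eq_mul,
      natCast_mul_coeff]
    simp

theorem bicoeff_eulerD (f : (LaurentSeries k)⟦X⟧) (m N : ℤ) :
    bicoeff (eulerD _ f) m N = N * bicoeff f m N := by
  unfold bicoeff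
  split_ifs with h
  · simp
  · rw [coeff_eulerD, natCast_mul_coeff]
    congr 1
    rw [← Int.cast_natCast, Int.toNat_of_nonneg (by omega)]

theorem bicoeff_coeffD_laurentD (f : (LaurentSeries k)⟦X⟧) (m N : ℤ) :
    bicoeff (coeffD (laurentD k) f) m N = m * bicoeff f m N := by
  unfold bicoeff
  split_ifs with h
  · simp
  · rw [coeff_coeffD, coeff_laurentD]

theorem isLeibniz_coeffD_laurentD : IsLeibniz (coeffD (laurentD k)) :=
  (isLeibniz_laurentD k).coeffD

/-- The product of the infinite product `∏ (1 - q ^ n)` with the image of the rank generating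
function under the heat operator. -/
noncomputable def heatRankSeries (k : Type*) [Field k] : (LaurentSeries k)⟦X⟧ :=
  PowerSeries.map HahnSeries.C (pentagonalSeries k) * (6 * eulerD _ (rankSeries k) +
      coeffD (laurentD k) (coeffD (laurentD k) (rankSeries k)) +
      coeffD (laurentD k) (rankSeries k)) -
    6 * (PowerSeries.map HahnSeries.C (eulerD k (pentagonalSeries k)) * rankSeries k)

theorem bicoeff_heatRankSeries (m : ℤ) {N : ℤ} {n : ℕ} (h : N ≤ n) :
    bicoeff (heatRankSeries k) m N = ∑ i ∈ Finset.range (n + 1),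
      coeff i (pentagonalSeries k) * ((6 * (N - 2 * i) + m ^ 2 + m) * rankCoeff k m (N - i)) := by
  rw [heatRankSeries, bicoeff_sub, bicoeff_ofNat_mul, bicoeff_map_C_mul _ _ _ h,
    bicoeff_map_C_mul _ _ _ h, Finset.mul_sum, ← Finset.sum_sub_distrib]
  refine Finset.sum_congr rfl fun i _ => ?_
  rw [bicoeff_add, bicoeff_add, bicoeff_ofNat_mul, bicoeff_eulerD, bicoeff_coeffD_laurentD,
    bicoeff_coeffD_laurentD, bicoeff_rankSeries, coeff_eulerD]
  push_cast
  ring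

/-- The weight N - 2i changes sign under i ↦ N - i; the sum is a coefficient of 6(e·De - De·e). -/
theorem sum_eulerCoeff_antisymm (h2 : (2 : k) ≠ 0) {N : ℤ} {n : ℕ} (h : N ≤ n) :
    ∑ i ∈ Finset.range (n + 1),
      coeff i (pentagonalSeries k) * ((6 * (N - 2 * i)) * eulerCoeff k (N - i)) = 0 := by
  rcases lt_or_ge N 0 with hN | hN
  · refine Finset.sum_eq_zero fun i _ => ?_
    rw [eulerCoeff, if_pos (by omega)]
    ring
  lift N to ℕ using hN
  have e : ∑ i ∈ Finset.range (n + 1),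
      coeff i (pentagonalSeries k) * ((6 * ((N : ℤ) - 2 * i)) * eulerCoeff k (N - i)) =
      ∑ i ∈ Finset.range (N + 1), 6 * ((N : k) - 2 * i) *
        (coeff i (pentagonalSeries k) * coeff (N - i) (pentagonalSeries k)) := by
    symm
    refine (Finset.sum_congr rfl fun i hi => ?_).trans
      (Finset.sum_subset (Finset.range_subset_range.mpr (by omega)) fun i _ hi => ?_)
    · rw [Finset.mem_range] at hi
      rw [eulerCoeff, if_neg (by omega), show ((N : ℤ) - i).toNat = N - i by omega]
      push_cast
      ring
    · rw [Finset.mem_range] at hi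
      rw [eulerCoeff, if_pos (by omega)]
      ring
  rw [e]
  have e' := Finset.sum_range_reflect (fun i => 6 * ((N : k) - 2 * i) *
        (coeff i (pentagonalSeries k) * coeff (N - i) (pentagonalSeries k))) (N + 1)
  have e'' : ∑ j ∈ Finset.range (N + 1), 6 * ((N : k) - 2 * ((N + 1 - 1 - j : ℕ) : k)) *
        (coeff (N + 1 - 1 - j) (pentagonalSeries k) *
          coeff (N - (N + 1 - 1 - j)) (pentagonalSeries k)) =
      -∑ i ∈ Finset.range (N + 1), 6 * ((N : k) - 2 * i) *
        (coeff i (pentagonalSeries k) * coeff (N - i) (pentagonalSeries k)) := by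
    rw [← Finset.sum_neg_distrib]
    refine Finset.sum_congr rfl fun i hi => ?_
    rw [Finset.mem_range] at hi
    rw [show N + 1 - 1 - i = N - i by omega, show N - (N - i) = i by omega,
      Nat.cast_sub (by omega)]
    ring
  rw [e''] at e'
  rw [eq_comm, eq_neg_iff_add_eq_zero, ← two_mul] at e'
  exact (mul_eq_zero.mp e').resolve_left h2

/-- The operator is designed so that the weight at (m, N - m) and at (m - 3, N - 1) is the same
number 6(N - 2i) + m² - 5m; `rankCoeff_add` then applies termwise. The pentagonal terms at m = 0 and
m = 2 cancel by antisymmetry, and only i = N - 1 survives, giving a polynomial of degree two in m.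
-/
theorem bicoeff_heatRankSeries_add (h2 : (2 : k) ≠ 0) (m N : ℤ) :
    bicoeff (heatRankSeries k) m (N - m) + bicoeff (heatRankSeries k) (m - 3) (N - 1) =
      6 * (2 - N) * eulerCoeff k (N - 1) + m * (-5 * eulerCoeff k (N - 1)) +
        m ^ 2 * eulerCoeff k (N - 1) := by
  obtain ⟨n, hn⟩ : ∃ n : ℕ, N ≤ n ∧ N - m ≤ n ∧ N - 1 ≤ n :=
    ⟨(max N (max (N - m) (N - 1))).toNat, by omega⟩
  rw [bicoeff_heatRankSeries m hn.2.1, bicoeff_heatRankSeries (m - 3) hn.2.2,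
    ← Finset.sum_add_distrib]
  have e1 : ∀ i : ℕ, coeff i (pentagonalSeries k) *
        ((6 * ((N - m : ℤ) - 2 * i) + m ^ 2 + m) * rankCoeff k m (N - m - i)) +
      coeff i (pentagonalSeries k) * ((6 * ((N - 1 : ℤ) - 2 * i) + ((m - 3 : ℤ) : k) ^ 2 +
        ((m - 3 : ℤ) : k)) * rankCoeff k (m - 3) (N - 1 - i)) =
      coeff i (pentagonalSeries k) * ((6 * (N - m - 2 * i) + m ^ 2 + m) *
        (if N - i = 1 then 1 else 0)) +
      (if m = 0 then coeff i (pentagonalSeries k) * ((6 * (N - 2 * i)) * eulerCoeff k (N - i))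
        else 0) -
      (if m = 2 then coeff i (pentagonalSeries k) *
        ((6 * ((N - 1 : ℤ) - 2 * i)) * eulerCoeff k (N - 1 - i)) else 0) := by
    intro i
    have := rankCoeff_add h2 m (N - i)
    rw [show N - (i : ℤ) - m = N - m - i by ring, show N - (i : ℤ) - 1 = N - 1 - i by ring] at this
    trans coeff i (pentagonalSeries k) * ((6 * (N - m - 2 * i) + m ^ 2 + m) *
      (rankCoeff k m (N - m - i) + rankCoeff k (m - 3) (N - 1 - i)))
    · push_cast
      ring
    · rw [this]
      split_ifs with h1 h3 h4 h5 h6 h7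
      all_goals first | omega | (subst_vars; push_cast; ring)
  rw [Finset.sum_congr rfl fun i _ => e1 i, Finset.sum_sub_distrib, Finset.sum_add_distrib]
  have e2 : ∑ i ∈ Finset.range (n + 1), (if m = 0 then coeff i (pentagonalSeries k) *
      ((6 * (N - 2 * i)) * eulerCoeff k (N - i)) else 0) = 0 := by
    split_ifs
    · exact sum_eulerCoeff_antisymm h2 hn.1
    · simp
  have e3 : ∑ i ∈ Finset.range (n + 1), (if m = 2 then coeff i (pentagonalSeries k) *
      ((6 * ((N - 1 : ℤ) - 2 * i)) * eulerCoeff k (N - 1 - i)) else 0) = 0 := by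
    split_ifs
    · exact sum_eulerCoeff_antisymm h2 hn.2.2
    · simp
  rw [e2, e3, add_zero, sub_zero]
  rcases lt_or_ge (N - 1) 0 with hN | hN
  · rw [eulerCoeff, if_pos hN, Finset.sum_eq_zero]
    · ring
    · intro i _
      rw [if_neg (by omega)]
      ring
  · obtain ⟨t, rfl⟩ : ∃ t : ℕ, N = t + 1 := ⟨(N - 1).toNat, by omega⟩
    rw [Finset.sum_eq_single t]
    · rw [if_pos (by ring), add_sub_cancel_right, eulerCoeff, if_neg (by omega), Int.toNat_natCast]
      push_cast
      ring
    · intro i _ hi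
      rw [if_neg (by omega)]
      ring
    · intro h
      exact absurd (Finset.mem_range.mpr (by omega)) h

/-- The variable `z`, as a constant power series in `q`. -/
noncomputable def zVar (k : Type*) [Field k] : (LaurentSeries k)⟦X⟧ := C (HahnSeries.single 1 1)

/-- The rank-crank equation: up to a function of q, the heat operator sends the rank function to
z/θ³. The function c is never computed; only its independence of z matters. -/
theorem thetaSeries_pow_three_mul_heatRankSeries (h2 : (2 : k) ≠ 0) :
    ∃ c : k⟦X⟧, thetaSeries k ^ 3 * heatRankSeries k =
      PowerSeries.map HahnSeries.C c * zVar k := by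
  refine ⟨PowerSeries.mk fun n => bicoeff (thetaSeries k ^ 3 * heatRankSeries k) 1 n, ?_⟩
  apply ext_bicoeff
  intro m N
  have hb : ∀ N < 0, eulerCoeff k (N - 1) = 0 := fun N hN => if_pos (by omega)
  rcases lt_or_ge N 0 with hN | hN
  · rw [bicoeff_of_neg _ _ hN, bicoeff_of_neg _ _ hN]
  lift N to ℕ using hN
  rw [bicoeff_natCast _ _ N, bicoeff_natCast _ _ N, zVar, coeff_mul_C, coeff_map,
    HahnSeries.C_mul_eq_smul, HahnSeries.coeff_smul, HahnSeries.coeff_single, smul_eq_mul, coeff_mk,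
    ← bicoeff_natCast]
  by_cases hm : m = 1
  · subst hm; simp
  · rw [if_neg hm, mul_zero]
    exact thetaSeries_pow_three_mul h2 _ (fun N hN => by rw [hb N hN, mul_zero])
      (fun N hN => by rw [hb N hN, mul_zero]) hb (bicoeff_heatRankSeries_add h2) hm N

end ThetaProducts


/-! ### The logarithmic derivative of theta and its Burgers equation. -/

section LogarithmicDerivative

open PowerSeries

variable {k : Type*} [Field k]

/-- The logarithmic derivative of the theta series, as a Lambert series. -/
noncomputable def logThetaSeries (k : Type*) [Field k] : (LaurentSeries k)⟦X⟧ :=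
  -(C (HahnSeries.single 1 1 * geomLaurent k)) -
    lambertSeries fun i => HahnSeries.single (i : ℤ) 1 - HahnSeries.single (-(i : ℤ)) 1

/-- The coefficients of `logThetaSeries`. -/
noncomputable def logCoeff (k : Type*) [Field k] (m N : ℤ) : k :=
  if N < 0 then 0 else if 0 < m ∧ m ∣ N then -1 else if m < 0 ∧ 0 < N ∧ m ∣ N then 1 else 0

theorem bicoeff_logThetaSeries : bicoeff (logThetaSeries k) = logCoeff k := by
  funext m N
  rcases lt_or_ge N 0 with hN | hN
  · rw [bicoeff_of_neg _ _ hN, logCoeff, if_pos hN]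
  lift N to ℕ using hN
  rw [bicoeff_natCast, logCoeff, if_neg (by omega), logThetaSeries, map_sub, map_neg,
    HahnSeries.coeff_sub, HahnSeries.coeff_neg, lambertSeries, coeff_mk, HahnSeries.coeff_sum,
    coeff_C]
  rcases Nat.eq_zero_or_pos N with rfl | hN
  · have : (HahnSeries.single 1 1 * geomLaurent k : LaurentSeries k).coeff m =
        if 0 < m then 1 else 0 := by
      rw [HahnSeries.coeff_single_mul, coeff_geomLaurent, one_mul]
      exact if_congr (by omega) rfl rfl
    simp only [if_true, this]
    split_ifs <;> first | omega | simp_all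
  · rw [if_neg hN.ne']
    simp only [HahnSeries.coeff_zero, neg_zero, zero_sub]
    rcases lt_trichotomy m 0 with hm | rfl | hm
    · obtain ⟨i, rfl⟩ : ∃ i : ℕ, m = -i := ⟨m.natAbs, by omega⟩
      rw [if_neg (by omega)]
      have h1 : ∀ x ∈ N.divisors, (HahnSeries.single (x : ℤ) (1 : k) -
          HahnSeries.single (-(x : ℤ)) 1).coeff (-(i : ℤ)) = -if x = i then 1 else 0 := by
        intro x _
        rw [HahnSeries.coeff_sub, HahnSeries.coeff_single, HahnSeries.coeff_single]
        split_ifs <;> first | omega | simp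
      rw [Finset.sum_congr rfl h1, Finset.sum_neg_distrib, Finset.sum_ite_eq', neg_neg]
      refine if_congr ?_ rfl rfl
      rw [Nat.mem_divisors, neg_dvd, Int.natCast_dvd_natCast]
      exact ⟨fun h => ⟨hm, by omega, h.1⟩, fun h => ⟨h.2.2, hN.ne'⟩⟩
    · rw [if_neg (by omega), if_neg (by omega), Finset.sum_eq_zero, neg_zero]
      intro x _
      simp [HahnSeries.coeff_single, eq_comm]
    · lift m to ℕ using hm.le
      have h1 : ∀ x ∈ N.divisors, (HahnSeries.single (x : ℤ) (1 : k) -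
          HahnSeries.single (-(x : ℤ)) 1).coeff (m : ℤ) = if x = m then 1 else 0 := by
        intro x _
        rw [HahnSeries.coeff_sub, HahnSeries.coeff_single, HahnSeries.coeff_single]
        split_ifs <;> first | omega | simp
      rw [Finset.sum_congr rfl h1, Finset.sum_ite_eq']
      by_cases h : m ∣ N
      · rw [if_pos (Nat.mem_divisors.mpr ⟨h, hN.ne'⟩), if_pos ⟨hm, Int.natCast_dvd_natCast.mpr h⟩]
      · rw [if_neg (fun h' => h (Nat.mem_divisors.mp h').1),
          if_neg (fun h' => h (Int.natCast_dvd_natCast.mp h'.2)), if_neg (by omega), neg_zero]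

/-- In series form L(zq) = L(z) - 1 + Σ z^m, the logarithmic derivative of θ(zq) = -z⁻¹θ(z)
corrected by a delta function that θ annihilates. -/
theorem logCoeff_shear (m N : ℤ) :
    logCoeff k m (N - m) = logCoeff k m N - ((if m = 0 then 1 else 0) * (if N = 0 then 1 else 0) -
      if N = 0 then 1 else 0) := by
  rcases eq_or_ne m 0 with rfl | hm
  · simp
  rw [if_neg hm, zero_mul, zero_sub, sub_neg_eq_add]
  have hd : m ∣ N - m ↔ m ∣ N := by simp
  unfold logCoeff
  simp only [hd]
  rcases eq_or_ne N 0 with rfl | hN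
  · split_ifs <;> first | omega | (simp_all <;> omega)
  · rw [if_neg hN, add_zero]
    by_cases h : m ∣ N
    · have h1 := Int.le_of_dvd (a := m) (b := N)
      have h2 := Int.le_of_dvd (a := -m) (b := -N)
      simp only [h, neg_dvd, dvd_neg, forall_const] at h1 h2
      split_ifs <;> first | omega | simp_all
    · simp [h]

theorem logCoeff_add_neg (m N : ℤ) :
    logCoeff k m N + logCoeff k (-m) N =
      (if m = 0 then 1 else 0) * (if N = 0 then 1 else 0) - if N = 0 then 1 else 0 := by
  unfold logCoeff
  simp only [neg_dvd]
  split_ifs <;> first | omega | (simp_all <;> omega)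

theorem bicoeff_thetaSeries (m N : ℤ) :
    bicoeff (thetaSeries k) m N = altSign k m * if N = triangular m then 1 else 0 := by
  have h : bicoeff (1 : (LaurentSeries k)⟦X⟧) =
      fun m N => (if m = 0 then 1 else 0) * if N = 0 then 1 else 0 := by
    funext m N
    unfold bicoeff
    rcases lt_trichotomy N 0 with h | rfl | h
    · simp [h, h.ne]
    · simp
    · simp [h.ne', coeff_one, show ¬ N ≤ 0 by omega]
  rw [← mul_one (thetaSeries k), bicoeff_thetaSeries_mul, h, thetaOp,
    finsum_eq_single _ m (fun a ha => by rw [if_neg (by omega)]; ring)]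
  rw [if_pos (by ring), one_mul]
  congr 1
  exact if_congr (by omega) rfl rfl

theorem thetaOp_unit (m N : ℤ) :
    thetaOp (fun m N => (if m = 0 then 1 else 0) * if N = 0 then 1 else 0) m N =
      altSign k m * if N = triangular m then 1 else 0 := by
  rw [thetaOp, finsum_eq_single _ m (fun a ha => by rw [if_neg (by omega)]; ring)]
  rw [if_pos (by ring), one_mul]
  congr 1
  exact if_congr (by omega) rfl rfl

/-- No product formula is needed: the difference of the two sides transforms like θ under z ↦ zq,
hence is determined by its row m = 0, and that row vanishes by the reflection a ↦ 1 - a. -/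
theorem coeffD_laurentD_thetaSeries (h2 : (2 : k) ≠ 0) :
    coeffD (laurentD k) (thetaSeries k) = thetaSeries k * logThetaSeries k := by
  set u : ℤ → ℤ → k := fun m N => (if m = 0 then 1 else 0) * if N = 0 then 1 else 0 with hu
  set v : ℤ → ℤ → k := fun _ N => if N = 0 then 1 else 0 with hv
  have hub : IsBounded u := fun m N hN => by simp [hu, hN.ne]
  have hvb : IsBounded v := fun m N hN => by simp [hv, hN.ne]
  have huv : IsBounded fun m N => u m N - v m N := fun m N hN => by
    simp only [hub m N hN, hvb m N hN, sub_zero]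
  have hL : IsBounded (logCoeff k) := fun m N hN => if_pos hN
  have hv0 : thetaOp v = fun _ _ => 0 := thetaOp_const h2 fun N => if N = 0 then 1 else 0
  have hw : ∀ m N, thetaOp (fun m N => u m N - v m N) m N = bicoeff (thetaSeries k) m N := by
    intro m N
    rw [congrFun (congrFun (thetaOp_sub hub hvb) m) N, hv0, sub_zero, thetaOp_unit,
      bicoeff_thetaSeries]
  have hs : ∀ m N, bicoeff (thetaSeries k) m (N - m) = -bicoeff (thetaSeries k) (m + 1) N := by
    intro m N
    rw [bicoeff_thetaSeries, bicoeff_thetaSeries, altSign_succ, triangular_succ, neg_mul, neg_neg]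
    congr 1
    exact if_congr (by omega) rfl rfl
  have hsL : (fun m N => logCoeff k m (N - m)) = fun m N => logCoeff k m N - (u m N - v m N) := by
    funext m N
    exact logCoeff_shear m N
  have shear : ∀ m N : ℤ, (m * bicoeff (thetaSeries k) m (N - m) - thetaOp (logCoeff k) m (N - m)) =
      -((m + 1 : ℤ) * bicoeff (thetaSeries k) (m + 1) N - thetaOp (logCoeff k) (m + 1) N) := by
    intro m N
    rw [thetaOp_shear, hsL, congrFun (congrFun (thetaOp_sub hL huv) (m + 1)) N, hw, hs]
    push_cast
    ring
  have zero : ∀ N : ℤ, ((0 : ℤ) * bicoeff (thetaSeries k) 0 N - thetaOp (logCoeff k) 0 N) = 0 := by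
    intro N
    have e1 := shear 0 N
    -- Reflecting the summation index relates rows 1 and 0 through `logCoeff_add_neg`; combined with
    -- the shear relation `e1`, twice row 0 is zero.
    have e2 : thetaOp (logCoeff k) 1 N = thetaOp (logCoeff k) 0 N -
        thetaOp (fun m N => u m N - v m N) 0 N := by
      rw [← congrFun (congrFun (thetaOp_sub hL huv) 0) N]
      rw [thetaOp, thetaOp, ← finsum_comp_equiv (Equiv.subLeft (1 : ℤ))]
      refine finsum_congr fun a => ?_
      rw [Equiv.subLeft_apply, altSign_one_sub, triangular_one_sub, sub_sub_cancel, zero_sub]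
      have := logCoeff_add_neg (k := k) a (N - triangular a)
      have h0 : u (-a) (N - triangular a) = u a (N - triangular a) := by
        simp [hu]
      have h1 : v (-a) (N - triangular a) = v a (N - triangular a) := rfl
      rw [h0, h1]
      linear_combination (-altSign k a) * this
    rw [hw] at e2
    have e3 := hs 0 N
    rw [sub_zero, zero_add] at e1 e3
    rw [e2, e3] at e1
    have e4 := e3
    have : (2 : k) * thetaOp (logCoeff k) 0 N = 0 := by
      push_cast at e1
      linear_combination -e1
    rw [Int.cast_zero, (mul_eq_zero.mp this).resolve_left h2]
    ring
  apply ext_bicoeff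
  intro m N
  rw [bicoeff_coeffD_laurentD, bicoeff_thetaSeries_mul, bicoeff_logThetaSeries, ← sub_eq_zero]
  exact eq_zero_of_shear (F := fun m N => m * bicoeff (thetaSeries k) m N -
    thetaOp (logCoeff k) m N) shear zero m N

theorem thetaSeries_ne_zero : thetaSeries k ≠ 0 := by
  intro h
  have := bicoeff_thetaSeries (k := k) 0 0
  rw [h] at this
  simp [bicoeff, altSign_zero, triangular] at this

/-- The heat equation of the theta series. -/
theorem two_mul_eulerD_thetaSeries :
    2 * eulerD _ (thetaSeries k) = coeffD (laurentD k) (coeffD (laurentD k) (thetaSeries k)) -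
      coeffD (laurentD k) (thetaSeries k) := by
  apply ext_bicoeff
  intro m N
  rw [bicoeff_ofNat_mul, bicoeff_sub, bicoeff_eulerD, bicoeff_coeffD_laurentD,
    bicoeff_coeffD_laurentD, bicoeff_thetaSeries]
  split_ifs with h
  · have := congrArg (Int.cast (R := k)) (two_mul_triangular m)
    rw [← h] at this
    push_cast at this
    linear_combination altSign k m * this
  · ring

/-- The Cole–Hopf transformation: the z-derivative of the heat equation of θ is compared with the
q-derivative of z dθ/dz = θL, and the nonzero factor θ is cancelled. -/
theorem two_mul_eulerD_logThetaSeries (h2 : (2 : k) ≠ 0) :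
    2 * eulerD _ (logThetaSeries k) =
      coeffD (laurentD k) (coeffD (laurentD k) (logThetaSeries k)) +
      2 * logThetaSeries k * coeffD (laurentD k) (logThetaSeries k) -
      coeffD (laurentD k) (logThetaSeries k) := by
  have h1 := coeffD_laurentD_thetaSeries h2
  have hD := isLeibniz_eulerD (LaurentSeries k)
  have hd := isLeibniz_coeffD_laurentD (k := k)
  have heat := two_mul_eulerD_thetaSeries (k := k)
  set θ := thetaSeries k with hθ
  set L := logThetaSeries k with hL
  have h3 := congrArg (eulerD _) h1
  rw [eulerD_coeffD, hD] at h3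
  have h4 := congrArg (coeffD (laurentD k)) heat
  rw [hd.map_ofNat_mul, map_sub, h1, hd, h1, map_add, hd, hd, hd, h1] at h4
  rw [h1, hd, h1] at heat
  apply mul_left_cancel₀ (thetaSeries_ne_zero (k := k))
  rw [← hθ]
  linear_combination h4 - 2 * h3 - L * heat

/-- The product of the rank generating function with the heat operator is, up to a function of
`q`, the inverse cube of the theta series. -/
theorem coeffD_laurentD_heatRankSeries (h2 : (2 : k) ≠ 0) :
    coeffD (laurentD k) (heatRankSeries k) =
      (1 - 3 * logThetaSeries k) * heatRankSeries k := by
  obtain ⟨c, hc⟩ := thetaSeries_pow_three_mul_heatRankSeries h2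
  have hd := isLeibniz_coeffD_laurentD (k := k)
  have h1 := coeffD_laurentD_thetaSeries h2
  have hz : coeffD (laurentD k) (PowerSeries.map HahnSeries.C c * zVar k) =
      PowerSeries.map HahnSeries.C c * zVar k := by
    apply ext_bicoeff
    intro m N
    rw [bicoeff_coeffD_laurentD]
    unfold bicoeff
    split_ifs
    · simp
    · rw [zVar, coeff_mul_C, coeff_map, HahnSeries.C_mul_eq_smul, HahnSeries.coeff_smul,
        HahnSeries.coeff_single]
      split_ifs with h <;> simp [h]
  have h3 := congrArg (coeffD (laurentD k)) hc
  have hp : coeffD (laurentD k) (thetaSeries k ^ 3) = 3 * thetaSeries k ^ 2 *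
      coeffD (laurentD k) (thetaSeries k) := by
    rw [hd.map_pow_succ]
    norm_num
  rw [hz, hd, hp, h1] at h3
  apply mul_left_cancel₀ (pow_ne_zero 3 (thetaSeries_ne_zero (k := k)))
  linear_combination h3 - hc

end LogarithmicDerivative


/-! ### The symmetric variable X = z - 2 + z⁻¹. -/

section SymmetricVariable

open PowerSeries

/-- The sequence of polynomials with initial terms `a`, `b` and the recursion of the sequences
`z ^ i`, `z ^ (-i)`, in the variable `z - 2 + z⁻¹`. -/
noncomputable def symmetricPoly (k : Type*) [Field k] (a b : Polynomial k) : ℕ → Polynomial k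
  | 0 => a
  | 1 => b
  | i + 2 => (Polynomial.X + 2) * symmetricPoly k a b (i + 1) - symmetricPoly k a b i

variable {k : Type*} [Field k]

local notation "zz" => (HahnSeries.single (1 : ℤ) (1 : k) : LaurentSeries k)
local notation "zi" => (HahnSeries.single (-1 : ℤ) (1 : k) : LaurentSeries k)

theorem single_one_mul_single_neg_one : zz * zi = 1 := by
  rw [HahnSeries.single_mul_single]
  simp

/-- The substitution of `z - 2 + z⁻¹` for the variable of a polynomial. -/
noncomputable def symmetricEval (k : Type*) [Field k] : Polynomial k →+* LaurentSeries k :=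
  Polynomial.eval₂RingHom HahnSeries.C (HahnSeries.single 1 1 - 2 + HahnSeries.single (-1) 1)

theorem symmetricEval_C (a : k) : symmetricEval k (Polynomial.C a) = HahnSeries.C a := by
  simp [symmetricEval]

theorem symmetricEval_X : symmetricEval k Polynomial.X = zz - 2 + zi := by
  simp [symmetricEval]

theorem symmetricEval_X_pow (i : ℕ) :
    symmetricEval k Polynomial.X ^ i = HahnSeries.single (-(i : ℤ)) 1 *
      HahnSeries.ofPowerSeries ℤ k ((1 - X) ^ (2 * i)) := by
  have h : symmetricEval k Polynomial.X = zi * HahnSeries.ofPowerSeries ℤ k ((1 - X) ^ 2) := by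
    rw [symmetricEval_X, map_pow, map_sub, map_one (HahnSeries.ofPowerSeries ℤ k),
      HahnSeries.ofPowerSeries_X]
    linear_combination (2 - zz) * single_one_mul_single_neg_one (k := k)
  rw [h, mul_pow, HahnSeries.single_pow, pow_mul, ← map_pow]
  simp

/-- X^i equals z^(-i)(1 - z)^(2i), so the coefficient of z^(-d) for a polynomial of degree d is its
leading coefficient. -/
theorem symmetricEval_injective : Function.Injective (symmetricEval k) := by
  rw [injective_iff_map_eq_zero]
  intro p hp
  by_contra h
  apply Polynomial.leadingCoeff_ne_zero.mpr h
  have h1 : ∀ i ∈ Finset.range (p.natDegree + 1),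
      (HahnSeries.C (p.coeff i) * symmetricEval k Polynomial.X ^ i).coeff (-(p.natDegree : ℤ)) =
        if i = p.natDegree then p.coeff i else 0 := by
    intro i hi
    rw [Finset.mem_range] at hi
    rw [HahnSeries.C_mul_eq_smul, HahnSeries.coeff_smul, symmetricEval_X_pow,
      HahnSeries.coeff_single_mul, one_mul, smul_eq_mul]
    split_ifs with hi'
    · rw [hi', sub_self, ← Nat.cast_zero, HahnSeries.ofPowerSeries_apply_coeff]
      simp
    · rw [HahnSeries.ofPowerSeries_apply, HahnSeries.embDomain_of_notMem_range, mul_zero]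
      rintro ⟨n, hn⟩
      simp at hn
      omega
  have h2 : symmetricEval k p = ∑ i ∈ Finset.range (p.natDegree + 1),
      HahnSeries.C (p.coeff i) * symmetricEval k Polynomial.X ^ i := by
    conv_lhs => rw [p.as_sum_range_C_mul_X_pow]
    simp [map_sum, symmetricEval_C]
  have h3 := congrArg (fun f => f.coeff (-(p.natDegree : ℤ))) h2
  simp only [HahnSeries.coeff_sum] at h3
  rw [hp, Finset.sum_congr rfl h1, Finset.sum_ite_eq'] at h3
  simpa [eq_comm] using h3

theorem laurentD_symmetricEval (p : Polynomial k) :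
    laurentD k (symmetricEval k p) = (zz - zi) * symmetricEval k (Polynomial.derivative p) := by
  have hX : laurentD k (symmetricEval k Polynomial.X) = zz - zi := by
    rw [symmetricEval_X, map_add, map_sub, laurentD_single, laurentD_single,
      (isLeibniz_laurentD k).map_ofNat_eq_zero]
    simp [sub_eq_add_neg]
  have hC : ∀ a : k, laurentD k (HahnSeries.C a) = 0 := by
    intro a
    rw [HahnSeries.C_apply, laurentD_single]
    simp
  induction p using Polynomial.induction_on with
  | C a => rw [symmetricEval_C, hC]; simp
  | add p q hp hq => simp [hp, hq, mul_add]
  | monomial n a _ =>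
    rw [map_mul, map_pow, isLeibniz_laurentD, symmetricEval_C, hC,
      (isLeibniz_laurentD k).map_pow_succ, hX, Polynomial.derivative_C_mul_X_pow]
    simp only [map_mul, map_pow, symmetricEval_C, Nat.add_sub_cancel, Nat.cast_succ, map_add,
      map_natCast, map_one]
    ring

/-- Both sides obey w_{i+2} = (z + z⁻¹)w_{i+1} - w_i, and z + z⁻¹ = X + 2. The factor c clears the
denominator: 1 - z⁻¹ for the rank function, z - z⁻¹ for L. -/
theorem symmetricEval_symmetricPoly (a b : Polynomial k) (c u v : LaurentSeries k)
    (h0 : c * symmetricEval k a = u + v) (h1 : c * symmetricEval k b = u * zz + v * zi) (i : ℕ) :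
    c * symmetricEval k (symmetricPoly k a b i) =
      u * HahnSeries.single (i : ℤ) 1 + v * HahnSeries.single (-(i : ℤ)) 1 := by
  have hp : ∀ i : ℕ, (HahnSeries.single (i : ℤ) 1 : LaurentSeries k) = zz ^ i := by
    intro i; rw [HahnSeries.single_pow]; simp
  have hn : ∀ i : ℕ, (HahnSeries.single (-(i : ℤ)) 1 : LaurentSeries k) = zi ^ i := by
    intro i; rw [HahnSeries.single_pow]; simp
  rw [hp, hn]
  induction i using Nat.twoStepInduction with
  | zero => rw [symmetricPoly, h0]; ring
  | one => rw [symmetricPoly, h1]; ring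
  | more i h2 h3 =>
    rw [symmetricPoly, map_sub, map_mul, map_add, symmetricEval_X, map_ofNat]
    linear_combination (zz + zi) * h3 - h2 +
      (u * zz ^ i + v * zi ^ i) * single_one_mul_single_neg_one (k := k)

/-- The generating function of `rankSeries` after removal of the factor `1 - z⁻¹`. -/
noncomputable def rankSymm (k : Type*) [Field k] : (Polynomial k)⟦X⟧ :=
  appellSeries (symmetricPoly k 1 (Polynomial.X + 3))

/-- The series `logThetaSeries` after removal of the factor `z - z⁻¹`. -/
noncomputable def logSymm (k : Type*) [Field k] : (Polynomial k)⟦X⟧ :=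
  lambertSeries (symmetricPoly k 0 1)

theorem rankSeries_eq : rankSeries k = C (geomLaurent k) +
    C (1 - zi) * PowerSeries.map (symmetricEval k) (rankSymm k) := by
  rw [rankSeries, rankSymm, map_appellSeries, C_mul_appellSeries]
  congr 2
  funext i
  rw [symmetricEval_symmetricPoly _ _ _ 1 (-zi)]
  · rw [neg_mul, HahnSeries.single_mul_single, one_mul, one_mul, ← sub_eq_add_neg,
      show -1 + -(i : ℤ) = -(i : ℤ) - 1 by ring]
  · simp [sub_eq_add_neg]
  · rw [map_add, symmetricEval_X, map_ofNat]
    linear_combination (zi - 1) * single_one_mul_single_neg_one (k := k) -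
      single_one_mul_single_neg_one (k := k) * zi

theorem logThetaSeries_eq : logThetaSeries k = -C (zz * geomLaurent k) -
    C (zz - zi) * PowerSeries.map (symmetricEval k) (logSymm k) := by
  rw [logThetaSeries, logSymm, map_lambertSeries, C_mul_lambertSeries]
  congr 2
  funext i
  rw [symmetricEval_symmetricPoly _ _ _ 1 (-1)]
  · rw [one_mul, neg_one_mul, ← sub_eq_add_neg]
  · simp
  · simp [sub_eq_add_neg]

end SymmetricVariable


/-! ### The two differential equations in the variable X. -/

section SymmetricEquations

open PowerSeries

variable {k : Type*} [Field k]

/-- The derivative of a polynomial, as an additive map. -/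
noncomputable def polyD (k : Type*) [Field k] : Polynomial k →+ Polynomial k where
  toFun p := Polynomial.derivative p
  map_zero' := Polynomial.derivative_zero
  map_add' _ _ := Polynomial.derivative_add

theorem polyD_apply (p : Polynomial k) : polyD k p = Polynomial.derivative p := rfl

theorem isLeibniz_polyD : IsLeibniz (polyD k) := by
  intro a b
  simp only [polyD_apply, Polynomial.derivative_mul]
  ring

/-- Differentiation in the symmetric variable. -/
noncomputable def symmD (k : Type*) [Field k] : (Polynomial k)⟦X⟧ →+ (Polynomial k)⟦X⟧ :=
  coeffD (polyD k)

theorem isLeibniz_symmD : IsLeibniz (symmD k) := isLeibniz_polyD.coeffD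

theorem coeffD_laurentD_map_symmetricEval (f : (Polynomial k)⟦X⟧) :
    coeffD (laurentD k) (PowerSeries.map (symmetricEval k) f) =
      C (HahnSeries.single 1 1 - HahnSeries.single (-1) 1) *
        PowerSeries.map (symmetricEval k) (symmD k f) :=
  coeffD_map (symmetricEval k) (laurentD k) (polyD k) _ laurentD_symmetricEval f

/-- The differential operator in the symmetric variable which corresponds to the action of
`(z d/dz) ^ 2 + z d/dz` on multiples of `1 - z⁻¹`. -/
noncomputable def symmHeat (f : (Polynomial k)⟦X⟧) : (Polynomial k)⟦X⟧ :=
  C (Polynomial.X ^ 2 + 4 * Polynomial.X) * symmD k (symmD k f) +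
    C (2 * Polynomial.X + 6) * symmD k f

/-- The image of the rank generating function under the heat operator, in the symmetric variable.
-/
noncomputable def heatSymm (k : Type*) [Field k] : (Polynomial k)⟦X⟧ :=
  PowerSeries.map Polynomial.C (pentagonalSeries k) *
      (2 - C (Polynomial.X ^ 2) * (6 * eulerD _ (rankSymm k) + symmHeat (rankSymm k))) -
    6 * PowerSeries.map Polynomial.C (eulerD k (pentagonalSeries k)) *
      (C Polynomial.X - C (Polynomial.X ^ 2) * rankSymm k)

theorem coeffD_laurentD_C_single_one :
    coeffD (laurentD k) (C (HahnSeries.single (1 : ℤ) (1 : k))) =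
      C (HahnSeries.single (1 : ℤ) (1 : k)) := by
  rw [coeffD_C, laurentD_single]; simp

theorem coeffD_laurentD_C_single_neg_one :
    coeffD (laurentD k) (C (HahnSeries.single (-1 : ℤ) (1 : k))) =
      -C (HahnSeries.single (-1 : ℤ) (1 : k)) := by
  rw [coeffD_C, laurentD_single]; simp

theorem C_single_mul_C_single :
    (C (HahnSeries.single (1 : ℤ) (1 : k)) : (LaurentSeries k)⟦X⟧) *
      C (HahnSeries.single (-1 : ℤ) (1 : k)) = 1 := by
  rw [← map_mul, single_one_mul_single_neg_one, map_one]

theorem C_geomLaurent_mul :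
    (C (geomLaurent k) : (LaurentSeries k)⟦X⟧) * (1 - C (HahnSeries.single (1 : ℤ) (1 : k))) =
      1 := by
  rw [← map_one (C (R := LaurentSeries k)), ← map_sub, ← map_mul, geomLaurent_mul, map_one]

theorem coeffD_laurentD_C_geomLaurent :
    coeffD (laurentD k) (C (geomLaurent k)) =
      C (HahnSeries.single (1 : ℤ) (1 : k)) * C (geomLaurent k) ^ 2 := by
  have h := C_geomLaurent_mul (k := k)
  have h1 := congrArg (coeffD (laurentD k)) h
  have hz := coeffD_laurentD_C_single_one (k := k)
  rw [isLeibniz_coeffD_laurentD, map_sub, isLeibniz_coeffD_laurentD.map_one_eq_zero, hz] at h1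
  linear_combination C (geomLaurent k) * h1 - coeffD (laurentD k) (C (geomLaurent k)) * h

theorem map_symmetricEval_C_X : PowerSeries.map (symmetricEval k) (C Polynomial.X) =
    C (HahnSeries.single (1 : ℤ) (1 : k)) - 2 + C (HahnSeries.single (-1 : ℤ) (1 : k)) := by
  rw [PowerSeries.map_C, symmetricEval_X, map_add, map_sub, map_ofNat]

/-- The cube removes the pole at z = 1, of order three after two derivatives of 1/(1 - z); what is
left is z times a symmetric expression. -/
theorem one_sub_pow_three_mul_heatRankSeries :
    (1 - C (HahnSeries.single (1 : ℤ) (1 : k))) ^ 3 * heatRankSeries k =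
      C (HahnSeries.single (1 : ℤ) (1 : k)) * PowerSeries.map (symmetricEval k) (heatSymm k) := by
  have hd := isLeibniz_coeffD_laurentD (k := k)
  have hg := C_geomLaurent_mul (k := k)
  have hz := C_single_mul_C_single (k := k)
  have hdg := coeffD_laurentD_C_geomLaurent (k := k)
  have hdz := coeffD_laurentD_C_single_one (k := k)
  have hdw := coeffD_laurentD_C_single_neg_one (k := k)
  have hX := map_symmetricEval_C_X (k := k)
  have hM := coeffD_laurentD_map_symmetricEval (k := k)
  have hC : ∀ f : k⟦X⟧, PowerSeries.map (symmetricEval k) (PowerSeries.map Polynomial.C f) =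
      PowerSeries.map HahnSeries.C f := by
    intro f
    ext1 n
    simp [symmetricEval_C]
  have hS := rankSeries_eq (k := k)
  rw [map_sub, map_one] at hS
  simp only [map_sub] at hM
  have hSD : eulerD _ (rankSeries k) = (1 - C (HahnSeries.single (-1 : ℤ) (1 : k))) *
      PowerSeries.map (symmetricEval k) (eulerD _ (rankSymm k)) := by
    rw [hS, map_add, isLeibniz_eulerD, map_sub, (isLeibniz_eulerD _).map_one_eq_zero, eulerD_C,
      eulerD_C, eulerD_map]
    ring
  have hSd : coeffD (laurentD k) (rankSeries k) = C (HahnSeries.single (1 : ℤ) (1 : k)) *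
      C (geomLaurent k) ^ 2 + (C (HahnSeries.single (-1 : ℤ) (1 : k)) *
      PowerSeries.map (symmetricEval k) (rankSymm k) +
      (1 - C (HahnSeries.single (-1 : ℤ) (1 : k))) * ((C (HahnSeries.single (1 : ℤ) (1 : k)) -
      C (HahnSeries.single (-1 : ℤ) (1 : k))) *
      PowerSeries.map (symmetricEval k) (symmD k (rankSymm k)))) := by
    rw [hS, map_add, hdg, hd, map_sub, hd.map_one_eq_zero, hdw, hM]
    ring
  have hSdd : coeffD (laurentD k) (coeffD (laurentD k) (rankSeries k)) =
      C (HahnSeries.single (1 : ℤ) (1 : k)) * C (geomLaurent k) ^ 2 +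
      2 * C (HahnSeries.single (1 : ℤ) (1 : k)) ^ 2 * C (geomLaurent k) ^ 3 +
      (-C (HahnSeries.single (-1 : ℤ) (1 : k)) *
        PowerSeries.map (symmetricEval k) (rankSymm k) +
      (2 * C (HahnSeries.single (-1 : ℤ) (1 : k)) *
        (C (HahnSeries.single (1 : ℤ) (1 : k)) - C (HahnSeries.single (-1 : ℤ) (1 : k))) +
        (1 - C (HahnSeries.single (-1 : ℤ) (1 : k))) *
        (C (HahnSeries.single (1 : ℤ) (1 : k)) + C (HahnSeries.single (-1 : ℤ) (1 : k)))) *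
        PowerSeries.map (symmetricEval k) (symmD k (rankSymm k)) +
      (1 - C (HahnSeries.single (-1 : ℤ) (1 : k))) * (C (HahnSeries.single (1 : ℤ) (1 : k)) -
      C (HahnSeries.single (-1 : ℤ) (1 : k))) ^ 2 *
      PowerSeries.map (symmetricEval k) (symmD k (symmD k (rankSymm k)))) := by
    rw [hSd, map_add, map_add, hd, hd, hd, hd, hd.map_pow_succ, hdg, hdz, hdw, hM, hM, map_sub,
      map_sub, hd.map_one_eq_zero, hdz, hdw]
    ring
  have hH : PowerSeries.map (symmetricEval k) (symmHeat (rankSymm k)) =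
      ((PowerSeries.map (symmetricEval k) (C Polynomial.X)) ^ 2 +
        4 * PowerSeries.map (symmetricEval k) (C Polynomial.X)) *
        PowerSeries.map (symmetricEval k) (symmD k (symmD k (rankSymm k))) +
      (2 * PowerSeries.map (symmetricEval k) (C Polynomial.X) + 6) *
        PowerSeries.map (symmetricEval k) (symmD k (rankSymm k)) := by
    simp only [symmHeat, map_add, map_mul, map_pow, map_ofNat]
  rw [heatRankSeries, hSdd, hSd, hSD, heatSymm]
  simp only [map_sub, map_mul, map_add, map_pow, map_ofNat, hC]
  rw [hH, hS, hX]
  generalize PowerSeries.map (symmetricEval k) (symmD k (symmD k (rankSymm k))) = b2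
  generalize PowerSeries.map (symmetricEval k) (symmD k (rankSymm k)) = b1
  generalize PowerSeries.map (symmetricEval k) (eulerD _ (rankSymm k)) = bD
  generalize PowerSeries.map (symmetricEval k) (rankSymm k) = b0
  generalize PowerSeries.map (HahnSeries.C : k →+* LaurentSeries k) (pentagonalSeries k) = e
  generalize PowerSeries.map (HahnSeries.C : k →+* LaurentSeries k) (eulerD k (pentagonalSeries k))
    = e'
  generalize C (geomLaurent k) = g at hg
  generalize (C (HahnSeries.single (1 : ℤ) (1 : k)) : (LaurentSeries k)⟦X⟧) = x at hz hg
  generalize (C (HahnSeries.single (-1 : ℤ) (1 : k)) : (LaurentSeries k)⟦X⟧) = w at hz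
  -- With all series generalized, this is a polynomial identity modulo xw = 1 and g(1 - x) = 1.
  grind

theorem coeffD_laurentD_one_sub_pow :
    coeffD (laurentD k) ((1 - C (HahnSeries.single (1 : ℤ) (1 : k))) ^ 3) =
      -3 * C (HahnSeries.single (1 : ℤ) (1 : k)) *
        (1 - C (HahnSeries.single (1 : ℤ) (1 : k))) ^ 2 := by
  have hd := isLeibniz_coeffD_laurentD (k := k)
  rw [hd.map_pow_succ, map_sub, hd.map_one_eq_zero, coeffD_laurentD_C_single_one]
  push_cast
  ring

theorem map_symmetricEval_injective :
    Function.Injective (PowerSeries.map (symmetricEval k)) := by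
  intro f g h
  ext1 n
  apply symmetricEval_injective
  rw [← coeff_map, h, coeff_map]

theorem C_single_sub_C_single_ne_zero : (C (HahnSeries.single (1 : ℤ) (1 : k)) -
    C (HahnSeries.single (-1 : ℤ) (1 : k)) : (LaurentSeries k)⟦X⟧) ≠ 0 := by
  rw [← map_sub]
  intro h
  have h1 := congrArg (fun f => (coeff 0 f).coeff 1) h
  simp at h1

theorem C_single_ne_zero (m : ℤ) :
    (C (HahnSeries.single m (1 : k)) : (LaurentSeries k)⟦X⟧) ≠ 0 := by
  intro h
  have h1 := congrArg (fun f => (coeff 0 f).coeff m) h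
  simp at h1

/-- Put V = zT/(1 - z)³ into z dV/dz = (1 - 3L)V. The polar part -z/(1 - z) of L accounts exactly
for the prefactor, and z d/dz acts on symmetric series as (z - z⁻¹) d/dX, so T' = 3lT remains. -/
theorem symmD_heatSymm (h2 : (2 : k) ≠ 0) :
    symmD k (heatSymm k) = 3 * logSymm k * heatSymm k := by
  have hd := isLeibniz_coeffD_laurentD (k := k)
  have hg := C_geomLaurent_mul (k := k)
  have hV := one_sub_pow_three_mul_heatRankSeries (k := k)
  have hdV := coeffD_laurentD_heatRankSeries h2
  have hM := coeffD_laurentD_map_symmetricEval (heatSymm k)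
  have hL := logThetaSeries_eq (k := k)
  have h1 := congrArg (coeffD (laurentD k)) hV
  have hne := mul_ne_zero (C_single_sub_C_single_ne_zero (k := k)) (C_single_ne_zero (k := k) 1)
  rw [hd, hd, coeffD_laurentD_one_sub_pow, coeffD_laurentD_C_single_one, hdV, hL, hM] at h1
  apply map_symmetricEval_injective
  apply mul_left_cancel₀ hne
  simp only [map_sub, map_mul, map_ofNat] at h1 ⊢
  generalize PowerSeries.map (symmetricEval k) (symmD k (heatSymm k)) = T' at *
  generalize PowerSeries.map (symmetricEval k) (heatSymm k) = T at *
  generalize PowerSeries.map (symmetricEval k) (logSymm k) = l at *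
  generalize heatRankSeries k = V at *
  generalize C (geomLaurent k) = g at *
  generalize (C (HahnSeries.single (1 : ℤ) (1 : k)) : (LaurentSeries k)⟦X⟧) = x at *
  generalize (C (HahnSeries.single (-1 : ℤ) (1 : k)) : (LaurentSeries k)⟦X⟧) = w at *
  linear_combination -h1 + (1 + 3 * (x - w) * l) * hV + 3 * x * V * (1 - x) ^ 2 * hg

/-- Burgers' equation for the logarithmic derivative of the theta series. -/
theorem two_mul_eulerD_logSymm (h2 : (2 : k) ≠ 0) :
    2 * eulerD _ (logSymm k) =
      C (Polynomial.X ^ 2 + 4 * Polynomial.X) * symmD k (symmD k (logSymm k)) +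
      C (4 * Polynomial.X + 10) * symmD k (logSymm k) + 2 * logSymm k -
      C (2 * Polynomial.X + 4) * logSymm k ^ 2 -
      2 * C (Polynomial.X ^ 2 + 4 * Polynomial.X) * (logSymm k * symmD k (logSymm k)) := by
  have hd := isLeibniz_coeffD_laurentD (k := k)
  have hg := C_geomLaurent_mul (k := k)
  have hz := C_single_mul_C_single (k := k)
  have hdg := coeffD_laurentD_C_geomLaurent (k := k)
  have hdz := coeffD_laurentD_C_single_one (k := k)
  have hdw := coeffD_laurentD_C_single_neg_one (k := k)
  have hX := map_symmetricEval_C_X (k := k)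
  have hM := coeffD_laurentD_map_symmetricEval (k := k)
  have hL := logThetaSeries_eq (k := k)
  have hB := two_mul_eulerD_logThetaSeries h2
  simp only [map_sub, map_mul] at hM hL
  have hLD : eulerD _ (logThetaSeries k) = -((C (HahnSeries.single (1 : ℤ) (1 : k)) -
      C (HahnSeries.single (-1 : ℤ) (1 : k))) *
      PowerSeries.map (symmetricEval k) (eulerD _ (logSymm k))) := by
    rw [hL, map_sub, map_neg, ← map_mul, eulerD_C, ← map_sub, isLeibniz_eulerD, eulerD_C,
      eulerD_map]
    ring
  set g : (LaurentSeries k)⟦X⟧ := C (geomLaurent k) with hgdef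
  set x : (LaurentSeries k)⟦X⟧ := C (HahnSeries.single (1 : ℤ) (1 : k)) with hx
  set w : (LaurentSeries k)⟦X⟧ := C (HahnSeries.single (-1 : ℤ) (1 : k)) with hw
  have hL1 : coeffD (laurentD k) (logThetaSeries k) = -(x * g + x ^ 2 * g ^ 2) -
      ((x + w) * PowerSeries.map (symmetricEval k) (logSymm k) +
        (x - w) ^ 2 * PowerSeries.map (symmetricEval k) (symmD k (logSymm k))) := by
    rw [hL, map_sub, map_neg, hd, hd, hdg, map_sub, hdz, hdw, hM]
    ring
  have hL2 : coeffD (laurentD k) (coeffD (laurentD k) (logThetaSeries k)) =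
      -(x * g + 3 * x ^ 2 * g ^ 2 + 2 * x ^ 3 * g ^ 3) -
      ((x - w) * PowerSeries.map (symmetricEval k) (logSymm k) +
        3 * (x + w) * (x - w) * PowerSeries.map (symmetricEval k) (symmD k (logSymm k)) +
        (x - w) ^ 3 * PowerSeries.map (symmetricEval k) (symmD k (symmD k (logSymm k)))) := by
    rw [hL1, map_sub, map_neg, map_add, map_add, hd, hd, hd, hd, hd.map_pow_succ _ 1,
      hd.map_pow_succ _ 1, hd.map_pow_succ _ 1, hdg, map_add, map_sub, hdz, hdw, hM, hM]
    push_cast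
    ring
  rw [hL2, hL1, hLD, hL] at hB
  apply map_symmetricEval_injective
  apply mul_left_cancel₀ (C_single_sub_C_single_ne_zero (k := k))
  simp only [map_sub, map_mul, map_add, map_pow, map_ofNat, hX]
  clear hL2 hL1 hLD hL hX hM hdw hdz hdg hd
  generalize PowerSeries.map (symmetricEval k) (symmD k (symmD k (logSymm k))) = l2 at *
  generalize PowerSeries.map (symmetricEval k) (symmD k (logSymm k)) = l1 at *
  generalize PowerSeries.map (symmetricEval k) (eulerD _ (logSymm k)) = lD at *
  generalize PowerSeries.map (symmetricEval k) (logSymm k) = l at *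
  clear_value g x w
  grind

end SymmetricEquations


/-! ### Recursions for the coefficients in X. -/

section SymmetricCoefficients

open PowerSeries

variable {k : Type*} [Field k]

/-- The coefficient of a power of the symmetric variable. -/
noncomputable def symmCoeff (j : ℕ) : (Polynomial k)⟦X⟧ →+ k⟦X⟧ where
  toFun f := PowerSeries.mk fun n => (coeff n f).coeff j
  map_zero' := by ext n; simp
  map_add' f g := by ext n; simp

theorem coeff_symmCoeff (j n : ℕ) (f : (Polynomial k)⟦X⟧) :
    coeff n (symmCoeff j f) = (coeff n f).coeff j := by
  simp [symmCoeff]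

theorem symmCoeff_mul (j : ℕ) (f g : (Polynomial k)⟦X⟧) :
    symmCoeff j (f * g) = ∑ p ∈ Finset.HasAntidiagonal.antidiagonal j,
      symmCoeff p.1 f * symmCoeff p.2 g := by
  ext n
  simp only [coeff_symmCoeff, coeff_mul, Polynomial.finsetSum_coeff, Polynomial.coeff_mul, map_sum]
  rw [Finset.sum_comm]

theorem symmCoeff_map_C_mul (j : ℕ) (a : k⟦X⟧) (f : (Polynomial k)⟦X⟧) :
    symmCoeff j (PowerSeries.map Polynomial.C a * f) = a * symmCoeff j f := by
  ext n
  simp [coeff_symmCoeff, coeff_mul, Polynomial.finsetSum_coeff]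

theorem symmCoeff_natCast_mul (j n : ℕ) (f : (Polynomial k)⟦X⟧) :
    symmCoeff j ((n : (Polynomial k)⟦X⟧) * f) = (n : k⟦X⟧) * symmCoeff j f := by
  rw [← nsmul_eq_mul, map_nsmul, nsmul_eq_mul]

theorem symmCoeff_ofNat_mul (j n : ℕ) [n.AtLeastTwo] (f : (Polynomial k)⟦X⟧) :
    symmCoeff j (ofNat(n) * f) = ofNat(n) * symmCoeff j f :=
  symmCoeff_natCast_mul j n f

theorem symmCoeff_X_mul_zero (f : (Polynomial k)⟦X⟧) : symmCoeff 0 (C Polynomial.X * f) = 0 := by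
  ext n
  simp [coeff_symmCoeff]

theorem symmCoeff_X_mul_succ (j : ℕ) (f : (Polynomial k)⟦X⟧) :
    symmCoeff (j + 1) (C Polynomial.X * f) = symmCoeff j f := by
  ext n
  simp [coeff_symmCoeff]

theorem symmCoeff_symmD (j : ℕ) (f : (Polynomial k)⟦X⟧) :
    symmCoeff j (symmD k f) = (j + 1) * symmCoeff (j + 1) f := by
  ext n
  rw [coeff_symmCoeff, symmD, coeff_coeffD, polyD_apply, Polynomial.coeff_derivative]
  rw [← Nat.cast_succ (R := k⟦X⟧), ← nsmul_eq_mul, map_nsmul, nsmul_eq_mul, coeff_symmCoeff]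
  push_cast
  ring

theorem symmCoeff_X_mul_symmD (j : ℕ) (f : (Polynomial k)⟦X⟧) :
    symmCoeff j (C Polynomial.X * symmD k f) = (j : k⟦X⟧) * symmCoeff j f := by
  cases j with
  | zero => simp [symmCoeff_X_mul_zero]
  | succ j => rw [symmCoeff_X_mul_succ, symmCoeff_symmD]; push_cast; ring

theorem symmCoeff_X_mul_X_mul_symmD_symmD (j : ℕ) (f : (Polynomial k)⟦X⟧) :
    symmCoeff j (C Polynomial.X * (C Polynomial.X * symmD k (symmD k f))) =
      (j : k⟦X⟧) * ((j : k⟦X⟧) - 1) * symmCoeff j f := by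
  cases j with
  | zero => simp [symmCoeff_X_mul_zero]
  | succ j => rw [symmCoeff_X_mul_succ, symmCoeff_X_mul_symmD, symmCoeff_symmD]; push_cast; ring

theorem symmCoeff_eulerD (j : ℕ) (f : (Polynomial k)⟦X⟧) :
    symmCoeff j (eulerD _ f) = eulerD k (symmCoeff j f) := by
  ext n
  rw [coeff_symmCoeff, coeff_eulerD, coeff_eulerD, coeff_symmCoeff, ← nsmul_eq_mul,
    Polynomial.coeff_smul, nsmul_eq_mul]

theorem symmCoeff_map_C_zero (f : k⟦X⟧) : symmCoeff 0 (PowerSeries.map Polynomial.C f) = f := by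
  ext n
  simp [coeff_symmCoeff]

theorem symmCoeff_map_C_succ (j : ℕ) (f : k⟦X⟧) :
    symmCoeff (j + 1) (PowerSeries.map Polynomial.C f) = 0 := by
  ext n
  simp [coeff_symmCoeff, Polynomial.coeff_C_succ]

theorem symmCoeff_symmHeat (j : ℕ) (f : (Polynomial k)⟦X⟧) :
    symmCoeff j (symmHeat f) = j * (j + 1) * symmCoeff j f +
      (2 * j + 2) * (2 * j + 3) * symmCoeff (j + 1) f := by
  have e : symmHeat f = C Polynomial.X * (C Polynomial.X * symmD k (symmD k f)) +
      4 * (C Polynomial.X * symmD k (symmD k f)) + 2 * (C Polynomial.X * symmD k f) +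
      6 * symmD k f := by
    rw [symmHeat]
    simp only [map_add, map_mul, map_pow, map_ofNat]
    ring
  simp only [e, map_add, symmCoeff_ofNat_mul, symmCoeff_X_mul_X_mul_symmD_symmD,
    symmCoeff_X_mul_symmD, symmCoeff_symmD]
  ring

/-- The coefficients of `logSymm`. -/
noncomputable def logLambert (k : Type*) [Field k] (j : ℕ) : k⟦X⟧ := symmCoeff j (logSymm k)

/-- The coefficients of `rankSymm`. -/
noncomputable def rankMoment (k : Type*) [Field k] (j : ℕ) : k⟦X⟧ := symmCoeff j (rankSymm k)

theorem heatSymm_eq : heatSymm k = 2 * PowerSeries.map Polynomial.C (pentagonalSeries k) -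
    C Polynomial.X * (6 * PowerSeries.map Polynomial.C (eulerD k (pentagonalSeries k))) +
    C Polynomial.X * (C Polynomial.X * (6 * (PowerSeries.map Polynomial.C
      (eulerD k (pentagonalSeries k)) * rankSymm k) -
      PowerSeries.map Polynomial.C (pentagonalSeries k) *
        (6 * eulerD _ (rankSymm k) + symmHeat (rankSymm k)))) := by
  rw [heatSymm, map_pow]
  ring

theorem symmCoeff_heatSymm_zero : symmCoeff 0 (heatSymm k) = 2 * pentagonalSeries k := by
  rw [heatSymm_eq, map_add, map_sub, symmCoeff_X_mul_zero, symmCoeff_X_mul_zero,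
    symmCoeff_ofNat_mul, symmCoeff_map_C_zero]
  ring

theorem symmCoeff_heatSymm_one :
    symmCoeff 1 (heatSymm k) = -6 * eulerD k (pentagonalSeries k) := by
  rw [heatSymm_eq, map_add, map_sub, symmCoeff_X_mul_succ, symmCoeff_X_mul_succ,
    symmCoeff_X_mul_zero, symmCoeff_ofNat_mul, symmCoeff_ofNat_mul, symmCoeff_map_C_zero,
    symmCoeff_map_C_succ]
  ring

theorem symmCoeff_heatSymm_add_two (j : ℕ) : symmCoeff (j + 2) (heatSymm k) =
    6 * (eulerD k (pentagonalSeries k) * rankMoment k j) - pentagonalSeries k *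
      (6 * eulerD k (rankMoment k j) + (j * (j + 1) * rankMoment k j +
        (2 * j + 2) * (2 * j + 3) * rankMoment k (j + 1))) := by
  rw [heatSymm_eq, map_add, map_sub, symmCoeff_X_mul_succ, symmCoeff_X_mul_succ,
    symmCoeff_X_mul_succ, symmCoeff_ofNat_mul, symmCoeff_ofNat_mul, symmCoeff_map_C_succ,
    symmCoeff_map_C_succ, map_sub, symmCoeff_ofNat_mul, symmCoeff_map_C_mul, symmCoeff_map_C_mul,
    map_add, symmCoeff_ofNat_mul, symmCoeff_eulerD, symmCoeff_symmHeat]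
  simp only [rankMoment]
  ring

theorem symmCoeff_heatSymm_succ (h2 : (2 : k) ≠ 0) (j : ℕ) :
    (j + 1) * symmCoeff (j + 1) (heatSymm k) = 3 * ∑ p ∈ Finset.HasAntidiagonal.antidiagonal j,
      logLambert k p.1 * symmCoeff p.2 (heatSymm k) := by
  rw [← symmCoeff_symmD, symmD_heatSymm h2, mul_assoc, symmCoeff_ofNat_mul, symmCoeff_mul]
  rfl

/-- The sums `∑_{i ≤ j} l i * l (j - i)` of products of the coefficients of `logSymm`. -/
noncomputable def logLambertSq (k : Type*) [Field k] (j : ℕ) : k⟦X⟧ :=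
  ∑ p ∈ Finset.HasAntidiagonal.antidiagonal j, logLambert k p.1 * logLambert k p.2

theorem two_mul_eulerD_logSymm' (h2 : (2 : k) ≠ 0) :
    2 * eulerD _ (logSymm k) =
      C Polynomial.X * (C Polynomial.X * symmD k (symmD k (logSymm k))) +
      4 * (C Polynomial.X * symmD k (symmD k (logSymm k))) +
      4 * (C Polynomial.X * symmD k (logSymm k)) + 10 * symmD k (logSymm k) + 2 * logSymm k -
      2 * (C Polynomial.X * (logSymm k * logSymm k)) - 4 * (logSymm k * logSymm k) -
      C Polynomial.X * (C Polynomial.X * symmD k (logSymm k * logSymm k)) -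
      4 * (C Polynomial.X * symmD k (logSymm k * logSymm k)) := by
  rw [two_mul_eulerD_logSymm h2, isLeibniz_symmD]
  simp only [map_add, map_mul, map_pow, map_ofNat]
  ring

theorem two_mul_eulerD_logLambert_zero (h2 : (2 : k) ≠ 0) :
    2 * eulerD k (logLambert k 0) =
      2 * logLambert k 0 + 10 * logLambert k 1 - 4 * logLambertSq k 0 := by
  have h := congrArg (symmCoeff 0) (two_mul_eulerD_logSymm' h2)
  simp only [map_add, map_sub, symmCoeff_ofNat_mul, symmCoeff_eulerD,
    symmCoeff_X_mul_zero, symmCoeff_symmD] at h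
  simp only [symmCoeff_mul] at h
  rw [logLambert, h]
  simp only [logLambertSq, logLambert]
  push_cast
  ring

/-- The coefficients of the Burgers equation. In characteristic p the recursion closes up when 2j +
7 = p: the highest term drops out and a differential relation among lower ones remains. -/
theorem two_mul_eulerD_logLambert_succ (h2 : (2 : k) ≠ 0) (j : ℕ) :
    2 * eulerD k (logLambert k (j + 1)) = (j + 2) * ((j + 3) * logLambert k (j + 1) +
      2 * (2 * j + 7) * logLambert k (j + 2) - logLambertSq k j - 4 * logLambertSq k (j + 1)) := by
  have h := congrArg (symmCoeff (j + 1)) (two_mul_eulerD_logSymm' h2)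
  simp only [map_add, map_sub, symmCoeff_ofNat_mul, symmCoeff_eulerD,
    symmCoeff_X_mul_X_mul_symmD_symmD, symmCoeff_X_mul_symmD] at h
  rw [symmCoeff_X_mul_succ, symmCoeff_X_mul_succ, symmCoeff_X_mul_symmD, symmCoeff_symmD] at h
  have hs : ∀ j, symmCoeff j (logSymm k * logSymm k) = logLambertSq k j := fun j =>
    symmCoeff_mul j _ _
  rw [hs, hs] at h
  rw [logLambert, h]
  simp only [logLambert]
  push_cast
  ring

/-- The operator which becomes `6 q d/dq + r` after multiplication by the generating function of
the partition numbers. -/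
noncomputable def twistedD (k : Type*) [Field k] (r : ℕ) (f : k⟦X⟧) : k⟦X⟧ :=
  6 * eulerD k f + 6 * logLambert k 0 * f + r * f

theorem constantCoeff_pentagonalSeries : constantCoeff (pentagonalSeries k) = 1 := by
  have h := coeff_pentagonalSeries_pentagonal k 0
  have h0 : pentagonal 0 = 0 := rfl
  rw [h0] at h
  simpa using h

/-- The lowest coefficient of T' = 3lT, with T₀ = 2e and T₁ = -6De, is Euler's recursion for the
pentagonal series. -/
theorem eulerD_pentagonalSeries (h2 : (2 : k) ≠ 0) (h3 : (3 : k) ≠ 0) :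
    eulerD k (pentagonalSeries k) = -logLambert k 0 * pentagonalSeries k := by
  have h := symmCoeff_heatSymm_succ h2 0
  simp only [Finset.Nat.antidiagonal_zero, Finset.sum_singleton, zero_add, Nat.cast_zero, one_mul,
    symmCoeff_heatSymm_zero, symmCoeff_heatSymm_one] at h
  have h6 : (6 : k⟦X⟧) ≠ 0 := by
    rw [← map_ofNat (C (R := k)), Ne, map_eq_zero_iff _ C_injective]
    rw [show (6 : k) = 2 * 3 by norm_num]
    exact mul_ne_zero h2 h3
  apply mul_left_cancel₀ h6
  linear_combination -h

/-- E is T/(2e), so it solves E' = 3lE with E₀ = 1 and is determined by the l_i while division by j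
+ 1 is possible. The factor (2j+2)(2j+3) on the next moment is what vanishes modulo t at 2j + 3 = t.
-/
theorem exists_rankMoment_recursion (h2 : (2 : k) ≠ 0) (h3 : (3 : k) ≠ 0) :
    ∃ E : ℕ → k⟦X⟧, E 0 = 1 ∧
      (∀ j : ℕ, ((j : k⟦X⟧) + 1) * E (j + 1) = 3 * ∑ p ∈ Finset.HasAntidiagonal.antidiagonal j,
        logLambert k p.1 * E p.2) ∧
      ∀ j : ℕ, 2 * E (j + 2) = -(twistedD k (j * (j + 1)) (rankMoment k j) +
        (2 * j + 2) * (2 * j + 3) * rankMoment k (j + 1)) := by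
  have hu : pentagonalSeries k * (pentagonalSeries k)⁻¹ = 1 := by
    apply PowerSeries.mul_inv_cancel
    simp [constantCoeff_pentagonalSeries]
  have h2' : C (2⁻¹ : k) * 2 = 1 := by
    rw [← map_ofNat (C (R := k)), ← map_mul, inv_mul_cancel₀ h2, map_one]
  -- Dividing by e turns De into -l₀e, which is the source of the term 6l₀f in `twistedD`.
  refine ⟨fun j => C 2⁻¹ * (pentagonalSeries k)⁻¹ * symmCoeff j (heatSymm k), ?_, ?_, ?_⟩
  · beta_reduce
    rw [symmCoeff_heatSymm_zero]
    linear_combination C 2⁻¹ * 2 * hu + h2'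
  · intro j
    have h := symmCoeff_heatSymm_succ h2 j
    trans C 2⁻¹ * (pentagonalSeries k)⁻¹ * (((j : k⟦X⟧) + 1) * symmCoeff (j + 1) (heatSymm k))
    · ring
    · rw [h, Finset.mul_sum, Finset.mul_sum, Finset.mul_sum]
      refine Finset.sum_congr rfl fun p _ => ?_
      ring
  · intro j
    beta_reduce
    rw [symmCoeff_heatSymm_add_two, eulerD_pentagonalSeries h2 h3, twistedD]
    push_cast
    linear_combination (-(6 * eulerD k (rankMoment k j) + 6 * logLambert k 0 * rankMoment k j +
      (j * (j + 1) * rankMoment k j + (2 * j + 2) * (2 * j + 3) * rankMoment k (j + 1)))) *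
        (h2' * pentagonalSeries k * (pentagonalSeries k)⁻¹ + hu)

end SymmetricCoefficients


/-! ### Binomial Lambert series, power sums and Fermat's theorem. -/

section BinomialCoefficients

open PowerSeries

variable {k : Type*} [Field k]

theorem symmetricPoly_coeff (i j : ℕ) :
    (symmetricPoly k 0 1 i).coeff j = ((i + j).choose (2 * j + 1) : k) := by
  induction i using Nat.twoStepInduction generalizing j with
  | zero => simp [symmetricPoly, Nat.choose_eq_zero_of_lt (show j < 2 * j + 1 by omega)]
  | one =>
    rw [symmetricPoly, Polynomial.coeff_one]
    split_ifs with h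
    · simp [h]
    · rw [Nat.choose_eq_zero_of_lt (by omega), Nat.cast_zero]
  | more i h1 h2 =>
    rw [symmetricPoly, Polynomial.coeff_sub, add_mul, Polynomial.coeff_add,
      Polynomial.coeff_ofNat_mul, h1, h2]
    cases j with
    | zero =>
      rw [Polynomial.mul_coeff_zero]
      simp
      ring
    | succ j =>
      rw [Polynomial.coeff_X_mul, h2]
      have e : (i + 2 + (j + 1)).choose (2 * (j + 1) + 1) + (i + (j + 1)).choose (2 * (j + 1) + 1) =
          (i + 1 + j).choose (2 * j + 1) + 2 * (i + 1 + (j + 1)).choose (2 * (j + 1) + 1) := by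
        have p1 := Nat.choose_succ_succ (i + j + 2) (2 * j + 2)
        have p2 := Nat.choose_succ_succ (i + j + 1) (2 * j + 1)
        have p3 := Nat.choose_succ_succ (i + j + 1) (2 * j + 2)
        simp only [Nat.succ_eq_add_one, show i + j + 2 + 1 = i + 2 + (j + 1) by ring,
          show i + j + 1 + 1 = i + j + 2 by ring, show 2 * j + 2 + 1 = 2 * (j + 1) + 1 by ring,
          show 2 * j + 1 + 1 = 2 * j + 2 by ring] at p1 p2 p3
        rw [show i + (j + 1) = i + j + 1 by ring, show i + 1 + j = i + j + 1 by ring,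
          show i + 1 + (j + 1) = i + j + 2 by ring]
        omega
      have e' := congrArg (Nat.cast (R := k)) e
      push_cast at e'
      linear_combination -e'

theorem symmetricPoly_rank_coeff_zero (i : ℕ) :
    (symmetricPoly k 1 (Polynomial.X + 3) i).coeff 0 = 2 * i + 1 := by
  induction i using Nat.twoStepInduction with
  | zero => simp [symmetricPoly]
  | one => simp [symmetricPoly]; norm_num
  | more i h1 h2 =>
    rw [symmetricPoly, Polynomial.coeff_sub, Polynomial.mul_coeff_zero, h1, h2]
    simp
    ring

theorem logLambert_eq (j : ℕ) :
    logLambert k j = lambertSeries fun i => ((i + j).choose (2 * j + 1) : k) := by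
  ext N
  simp [logLambert, coeff_symmCoeff, logSymm, lambertSeries, Polynomial.finsetSum_coeff,
    symmetricPoly_coeff]

theorem rankMoment_zero : rankMoment k 0 = appellSeries fun i => 2 * (i : k) + 1 := by
  ext N
  rw [rankMoment, coeff_symmCoeff, rankSymm, appellSeries, appellSeries, coeff_mk, coeff_mk,
    Polynomial.finsetSum_coeff]
  refine Finset.sum_congr rfl fun j _ => ?_
  rw [Polynomial.finsetSum_coeff]
  refine Finset.sum_congr rfl fun i _ => ?_
  split_ifs
  · rw [Polynomial.mul_coeff_zero, symmetricPoly_rank_coeff_zero,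
      Polynomial.coeff_zero_eq_eval_zero]
    simp
  · simp

theorem lambertSeries_pow (r : ℕ) : lambertSeries (fun i => (i : k) ^ r) = divisorSeries k r := rfl

theorem logLambert_zero : logLambert k 0 = divisorSeries k 1 := by
  rw [logLambert_eq, ← lambertSeries_pow]
  simp

theorem choose_add_succ_mul (i j : ℕ) :
    (2 * j + 2) * (2 * j + 3) * ((i + (j + 1)).choose (2 * (j + 1) + 1) : k) =
      ((i : k) ^ 2 - (j + 1) ^ 2) * ((i + j).choose (2 * j + 1) : k) := by
  have h1 := congrArg (Nat.cast (R := k)) (Nat.add_one_mul_choose_eq (i + j) (2 * j + 2))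
  have h2 := congrArg (Nat.cast (R := k)) (Nat.choose_succ_right_eq (i + j) (2 * j + 1))
  have h3 : ((i + j).choose (2 * j + 1) : k) * ((i + j - (2 * j + 1) : ℕ) : k) =
      (i + j).choose (2 * j + 1) * (i - j - 1) := by
    rcases Nat.lt_or_ge (i + j) (2 * j + 1) with h | h
    · rw [Nat.choose_eq_zero_of_lt h]; simp
    · rw [Nat.cast_sub h]; push_cast; ring
  push_cast at h1 h2 h3
  rw [h3] at h2
  rw [show i + (j + 1) = i + j + 1 by ring, show 2 * (j + 1) + 1 = 2 * j + 2 + 1 by ring]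
  linear_combination -(2 * (j : k) + 2) * h1 + (i + j + 1) * h2

/-- Multiplication by i² climbs one step in the basis of binomials C(i + j, 2j + 1). Starting from i
itself, iteration gives the expansions of odd powers used below to write σ₃, …, σ₁₁ in the l_j. -/
theorem sq_mul_choose (i j : ℕ) : (i : k) ^ 2 * ((i + j).choose (2 * j + 1) : k) =
    (2 * j + 2) * (2 * j + 3) * ((i + (j + 1)).choose (2 * (j + 1) + 1) : k) +
      (j + 1) ^ 2 * ((i + j).choose (2 * j + 1) : k) := by
  linear_combination -choose_add_succ_mul (k := k) i j

theorem pow_three_eq_choose (i : ℕ) : (i : k) ^ 3 = ((i + 0).choose (2 * 0 + 1) : k) + 6 * ((i +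
  1).choose (2 * 1 + 1) : k) := by
  have h := sq_mul_choose (k := k) i 0
  norm_num at h ⊢
  linear_combination h

theorem pow_five_eq_choose (i : ℕ) : (i : k) ^ 5 = ((i + 0).choose (2 * 0 + 1) : k) + 30 * ((i +
  1).choose (2 * 1 + 1) : k) + 120 * ((i + 2).choose (2 * 2 + 1) : k) := by
  have h0 := sq_mul_choose (k := k) i 0
  have h1 := sq_mul_choose (k := k) i 1
  norm_num at h0 h1 ⊢
  have h := pow_three_eq_choose (k := k) i
  norm_num at h
  linear_combination (i : k) ^ 2 * h + h0 + 6 * h1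

theorem pow_seven_eq_choose (i : ℕ) : (i : k) ^ 7 = ((i + 0).choose (2 * 0 + 1) : k) + 126 * ((i +
  1).choose (2 * 1 + 1) : k) + 1680 * ((i + 2).choose (2 * 2 + 1) : k) + 5040 * ((i +
  3).choose (2 * 3 + 1) : k) := by
  have h0 := sq_mul_choose (k := k) i 0
  have h1 := sq_mul_choose (k := k) i 1
  have h2 := sq_mul_choose (k := k) i 2
  norm_num at h0 h1 h2 ⊢
  have h := pow_five_eq_choose (k := k) i
  norm_num at h
  linear_combination (i : k) ^ 2 * h + h0 + 30 * h1 + 120 * h2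

theorem pow_nine_eq_choose (i : ℕ) : (i : k) ^ 9 = ((i + 0).choose (2 * 0 + 1) : k) + 510 * ((i +
  1).choose (2 * 1 + 1) : k) + 17640 * ((i + 2).choose (2 * 2 + 1) : k) + 151200 * ((i +
  3).choose (2 * 3 + 1) : k) + 362880 * ((i + 4).choose (2 * 4 + 1) : k) := by
  have h0 := sq_mul_choose (k := k) i 0
  have h1 := sq_mul_choose (k := k) i 1
  have h2 := sq_mul_choose (k := k) i 2
  have h3 := sq_mul_choose (k := k) i 3
  norm_num at h0 h1 h2 h3 ⊢
  have h := pow_seven_eq_choose (k := k) i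
  norm_num at h
  linear_combination (i : k) ^ 2 * h + h0 + 126 * h1 + 1680 * h2 + 5040 * h3

theorem pow_eleven_eq_choose (i : ℕ) : (i : k) ^ 11 = ((i + 0).choose (2 * 0 + 1) : k) +
  2046 * ((i + 1).choose (2 * 1 + 1) : k) + 168960 * ((i + 2).choose (2 * 2 + 1) : k) +
  3160080 * ((i + 3).choose (2 * 3 + 1) : k) + 19958400 * ((i + 4).choose (2 * 4 + 1) : k) +
  39916800 * ((i + 5).choose (2 * 5 + 1) : k) := by
  have h0 := sq_mul_choose (k := k) i 0
  have h1 := sq_mul_choose (k := k) i 1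
  have h2 := sq_mul_choose (k := k) i 2
  have h3 := sq_mul_choose (k := k) i 3
  have h4 := sq_mul_choose (k := k) i 4
  norm_num at h0 h1 h2 h3 h4 ⊢
  have h := pow_nine_eq_choose (k := k) i
  norm_num at h
  linear_combination (i : k) ^ 2 * h + h0 + 510 * h1 + 17640 * h2 + 151200 * h3 + 362880 * h4

theorem divisorSeries_three_eq : divisorSeries k 3 = logLambert k 0 + 6 * logLambert k 1 := by
  simp only [← map_ofNat (C (R := k)), logLambert_eq, C_mul_lambertSeries]
  ext N
  simp only [map_add, divisorSeries, lambertSeries, coeff_mk, ← Finset.sum_add_distrib]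
  exact Finset.sum_congr rfl fun i _ => pow_three_eq_choose i

theorem divisorSeries_five_eq : divisorSeries k 5 = logLambert k 0 + 30 * logLambert k 1 +
  120 * logLambert k 2 := by
  simp only [← map_ofNat (C (R := k)), logLambert_eq, C_mul_lambertSeries]
  ext N
  simp only [map_add, divisorSeries, lambertSeries, coeff_mk, ← Finset.sum_add_distrib]
  exact Finset.sum_congr rfl fun i _ => pow_five_eq_choose i

theorem divisorSeries_seven_eq : divisorSeries k 7 = logLambert k 0 + 126 * logLambert k 1 +
  1680 * logLambert k 2 + 5040 * logLambert k 3 := by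
  simp only [← map_ofNat (C (R := k)), logLambert_eq, C_mul_lambertSeries]
  ext N
  simp only [map_add, divisorSeries, lambertSeries, coeff_mk, ← Finset.sum_add_distrib]
  exact Finset.sum_congr rfl fun i _ => pow_seven_eq_choose i

theorem divisorSeries_eleven_eq : divisorSeries k 11 = logLambert k 0 + 2046 * logLambert k 1 +
  168960 * logLambert k 2 + 3160080 * logLambert k 3 + 19958400 * logLambert k 4 +
  39916800 * logLambert k 5 := by
  simp only [← map_ofNat (C (R := k)), logLambert_eq, C_mul_lambertSeries]
  ext N
  simp only [map_add, divisorSeries, lambertSeries, coeff_mk, ← Finset.sum_add_distrib]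
  exact Finset.sum_congr rfl fun i _ => pow_eleven_eq_choose i

/-- If n = de is prime to p, then n·d^(p-2) = e·d^(p-1) = e, and n^(p-1) = 1; summing over divisors
gives σ₁(n). If p divides n, both coefficients are zero. -/
theorem eulerD_divisorSeries_card_sub_two (p : ℕ) [Fact p.Prime] (hp : 3 ≤ p) :
    eulerD _ (divisorSeries (ZMod p) (p - 2)) =
      (eulerD (ZMod p))^[p - 1] (divisorSeries (ZMod p) 1) := by
  have hit : ∀ (m : ℕ) (f : (ZMod p)⟦X⟧) (n : ℕ),
      coeff n ((eulerD (ZMod p))^[m] f) = (n : ZMod p) ^ m * coeff n f := by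
    intro m
    induction m with
    | zero => intro f n; simp
    | succ m ih => intro f n; rw [Function.iterate_succ_apply', coeff_eulerD, ih]; ring
  ext n
  rw [coeff_eulerD, hit, divisorSeries, divisorSeries, coeff_mk, coeff_mk]
  by_cases hn : (n : ZMod p) = 0
  · rw [hn, zero_mul, zero_pow (by omega), zero_mul]
  · rw [ZMod.pow_card_sub_one_eq_one hn, one_mul, Finset.mul_sum,
      ← Nat.sum_div_divisors n fun d => (d : ZMod p) ^ 1]
    refine Finset.sum_congr rfl fun d hd => ?_
    obtain ⟨e, rfl⟩ := Nat.dvd_of_mem_divisors hd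
    have hd0 : (d : ZMod p) ≠ 0 := by
      intro h
      simp [h] at hn
    have hd1 : 0 < d := Nat.pos_of_ne_zero fun h => by simp [h] at hd0
    rw [Nat.mul_div_cancel_left _ hd1]
    have := ZMod.pow_card_sub_one_eq_one hd0
    rw [show p - 1 = p - 2 + 1 by omega, pow_succ] at this
    push_cast
    linear_combination (e : ZMod p) * this

theorem divisorSeries_add_card_sub_one (p : ℕ) [Fact p.Prime] (r : ℕ) (hr : r ≠ 0) :
    divisorSeries (ZMod p) (r + (p - 1)) = divisorSeries (ZMod p) r := by
  ext n
  rw [divisorSeries, divisorSeries, coeff_mk, coeff_mk]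
  refine Finset.sum_congr rfl fun d _ => ?_
  by_cases hd : (d : ZMod p) = 0
  · rw [hd, zero_pow hr, zero_pow (by omega)]
  · rw [pow_add, ZMod.pow_card_sub_one_eq_one hd, mul_one]

end BinomialCoefficients


/-! ### Differential algebra modulo 5 and 7. -/

section FinalIdentities

open PowerSeries

theorem IsLeibniz.map_pow_eq {R : Type*} [CommRing R] {d : R →+ R} (h : IsLeibniz d) (a : R)
    (n : ℕ) : d (a ^ n) = n * a ^ (n - 1) * d a := by
  cases n with
  | zero => simp [h.map_one_eq_zero]
  | succ n => rw [h.map_pow_succ]; simp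

/-- Eliminating through `r0` and `r1` turns f_j into a multiple of β_j plus a polynomial in the
Lambert series; the multiple of β₂ is 20·72 ≡ 0. The polynomials become explicit once D is known on
a and b. -/
theorem twisted_identity_five {A : Type*} [CommRing A] [CharP A 5] {D : A →+ A} (hD : IsLeibniz D)
    {a b c β₀ β₁ β₂ E₁ E₂ E₃ : A} (hB0 : 2 * D a = 2 * a + 10 * b - 4 * (a * a))
    (hB1 : 2 * D b = 2 * (3 * b + 14 * c - a * a - 4 * (a * b + b * a)))
    (hF : D (a + 6 * b) = D (D (D (D a))))
    (e1 : E₁ = 3 * a) (e2 : 2 * E₂ = 3 * (a * E₁ + b)) (e3 : 3 * E₃ = 3 * (a * E₂ + b * E₁ + c))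
    (r0 : 2 * E₂ = -(6 * D β₀ + 6 * a * β₀ + 6 * β₁))
    (r1 : 2 * E₃ = -(6 * D β₁ + 6 * a * β₁ + 2 * β₁ + 20 * β₂)) {f₀ f₁ f₂ : A}
    (h0 : f₀ = 12 * β₀ + 36 * a - 1) (h1 : f₁ = 6 * D f₀ + 6 * a * f₀)
    (h2 : f₂ = 6 * D f₁ + 6 * a * f₁ + 2 * f₁) : f₂ = 0 := by
  -- The term 10b vanishes modulo 5, so a generates a differential ring by itself; this is E₄ ≡ 1
  -- modulo 5.
  have ha : D a = a - 2 * a ^ 2 := by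
    linear_combination (norm := (ring_nf; reduce_mod_char!)) 3 * hB0
  have hp := fun n => hD.map_pow_eq a n
  simp only [ha] at hp
  have ha2 : D (D a) = a - 2 * a ^ 3 - a ^ 2 := by
    rw [ha]
    simp only [map_sub, hD.map_ofNat_mul, hp, ha, Nat.cast_ofNat, Nat.reduceSub]
    linear_combination (norm := (ring_nf; reduce_mod_char!))
  have ha3 : D (D (D a)) = 2 * a ^ 4 - 2 * a ^ 3 + a ^ 2 + a := by
    rw [ha2]
    simp only [map_sub, hD.map_ofNat_mul, hp, ha, Nat.cast_ofNat, Nat.reduceSub]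
    linear_combination (norm := (ring_nf; reduce_mod_char!))
  have hb : D b = 2 * a ^ 2 - a ^ 5 := by
    rw [ha3] at hF
    simp only [map_sub, map_add, hD.map_ofNat_mul, hp, ha, Nat.cast_ofNat, Nat.reduceSub] at hF
    linear_combination (norm := (ring_nf; reduce_mod_char!)) hF
  -- c involves binomials with lower index 5, out of reach of power sums modulo 5; it is recovered
  -- from the Burgers relation once Fermat's theorem has supplied Db.
  have hc : c = a ^ 5 + 2 * a ^ 2 + 2 * a * b - 2 * b := by
    linear_combination (norm := (ring_nf; reduce_mod_char!)) 3 * hB1 - hb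
  have he2 : E₂ = 2 * a ^ 2 - b := by
    rw [e1] at e2
    linear_combination (norm := (ring_nf; reduce_mod_char!)) 3 * e2
  have he3 : E₃ = a ^ 5 + 2 * a ^ 3 + 2 * a ^ 2 - a * b - 2 * b := by
    rw [e1, he2, hc] at e3
    linear_combination (norm := (ring_nf; reduce_mod_char!)) 2 * e3
  have hf1 : f₁ = -72 * β₁ + (a ^ 2 - b) := by
    rw [h1, h0, map_sub, map_add, hD.map_ofNat_mul, hD.map_ofNat_mul, hD.map_one_eq_zero, ha]
    rw [he2] at r0
    linear_combination (norm := (ring_nf; reduce_mod_char!)) 12 * r0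
  rw [h2, hf1, map_add, neg_mul, map_neg, map_sub, hD.map_ofNat_mul, hp, hb]
  rw [he3] at r1
  linear_combination (norm := (ring_nf; reduce_mod_char!)) -72 * r1

set_option linter.unusedSimpArgs false

/-- The same elimination, with a and b generating the differential ring because 14c ≡ 0; the term
42β₃ vanishes. The relation `hQ`, which is E₄² = E₈ ≡ E₂ modulo 7, is needed only to cancel the
final residue. -/
theorem twisted_identity_seven {A : Type*} [CommRing A] [CharP A 7] {D : A →+ A} (hD : IsLeibniz D)
    {a b c d β₀ β₁ β₂ β₃ E₁ E₂ E₃ E₄ : A} (hB0 : 2 * D a = 2 * a + 10 * b - 4 * (a * a))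
    (hB1 : 2 * D b = 2 * (3 * b + 14 * c - a * a - 4 * (a * b + b * a)))
    (hB2 : 2 * D c = 3 * (4 * c + 18 * d - (a * b + b * a) - 4 * (a * c + b * b + c * a)))
    (hF : D (a + 30 * b + 120 * c) = D (D (D (D (D (D a))))))
    (hQ : a = a + 6 * b + 120 * (a + 6 * b) ^ 2)
    (e1 : E₁ = 3 * a) (e2 : 2 * E₂ = 3 * (a * E₁ + b)) (e3 : 3 * E₃ = 3 * (a * E₂ + b * E₁ + c))
    (e4 : 4 * E₄ = 3 * (a * E₃ + b * E₂ + c * E₁ + d))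
    (r0 : 2 * E₂ = -(6 * D β₀ + 6 * a * β₀ + 6 * β₁))
    (r1 : 2 * E₃ = -(6 * D β₁ + 6 * a * β₁ + 2 * β₁ + 20 * β₂))
    (r2 : 2 * E₄ = -(6 * D β₂ + 6 * a * β₂ + 6 * β₂ + 42 * β₃)) {f₀ f₁ f₂ f₃ : A}
    (h0 : f₀ = 12 * β₀ + 36 * a - 1) (h1 : f₁ = 6 * D f₀ + 6 * a * f₀)
    (h2 : f₂ = 6 * D f₁ + 6 * a * f₁ + 2 * f₁) (h3 : f₃ = 6 * D f₂ + 6 * a * f₂ + 6 * f₂) :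
    f₃ = 0 := by
  have ha : D a = a - 2 * a ^ 2 - 2 * b := by
    linear_combination (norm := (ring_nf; reduce_mod_char!)) 4 * hB0
  have hb : D b = 3 * b - a ^ 2 - a * b := by
    linear_combination (norm := (ring_nf; reduce_mod_char!)) 4 * hB1
  have hp := fun n => hD.map_pow_eq a n
  have hq := fun n => hD.map_pow_eq b n
  have ha2 : D (D a) = a ^ 3 + 3 * a ^ 2 + 3 * a * b + a - b := by
    rw [ha]
    simp only [map_sub, map_add, map_neg, hD _ _, hp, hq, hD.map_ofNat_eq_zero, hD.map_one_eq_zero,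
      ha, hb,
      Nat.cast_ofNat, Nat.reduceSub]
    linear_combination (norm := (ring_nf; reduce_mod_char!))
  have ha3 : D (D (D a)) = a ^ 4 + 2 * a ^ 3 - a ^ 2 * b - 2 * a ^ 2 + a * b + a + b ^ 2 +
    2 * b := by
    rw [ha2]
    simp only [map_sub, map_add, map_neg, hD _ _, hp, hq, hD.map_ofNat_eq_zero, hD.map_one_eq_zero,
      ha, hb,
      Nat.cast_ofNat, Nat.reduceSub]
    linear_combination (norm := (ring_nf; reduce_mod_char!))
  have ha4 : D (D (D (D a))) = 2 * a * b ^ 2 + 3 * a * b + a - a ^ 5 - 3 * a ^ 3 * b - a ^ 3 -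
    a ^ 2 * b - a ^ 2 - 3 * b ^ 2 - 3 * b := by
    rw [ha3]
    simp only [map_sub, map_add, map_neg, hD _ _, hp, hq, hD.map_ofNat_eq_zero, hD.map_one_eq_zero,
      ha, hb,
      Nat.cast_ofNat, Nat.reduceSub]
    linear_combination (norm := (ring_nf; reduce_mod_char!))
  have ha5 : D (D (D (D (D a)))) = 3 * a ^ 6 - 2 * a ^ 5 + 3 * a ^ 4 * b - 3 * a ^ 3 * b -
    2 * a ^ 3 + 3 * a ^ 2 * b ^ 2 - 2 * a ^ 2 * b - a ^ 2 + 3 * a * b ^ 2 - 2 * a * b + a +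
    3 * b ^ 3 - 3 * b ^ 2 + 3 * b := by
    rw [ha4]
    simp only [map_sub, map_add, map_neg, hD _ _, hp, hq, hD.map_ofNat_eq_zero, hD.map_one_eq_zero,
      ha, hb,
      Nat.cast_ofNat, Nat.reduceSub]
    linear_combination (norm := (ring_nf; reduce_mod_char!))
  have hc : D c = 2 * a * b + 3 * b - a ^ 7 - 3 * a ^ 2 := by
    rw [ha5] at hF
    simp only [map_sub, map_add, map_neg, hD _ _, hp, hq, hD.map_ofNat_eq_zero, hD.map_one_eq_zero,
      ha, hb,
      Nat.cast_ofNat, Nat.reduceSub] at hF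
    linear_combination (norm := (ring_nf; reduce_mod_char!)) hF
  have hd : d = a ^ 7 + 3 * a ^ 2 + 2 * a * b + 2 * a * c + b ^ 2 - 3 * b - c := by
    linear_combination (norm := (ring_nf; reduce_mod_char!)) 4 * hB2 - hc
  have he2 : E₂ = a ^ 2 - 2 * b := by
    linear_combination (norm := (ring_nf; reduce_mod_char!)) 4 * e2 + 5 * a * e1
  have he3 : E₃ = a ^ 3 + a * b + c := by
    linear_combination (norm := (ring_nf; reduce_mod_char!)) 5 * e3 + a * he2 + b * e1
  have he4 : E₄ = a * c + b ^ 2 + 3 * b + c - a ^ 7 - a ^ 4 - 2 * a ^ 2 * b - 3 * a ^ 2 -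
    2 * a * b := by
    rw [e1, he2, he3, hd] at e4
    linear_combination (norm := (ring_nf; reduce_mod_char!)) 2 * e4
  have hf1 : f₁ = -72 * β₁ + (b - 2 * a ^ 2) := by
    rw [h1, h0, map_sub, map_add, hD.map_ofNat_mul, hD.map_ofNat_mul, hD.map_one_eq_zero, ha]
    rw [he2] at r0
    linear_combination (norm := (ring_nf; reduce_mod_char!)) 12 * r0
  have hf2 : f₂ = 1440 * β₂ + (a ^ 2 + 3 * a * b - 2 * a ^ 3 - b - 3 * c) := by
    rw [h2, hf1, map_add, neg_mul, map_neg, hD.map_ofNat_mul]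
    simp only [map_sub, map_add, map_neg, hD _ _, hp, hq, hD.map_ofNat_eq_zero, hD.map_one_eq_zero,
      ha, hb,
      Nat.cast_ofNat, Nat.reduceSub]
    rw [he3] at r1
    linear_combination (norm := (ring_nf; reduce_mod_char!)) -72 * r1
  rw [h3, hf2, map_add, hD.map_ofNat_mul]
  simp only [map_sub, map_add, map_neg, hD _ _, hp, hq, hD.map_ofNat_eq_zero, hD.map_one_eq_zero,
    ha, hb, hc,
      Nat.cast_ofNat, Nat.reduceSub]
  rw [he4] at r2
  linear_combination (norm := (ring_nf; reduce_mod_char!)) 1440 * r2 - 3 * hQ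

end FinalIdentities


/-! ### Differential algebra modulo 13. -/

section FinalIdentitiesThirteen

set_option linter.unusedSimpArgs false

/-- The first Burgers relations are Ramanujan's differential equations for P = E₂, Q = E₄, R = E₆.
Modulo 13 they collapse to Q and R alone, subject to one cubic relation. -/
theorem exists_eisenstein_thirteen {A : Type*} [CommRing A] [CharP A 13] {D : A →+ A}
    (hD : IsLeibniz D) {l₀ l₁ l₂ l₃ l₄ l₅ : A}
    (hB0 : 2 * D l₀ = 2 * l₀ + 10 * l₁ - 4 * (l₀ * l₀))
    (hB1 : 2 * D l₁ = 2 * (3 * l₁ + 14 * l₂ - l₀ * l₀ - 4 * (l₀ * l₁ + l₁ * l₀)))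
    (hB2 : 2 * D l₂ = 3 * (4 * l₂ + 18 * l₃ - (l₀ * l₁ + l₁ * l₀) -
      4 * (l₀ * l₂ + l₁ * l₁ + l₂ * l₀)))
    (hB3 : 2 * D l₃ = 4 * (5 * l₃ + 22 * l₄ - (l₀ * l₂ + l₁ * l₁ + l₂ * l₀) -
      4 * (l₀ * l₃ + l₁ * l₂ + l₂ * l₁ + l₃ * l₀)))
    (hB4 : 2 * D l₄ = 5 * (6 * l₄ + 26 * l₅ - (l₀ * l₃ + l₁ * l₂ + l₂ * l₁ + l₃ * l₀) -
      4 * (l₀ * l₄ + l₁ * l₃ + l₂ * l₂ + l₃ * l₁ + l₄ * l₀)))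
    (h8 : l₀ + 126 * l₁ + 1680 * l₂ + 5040 * l₃ = l₀ + 6 * l₁ + 120 * (l₀ + 6 * l₁) ^ 2) :
    ∃ Q R : A, Q ^ 3 = 3 * R ^ 2 - 2 ∧ D Q = R ^ 3 - R ∧ D R = 6 * Q ^ 2 - 6 * Q ^ 2 * R ^ 2 ∧
      l₀ = 6 - 6 * Q ^ 2 * R ∧
      l₁ = Q ^ 2 * R + 4 * Q - 5 ∧
      l₂ = 5 * Q ^ 2 * R - Q + 3 * R + 6 ∧
      l₃ = 5 * Q + 1 - 2 * Q ^ 2 * R - 3 * Q ^ 2 - R ∧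
      l₄ = 5 * Q * R - Q ^ 2 * R - 2 * Q ^ 2 - Q - 1 := by
  obtain ⟨P, hP⟩ : ∃ P, P = 1 - 24 * l₀ := ⟨_, rfl⟩
  obtain ⟨Q, hQ'⟩ : ∃ Q, Q = 1 + 240 * (l₀ + 6 * l₁) := ⟨_, rfl⟩
  obtain ⟨R, hR⟩ : ∃ R, R = 1 - 504 * (l₀ + 30 * l₁ + 120 * l₂) := ⟨_, rfl⟩
  have hp := fun n => hD.map_pow_eq P n
  have hq := fun n => hD.map_pow_eq Q n
  have hr := fun n => hD.map_pow_eq R n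
  have e0 : l₀ = 6 - 6 * P := by
    linear_combination (norm := (ring_nf; reduce_mod_char!)) 6 * hP
  subst e0
  have e1 : l₁ = P + 4 * Q - 5 := by
    linear_combination (norm := (ring_nf; reduce_mod_char!)) 9 * hQ'
  subst e1
  have e2 : l₂ = 5 * P - Q + 3 * R + 6 := by
    linear_combination (norm := (ring_nf; reduce_mod_char!)) 10 * hR
  subst e2
  -- Here E₄² = E₈ expresses the seventh-power sum, and thereby l₃, through lower ones.
  have e3 : l₃ = 5 * Q + 1 - 2 * P - 3 * Q ^ 2 - R := by
    linear_combination (norm := (ring_nf; reduce_mod_char!)) 3 * h8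
  subst e3
  clear hP hQ' hR
  have hP : D P = Q - P ^ 2 := by
    simp only [map_sub, map_add, map_neg, hD _ _, hp, hq, hr, hD.map_ofNat_eq_zero,
      hD.map_one_eq_zero,
      Nat.cast_ofNat, Nat.reduceSub] at hB0
    linear_combination (norm := (ring_nf; reduce_mod_char!)) hB0
  have hQ' : D Q = 4 * R - 4 * P * Q := by
    simp only [map_sub, map_add, map_neg, hD _ _, hp, hq, hr, hD.map_ofNat_eq_zero,
      hD.map_one_eq_zero, hP,
      Nat.cast_ofNat, Nat.reduceSub] at hB1
    linear_combination (norm := (ring_nf; reduce_mod_char!)) 5 * hB1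
  have hR : D R = 6 * Q ^ 2 - 6 * P * R := by
    simp only [map_sub, map_add, map_neg, hD _ _, hp, hq, hr, hD.map_ofNat_eq_zero,
      hD.map_one_eq_zero, hP, hQ',
      Nat.cast_ofNat, Nat.reduceSub] at hB2
    linear_combination (norm := (ring_nf; reduce_mod_char!)) 11 * hB2
  have e4 : l₄ = 5 * Q * R - P - 2 * Q ^ 2 - Q - 1 := by
    simp only [map_sub, map_add, map_neg, hD _ _, hp, hq, hr, hD.map_ofNat_eq_zero,
      hD.map_one_eq_zero, hP, hQ', hR,
      Nat.cast_ofNat, Nat.reduceSub] at hB3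
    linear_combination (norm := (ring_nf; reduce_mod_char!)) 9 * hB3
  subst e4
  -- Since 26l₅ ≡ 0 modulo 13, this Burgers relation contains nothing unknown; it says E₁₂ ≡ 1.
  have hrel' : 4 * Q ^ 3 + R ^ 2 - 5 = 0 := by
    simp only [map_sub, map_add, map_neg, hD _ _, hp, hq, hr, hD.map_ofNat_eq_zero,
      hD.map_one_eq_zero, hP, hQ', hR,
      Nat.cast_ofNat, Nat.reduceSub] at hB4
    linear_combination (norm := (ring_nf; reduce_mod_char!)) -hB4
  have hrel : Q ^ 3 = 3 * R ^ 2 - 2 := by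
    linear_combination (norm := (ring_nf; reduce_mod_char!)) 10 * hrel'
  -- The derivative of the preceding relation gives E₂ ≡ E₁₄ = E₄²E₆ modulo 13.
  have hPQ : P = Q ^ 2 * R := by
    have h := congrArg D hrel'
    simp only [map_sub, map_add, map_neg, hD _ _, hp, hq, hr, hD.map_ofNat_eq_zero,
      hD.map_one_eq_zero, hP, hQ', hR, map_zero,
      Nat.cast_ofNat, Nat.reduceSub] at h
    linear_combination (norm := (ring_nf; reduce_mod_char!)) 8 * h - 8 * P * hrel'
  subst hPQ
  refine ⟨Q, R, hrel, ?_, ?_, ?_, ?_, ?_, ?_, ?_⟩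
  · rw [hQ']
    linear_combination (norm := (ring_nf; reduce_mod_char!)) -4 * R * hrel
  · rw [hR]
    ring
  all_goals ring

-- All quantities are kept in the normal form of degree at most two in Q, via `hrel`, with l₅ as one
-- extra generator; each `linear_combination` records the multiple of `hrel` used in the reduction.
set_option maxHeartbeats 1000000 in
theorem twisted_identity_thirteen {A : Type*} [CommRing A] [CharP A 13] {D : A →+ A}
    (hD : IsLeibniz D) {l₀ l₁ l₂ l₃ l₄ l₅ l₆ β₀ β₁ β₂ β₃ β₄ β₅ β₆ E₁ E₂ E₃ E₄ E₅ E₆ E₇ : A}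
    (hB0 : 2 * D l₀ = 2 * l₀ + 10 * l₁ - 4 * (l₀ * l₀))
    (hB1 : 2 * D l₁ = 2 * (3 * l₁ + 14 * l₂ - l₀ * l₀ - 4 * (l₀ * l₁ + l₁ * l₀)))
    (hB2 : 2 * D l₂ = 3 * (4 * l₂ + 18 * l₃ - (l₀ * l₁ + l₁ * l₀) -
      4 * (l₀ * l₂ + l₁ * l₁ + l₂ * l₀)))
    (hB3 : 2 * D l₃ = 4 * (5 * l₃ + 22 * l₄ - (l₀ * l₂ + l₁ * l₁ + l₂ * l₀) -
      4 * (l₀ * l₃ + l₁ * l₂ + l₂ * l₁ + l₃ * l₀)))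
    (hB4 : 2 * D l₄ = 5 * (6 * l₄ + 26 * l₅ - (l₀ * l₃ + l₁ * l₂ + l₂ * l₁ + l₃ * l₀) -
      4 * (l₀ * l₄ + l₁ * l₃ + l₂ * l₂ + l₃ * l₁ + l₄ * l₀)))
    (hB5 : 2 * D l₅ = 6 * (7 * l₅ + 30 * l₆ -
      (l₀ * l₄ + l₁ * l₃ + l₂ * l₂ + l₃ * l₁ + l₄ * l₀) -
      4 * (l₀ * l₅ + l₁ * l₄ + l₂ * l₃ + l₃ * l₂ + l₄ * l₁ + l₅ * l₀)))
    (hF : D (l₀ + 2046 * l₁ + 168960 * l₂ + 3160080 * l₃ + 19958400 * l₄ + 39916800 * l₅) =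
      D (D (D (D (D (D (D (D (D (D (D (D l₀))))))))))))
    (h8 : l₀ + 126 * l₁ + 1680 * l₂ + 5040 * l₃ = l₀ + 6 * l₁ + 120 * (l₀ + 6 * l₁) ^ 2)
    (e1 : E₁ = 3 * l₀)
    (e2 : 2 * E₂ = 3 * (l₀ * E₁ + l₁))
    (e3 : 3 * E₃ = 3 * (l₀ * E₂ + l₁ * E₁ + l₂))
    (e4 : 4 * E₄ = 3 * (l₀ * E₃ + l₁ * E₂ + l₂ * E₁ + l₃))
    (e5 : 5 * E₅ = 3 * (l₀ * E₄ + l₁ * E₃ + l₂ * E₂ + l₃ * E₁ + l₄))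
    (e6 : 6 * E₆ = 3 * (l₀ * E₅ + l₁ * E₄ + l₂ * E₃ + l₃ * E₂ + l₄ * E₁ + l₅))
    (e7 : 7 * E₇ = 3 * (l₀ * E₆ + l₁ * E₅ + l₂ * E₄ + l₃ * E₃ + l₄ * E₂ + l₅ * E₁ + l₆))
    (r0 : 2 * E₂ = -(6 * D β₀ + 6 * l₀ * β₀ + 6 * β₁))
    (r1 : 2 * E₃ = -(6 * D β₁ + 6 * l₀ * β₁ + 2 * β₁ + 20 * β₂))
    (r2 : 2 * E₄ = -(6 * D β₂ + 6 * l₀ * β₂ + 6 * β₂ + 42 * β₃))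
    (r3 : 2 * E₅ = -(6 * D β₃ + 6 * l₀ * β₃ + 12 * β₃ + 72 * β₄))
    (r4 : 2 * E₆ = -(6 * D β₄ + 6 * l₀ * β₄ + 20 * β₄ + 110 * β₅))
    (r5 : 2 * E₇ = -(6 * D β₅ + 6 * l₀ * β₅ + 30 * β₅ + 156 * β₆))
    {f₀ f₁ f₂ f₃ f₄ f₅ f₆ : A} (h0 : f₀ = 12 * β₀ + 36 * l₀ - 1)
    (h1 : f₁ = 6 * D f₀ + 6 * l₀ * f₀)
    (h2 : f₂ = 6 * D f₁ + 6 * l₀ * f₁ + 2 * f₁)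
    (h3 : f₃ = 6 * D f₂ + 6 * l₀ * f₂ + 6 * f₂)
    (h4 : f₄ = 6 * D f₃ + 6 * l₀ * f₃ + 12 * f₃)
    (h5 : f₅ = 6 * D f₄ + 6 * l₀ * f₄ + 20 * f₄)
    (h6 : f₆ = 6 * D f₅ + 6 * l₀ * f₅ + 30 * f₅) :
    f₆ = 0 := by
  obtain ⟨Q, R, hrel, hQ, hR, rfl, rfl, rfl, rfl, rfl⟩ :=
    exists_eisenstein_thirteen hD hB0 hB1 hB2 hB3 hB4 h8
  clear hB0 hB1 hB2 hB3 hB4 h8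
  have hp := fun n => hD.map_pow_eq Q n
  have hq := fun n => hD.map_pow_eq R n
  -- The statements `d1` to `d11` give the successive derivatives of l₀; the twelfth is taken when D
  -- is applied once more in `hF`.
  have d1 : D (6 - 6 * Q ^ 2 * R) =
      5 * Q * R ^ 4 + Q * R ^ 2 - 6 * Q := by
    simp only [map_sub, map_add, map_neg, hD _ _, hp, hq, hD.map_ofNat_eq_zero, hD.map_one_eq_zero,
      hQ, hR,
      Nat.cast_ofNat, Nat.reduceSub]
    linear_combination (norm := (ring_nf; reduce_mod_char!)) (3 * Q - 3 * Q * R ^ 2) * hrel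
  have d2 : D (5 * Q * R ^ 4 + Q * R ^ 2 - 6 * Q) =
      R ^ 5 - 4 * R ^ 7 - 5 * R ^ 3 - 5 * R := by
    simp only [map_sub, map_add, map_neg, hD _ _, hp, hq, hD.map_ofNat_eq_zero, hD.map_one_eq_zero,
      hQ, hR,
      Nat.cast_ofNat, Nat.reduceSub]
    linear_combination (norm := (ring_nf; reduce_mod_char!)) (4 * R ^ 3 - 3 * R ^ 5 - R) * hrel
  have d3 : D (R ^ 5 - 4 * R ^ 7 - 5 * R ^ 3 - 5 * R) =
      3 * Q ^ 2 * R ^ 4 + 5 * Q ^ 2 * R ^ 2 - Q ^ 2 * R ^ 8 - 3 * Q ^ 2 * R ^ 6 - 4 * Q ^ 2 := by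
    simp only [map_sub, map_add, map_neg, hD _ _, hp, hq, hD.map_ofNat_eq_zero, hD.map_one_eq_zero,
      hQ, hR,
      Nat.cast_ofNat, Nat.reduceSub]
    linear_combination (norm := (ring_nf; reduce_mod_char!))
  have d4 : D (3 * Q ^ 2 * R ^ 4 + 5 * Q ^ 2 * R ^ 2 - Q ^ 2 * R ^ 8 - 3 * Q ^ 2 * R ^ 6 -
      4 * Q ^ 2) =
      2 * Q * R ^ 9 + 2 * Q * R ^ 7 + 5 * Q * R - Q * R ^ 11 - 3 * Q * R ^ 5 - 5 * Q * R ^ 3 := by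
    simp only [map_sub, map_add, map_neg, hD _ _, hp, hq, hD.map_ofNat_eq_zero, hD.map_one_eq_zero,
      hQ, hR,
      Nat.cast_ofNat, Nat.reduceSub]
    linear_combination (norm := (ring_nf; reduce_mod_char!)) (2 * Q * R ^ 5 - 4 * Q * R ^ 9 -
        5 * Q * R ^ 7 - Q * R ^ 3 - 5 * Q * R) * hrel
  have d5 : D (2 * Q * R ^ 9 + 2 * Q * R ^ 7 + 5 * Q * R - Q * R ^ 11 - 3 * Q * R ^ 5 -
      5 * Q * R ^ 3) =
      2 * R ^ 14 - R ^ 12 + 4 * R ^ 10 + R ^ 8 + R ^ 6 + R ^ 4 + 5 := by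
    simp only [map_sub, map_add, map_neg, hD _ _, hp, hq, hD.map_ofNat_eq_zero, hD.map_one_eq_zero,
      hQ, hR,
      Nat.cast_ofNat, Nat.reduceSub]
    linear_combination (norm := (ring_nf; reduce_mod_char!)) (R ^ 12 - 5 * R ^ 10 - 2 * R ^ 8 +
        5 * R ^ 6 - 3 * R ^ 2 + 4) * hrel
  have d6 : D (2 * R ^ 14 - R ^ 12 + 4 * R ^ 10 + R ^ 8 + R ^ 6 + R ^ 4 + 5) =
      Q ^ 2 * R ^ 15 + 6 * Q ^ 2 * R ^ 13 - 3 * Q ^ 2 * R ^ 9 - Q ^ 2 * R ^ 7 - Q ^ 2 * R ^ 5 -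
          2 * Q ^ 2 * R ^ 3 := by
    simp only [map_sub, map_add, map_neg, hD _ _, hp, hq, hD.map_ofNat_eq_zero, hD.map_one_eq_zero,
      hQ, hR,
      Nat.cast_ofNat, Nat.reduceSub]
    linear_combination (norm := (ring_nf; reduce_mod_char!))
  have d7 : D (Q ^ 2 * R ^ 15 + 6 * Q ^ 2 * R ^ 13 - 3 * Q ^ 2 * R ^ 9 - Q ^ 2 * R ^ 7 -
      Q ^ 2 * R ^ 5 - 2 * Q ^ 2 * R ^ 3) =
      5 * Q * R ^ 18 + 5 * Q * R ^ 16 + 3 * Q * R ^ 14 - Q * R ^ 12 - 4 * Q * R ^ 10 -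
          4 * Q * R ^ 8 + Q * R ^ 6 + Q * R ^ 4 - 6 * Q * R ^ 2 := by
    simp only [map_sub, map_add, map_neg, hD _ _, hp, hq, hD.map_ofNat_eq_zero, hD.map_one_eq_zero,
      hQ, hR,
      Nat.cast_ofNat, Nat.reduceSub]
    linear_combination (norm := (ring_nf; reduce_mod_char!)) (Q * R ^ 16 - Q * R ^ 14 +
        6 * Q * R ^ 10 - 3 * Q * R ^ 8 + Q * R ^ 6 + 6 * Q * R ^ 4 + 3 * Q * R ^ 2) * hrel
  have d8 : D (5 * Q * R ^ 18 + 5 * Q * R ^ 16 + 3 * Q * R ^ 14 - Q * R ^ 12 - 4 * Q * R ^ 10 -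
      4 * Q * R ^ 8 + Q * R ^ 6 + Q * R ^ 4 - 6 * Q * R ^ 2) =
      3 * R ^ 17 + 5 * R ^ 15 + R ^ 11 + 2 * R ^ 9 + R ^ 3 + R - 3 * R ^ 21 - R ^ 19 -
          4 * R ^ 13 - 2 * R ^ 7 - 3 * R ^ 5 := by
    simp only [map_sub, map_add, map_neg, hD _ _, hp, hq, hD.map_ofNat_eq_zero, hD.map_one_eq_zero,
      hQ, hR,
      Nat.cast_ofNat, Nat.reduceSub]
    linear_combination (norm := (ring_nf; reduce_mod_char!)) (6 * R ^ 19 - 5 * R ^ 17 -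
        6 * R ^ 15 - R ^ 13 - R ^ 11 + 4 * R ^ 9 + 6 * R ^ 7 - R ^ 5 + 5 * R ^ 3 + 6 * R) * hrel
  have d9 : D (3 * R ^ 17 + 5 * R ^ 15 + R ^ 11 + 2 * R ^ 9 + R ^ 3 + R - 3 * R ^ 21 - R ^ 19 -
      4 * R ^ 13 - 2 * R ^ 7 - 3 * R ^ 5) =
      Q ^ 2 * R ^ 22 - 4 * Q ^ 2 * R ^ 20 - 4 * Q ^ 2 * R ^ 18 - Q ^ 2 * R ^ 16 -
          5 * Q ^ 2 * R ^ 14 - Q ^ 2 * R ^ 12 - 3 * Q ^ 2 * R ^ 10 - 3 * Q ^ 2 * R ^ 8 +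
          6 * Q ^ 2 * R ^ 6 - 4 * Q ^ 2 * R ^ 4 - Q ^ 2 * R ^ 2 + 6 * Q ^ 2 := by
    simp only [map_sub, map_add, map_neg, hD _ _, hp, hq, hD.map_ofNat_eq_zero, hD.map_one_eq_zero,
      hQ, hR,
      Nat.cast_ofNat, Nat.reduceSub]
    linear_combination (norm := (ring_nf; reduce_mod_char!))
  have d10 : D (Q ^ 2 * R ^ 22 - 4 * Q ^ 2 * R ^ 20 - 4 * Q ^ 2 * R ^ 18 - Q ^ 2 * R ^ 16 -
      5 * Q ^ 2 * R ^ 14 - Q ^ 2 * R ^ 12 - 3 * Q ^ 2 * R ^ 10 - 3 * Q ^ 2 * R ^ 8 +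
          6 * Q ^ 2 * R ^ 6 - 4 * Q ^ 2 * R ^ 4 - Q ^ 2 * R ^ 2 + 6 * Q ^ 2) =
      4 * Q * R ^ 19 + 6 * Q * R ^ 15 + 2 * Q * R ^ 13 + Q * R ^ 11 + Q * R ^ 5 + 3 * Q * R ^ 3 -
          4 * Q * R ^ 25 - 3 * Q * R ^ 23 - 3 * Q * R ^ 21 - 2 * Q * R ^ 17 - 2 * Q * R ^ 9 -
          2 * Q * R ^ 7 - Q * R := by
    simp only [map_sub, map_add, map_neg, hD _ _, hp, hq, hD.map_ofNat_eq_zero, hD.map_one_eq_zero,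
      hQ, hR,
      Nat.cast_ofNat, Nat.reduceSub]
    linear_combination (norm := (ring_nf; reduce_mod_char!)) (Q * R ^ 21 + 4 * Q * R ^ 19 +
        2 * Q * R ^ 17 + 3 * Q * R ^ 13 + 4 * Q * R ^ 11 + 3 * Q * R ^ 9 + 4 * Q * R ^ 7 +
            Q * R - 2 * Q * R ^ 23 - Q * R ^ 15 - 6 * Q * R ^ 3) * hrel
  have d11 : D (4 * Q * R ^ 19 + 6 * Q * R ^ 15 + 2 * Q * R ^ 13 + Q * R ^ 11 + Q * R ^ 5 +
      3 * Q * R ^ 3 - 4 * Q * R ^ 25 - 3 * Q * R ^ 23 - 3 * Q * R ^ 21 - 2 * Q * R ^ 17 -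
          2 * Q * R ^ 9 - 2 * Q * R ^ 7 - Q * R) =
      2 * R ^ 28 - 2 * R ^ 26 + 4 * R ^ 24 - 5 * R ^ 22 + 2 * R ^ 20 + 5 * R ^ 18 - 3 * R ^ 16 -
          5 * R ^ 14 + R ^ 12 - 4 * R ^ 10 - 5 * R ^ 8 + 2 * R ^ 6 + 3 * R ^ 4 + 6 * R ^ 2 - 1 := by
    simp only [map_sub, map_add, map_neg, hD _ _, hp, hq, hD.map_ofNat_eq_zero, hD.map_one_eq_zero,
      hQ, hR,
      Nat.cast_ofNat, Nat.reduceSub]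
    linear_combination (norm := (ring_nf; reduce_mod_char!)) (2 * R ^ 26 - 4 * R ^ 24 +
        3 * R ^ 22 - 2 * R ^ 20 - 3 * R ^ 18 - 3 * R ^ 16 - 6 * R ^ 14 - R ^ 12 + 5 * R ^ 10 +
            2 * R ^ 8 + 3 * R ^ 6 + 2 * R ^ 4 - 5 * R ^ 2 - 6) * hrel
  -- Fermat's relation for σ₁₁ supplies Dl₅; the Burgers relation `hB5`, where l₆ has an invertible
  -- coefficient, then determines l₆.
  have he : D l₅ = 2 * Q ^ 2 * R ^ 29 - 2 * Q ^ 2 * R ^ 27 - 4 * Q ^ 2 * R ^ 25 +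
      Q ^ 2 * R ^ 23 - 3 * Q ^ 2 * R ^ 21 - Q ^ 2 * R ^ 19 - 4 * Q ^ 2 * R ^ 17 +
          2 * Q ^ 2 * R ^ 15 + 2 * Q ^ 2 * R ^ 13 + 2 * Q ^ 2 * R ^ 2 - 6 * Q ^ 2 * R -
          2 * Q ^ 2 - 6 * Q * R ^ 4 - 5 * Q * R ^ 3 + 4 * Q * R ^ 2 + 5 * Q * R + 2 * Q -
          3 * R ^ 4 - 6 * R ^ 3 - R ^ 2 + 6 * R + 4 := by
    rw [d1, d2, d3, d4, d5, d6, d7, d8, d9, d10, d11] at hF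
    simp only [map_sub, map_add, map_neg, hD _ _, hp, hq, hD.map_ofNat_eq_zero, hD.map_one_eq_zero,
      hQ, hR,
      Nat.cast_ofNat, Nat.reduceSub] at hF
    linear_combination (norm := (ring_nf; reduce_mod_char!)) 1 * hF + (Q * R ^ 2 - Q +
        2 * R ^ 2 - 2) * hrel
  have h₆ : l₆ = 2 * Q ^ 2 * R ^ 27 + 4 * Q ^ 2 * R ^ 25 + 3 * Q ^ 2 * R ^ 21 + Q ^ 2 * R ^ 19 +
      4 * Q ^ 2 * R ^ 17 + Q ^ 2 * R * l₅ + Q * R ^ 3 + 4 * Q * R ^ 2 + 2 * Q * R + R ^ 4 +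
          5 * R ^ 3 - 2 * Q ^ 2 * R ^ 29 - Q ^ 2 * R ^ 23 - 2 * Q ^ 2 * R ^ 15 -
          2 * Q ^ 2 * R ^ 13 - 4 * Q ^ 2 * R ^ 2 - 3 * Q ^ 2 * R - 4 * Q ^ 2 - 6 * Q * R ^ 4 -
          4 * Q - 5 * R ^ 2 - 2 * R - 6 * l₅ - 5 := by
    rw [he] at hB5
    linear_combination (norm := (ring_nf; reduce_mod_char!)) 7 * hB5 + (3 * Q * R + 4 * R -
        4 * Q * R ^ 2 - 5 * R ^ 2 - 3) * hrel
  subst h₆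
  clear hB5 hF d1 d2 d3 d4 d5 d6 d7 d8 d9 d10 d11
  have h : E₁ = 5 - 5 * Q ^ 2 * R := by
    linear_combination (norm := (ring_nf; reduce_mod_char!)) e1
  subst h
  have h : E₂ = 5 * Q * R ^ 4 + Q * R ^ 2 + 6 * Q + 5 - 4 * Q ^ 2 * R := by
    linear_combination (norm := (ring_nf; reduce_mod_char!)) 7 * e2 + (6 * Q * R ^ 2) * hrel
  subst h
  have h : E₃ = 3 * Q + R ^ 7 + 3 * R ^ 5 - 6 * Q ^ 2 * R - 4 * Q * R ^ 4 - 6 * Q * R ^ 2 -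
      2 * R - 2 := by
    linear_combination (norm := (ring_nf; reduce_mod_char!)) 9 * e3 + (6 * Q * R ^ 2 -
        4 * R ^ 5 - 6 * R ^ 3 - 4 * R) * hrel
  subst h
  have h : E₄ = 2 * Q ^ 2 * R ^ 8 + 6 * Q ^ 2 * R ^ 6 + 2 * Q ^ 2 * R ^ 4 + 4 * Q ^ 2 * R ^ 2 +
      2 * Q ^ 2 * R + 6 * Q ^ 2 + 5 * Q * R ^ 4 + Q * R ^ 2 + 6 * Q - 5 * R ^ 7 - 2 * R ^ 5 -
          3 * R + 2 := by
    linear_combination (norm := (ring_nf; reduce_mod_char!)) 10 * e4 + (2 * Q * R ^ 2 - R ^ 5 +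
        5 * R ^ 3 - R) * hrel
  subst h
  have h : E₅ = 5 * Q ^ 2 * R ^ 8 + 2 * Q ^ 2 * R ^ 6 + 5 * Q ^ 2 * R ^ 4 - 3 * Q ^ 2 * R ^ 2 +
      2 * Q ^ 2 - 6 * Q * R ^ 11 - Q * R ^ 9 - 2 * Q * R ^ 7 + 3 * Q * R ^ 5 - 5 * Q * R ^ 4 -
          2 * Q * R ^ 3 - Q * R ^ 2 + 3 * Q * R - 6 * Q - 6 * R ^ 7 - 5 * R ^ 5 - R + 5 := by
    linear_combination (norm := (ring_nf; reduce_mod_char!)) 8 * e5 + (4 * Q * R ^ 2 +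
        3 * Q * R + 5 * R ^ 5 + R ^ 3 + 5 * R - 2 * Q * R ^ 9 - 6 * Q * R ^ 7 - 2 * Q * R ^ 5 -
            4 * Q * R ^ 3) * hrel
  subst h
  have h : E₆ = 2 * Q ^ 2 * R ^ 8 + 6 * Q ^ 2 * R ^ 6 + 2 * Q ^ 2 * R ^ 4 + 4 * Q ^ 2 * R ^ 2 +
      3 * Q ^ 2 * R + 4 * Q ^ 2 + 5 * Q * R ^ 11 + 3 * Q * R ^ 9 + 6 * Q * R ^ 7 +
          4 * Q * R ^ 5 - Q * R ^ 4 + 6 * Q * R ^ 3 + 5 * Q * R ^ 2 + 2 * Q * R - 6 * Q +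
          2 * R ^ 14 - R ^ 12 - 2 * R ^ 10 - 3 * R ^ 8 + 5 * R ^ 7 + 6 * R ^ 6 + 2 * R ^ 5 +
          2 * R ^ 4 - 3 * R ^ 2 + R - 6 * l₅ - 2 := by
    linear_combination (norm := (ring_nf; reduce_mod_char!)) 11 * e6 + (5 * R ^ 12 + 3 * R ^ 10 +
        3 * R ^ 6 + 3 - Q * R ^ 9 - 3 * Q * R ^ 7 - Q * R ^ 5 - 2 * Q * R ^ 3 - Q * R ^ 2 -
            5 * Q * R - 3 * R ^ 8 - 4 * R ^ 5 - 4 * R ^ 4 - 6 * R ^ 3 - 2 * R ^ 2 - 4 * R) * hrel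
  subst h
  have h : E₇ = Q ^ 2 * R ^ 29 - Q ^ 2 * R ^ 27 - 2 * Q ^ 2 * R ^ 25 - 6 * Q ^ 2 * R ^ 23 +
      5 * Q ^ 2 * R ^ 21 + 6 * Q ^ 2 * R ^ 19 - 2 * Q ^ 2 * R ^ 17 - 6 * Q ^ 2 * R ^ 15 -
          2 * Q ^ 2 * R ^ 13 + 6 * Q ^ 2 * R ^ 11 + 3 * Q ^ 2 * R ^ 9 + 6 * Q ^ 2 * R ^ 8 -
          5 * Q ^ 2 * R ^ 7 + 5 * Q ^ 2 * R ^ 6 + 2 * Q ^ 2 * R ^ 5 + 6 * Q ^ 2 * R ^ 4 +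
          6 * Q ^ 2 * R ^ 3 - 2 * Q ^ 2 * R ^ 2 - 3 * Q ^ 2 * R * l₅ - 4 * Q ^ 2 -
          2 * Q * R ^ 11 + 4 * Q * R ^ 9 - 5 * Q * R ^ 7 + Q * R ^ 5 - 3 * Q * R ^ 4 +
          5 * Q * R ^ 3 + 2 * Q * R ^ 2 - 6 * Q * R - 4 * R ^ 14 + 2 * R ^ 12 + 4 * R ^ 10 +
          6 * R ^ 8 + 6 * R ^ 7 + R ^ 6 + 5 * R ^ 5 + 6 * R ^ 4 - 2 * R ^ 3 - 5 * R ^ 2 + 2 * R -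
          l₅ + 6 := by
    linear_combination (norm := (ring_nf; reduce_mod_char!)) 2 * e7 + (5 * Q * R ^ 9 +
        2 * Q * R ^ 7 + 5 * Q * R ^ 5 - 3 * Q * R ^ 3 - 4 * Q * R ^ 2 - 4 * Q * R + 5 * R ^ 12 +
            3 * R ^ 10 - 3 * R ^ 8 + 3 * R ^ 6 + 5 * R ^ 5 - 4 * R ^ 4 + R ^ 3 - 5 * R ^ 2 +
            3 * R + 3) * hrel
  subst h
  -- The coefficients of β_j in `g1` to `g5` arise from 12 by multiplying with -6, -20, -42, -72,
  -- -110; the next factor 156 = 12·13 removes β₆.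
  have g1 : f₁ = -(72 * β₁) + (4 * Q * R ^ 4 + 6 * Q * R ^ 2 + 3 * Q + 2 - 2 * Q ^ 2 * R) := by
    rw [h1, h0]
    simp only [map_sub, map_add, map_neg, hD _ _, hp, hq, hD.map_ofNat_eq_zero, hD.map_one_eq_zero,
      hQ, hR, he,
      Nat.cast_ofNat, Nat.reduceSub]
    linear_combination (norm := (ring_nf; reduce_mod_char!)) 12 * r0 + (4 * Q * R ^ 2 -
        2 * Q) * hrel
  have g2 : f₂ = 1440 * β₂ + (2 * Q ^ 2 * R - 3 * Q * R ^ 4 + 2 * Q * R ^ 2 + Q - 3 * R ^ 7 +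
      4 * R ^ 5 + 6 * R ^ 3 - 5 * R - 4) := by
    rw [h2, g1]
    simp only [map_sub, map_add, map_neg, hD _ _, hp, hq, hD.map_ofNat_eq_zero, hD.map_one_eq_zero,
      hQ, hR, he,
      Nat.cast_ofNat, Nat.reduceSub]
    linear_combination (norm := (ring_nf; reduce_mod_char!)) -72 * r1 + (Q * R ^ 2 + 6 * Q -
        5 * R ^ 5 + 6 * R ^ 3 - R) * hrel
  have g3 : f₃ = -(60480 * β₃) + (5 * Q ^ 2 * R ^ 8 + 2 * Q ^ 2 * R ^ 6 - 2 * Q ^ 2 * R ^ 4 +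
      5 * Q ^ 2 * R ^ 2 + 6 * Q ^ 2 * R - Q ^ 2 + 3 * Q * R ^ 4 - 2 * Q * R ^ 2 - Q + 3 * R ^ 7 -
          4 * R ^ 5 - 6 * R ^ 3 + 5 * R) := by
    rw [h3, g2]
    simp only [map_sub, map_add, map_neg, hD _ _, hp, hq, hD.map_ofNat_eq_zero, hD.map_one_eq_zero,
      hQ, hR, he,
      Nat.cast_ofNat, Nat.reduceSub]
    linear_combination (norm := (ring_nf; reduce_mod_char!)) 1440 * r2 + (2 * R ^ 3 + 4 * R -
        Q * R ^ 2 - 6 * Q - 6 * R ^ 5) * hrel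
  have g4 : f₄ = 4354560 * β₄ + (Q ^ 2 * R ^ 8 + 3 * Q ^ 2 * R ^ 6 - 3 * Q ^ 2 * R ^ 4 +
      Q ^ 2 * R ^ 2 + 2 * Q ^ 2 * R + 5 * Q ^ 2 + Q * R ^ 11 - 2 * Q * R ^ 9 - 2 * Q * R ^ 7 +
          5 * Q * R ^ 5 - 2 * Q * R ^ 4 - 3 * Q * R ^ 2 - 2 * Q * R + 5 * Q + 2 * R ^ 7 +
          6 * R ^ 5 - 4 * R ^ 3 - R + 1) := by
    rw [h4, g3]
    simp only [map_sub, map_add, map_neg, hD _ _, hp, hq, hD.map_ofNat_eq_zero, hD.map_one_eq_zero,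
      hQ, hR, he,
      Nat.cast_ofNat, Nat.reduceSub]
    linear_combination (norm := (ring_nf; reduce_mod_char!)) -60480 * r3 + (5 * Q * R ^ 9 -
        Q * R ^ 5 + 4 * Q * R ^ 3 - 3 * Q * R ^ 2 + 6 * Q * R - 5 * Q + 6 * R ^ 5 - 2 * R ^ 3 -
            4 * R) * hrel
  have g5 : f₅ = -(479001600 * β₅) + (5 * Q ^ 2 * R ^ 8 + 2 * Q ^ 2 * R ^ 6 - 2 * Q ^ 2 * R ^ 4 +
      5 * Q ^ 2 * R ^ 2 - Q ^ 2 * R - 6 * Q ^ 2 - Q * R ^ 11 + 2 * Q * R ^ 9 + 2 * Q * R ^ 7 -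
          5 * Q * R ^ 5 + 4 * Q * R ^ 4 + 6 * Q * R ^ 2 - 3 * Q * R + 4 * Q + 2 * R ^ 14 -
          R ^ 12 + 4 * R ^ 10 - 4 * R ^ 8 + 3 * R ^ 7 + 3 * R ^ 6 - 4 * R ^ 5 + 3 * R ^ 4 -
          6 * R ^ 3 + R ^ 2 - 2 * l₅) := by
    rw [h5, g4]
    simp only [map_sub, map_add, map_neg, hD _ _, hp, hq, hD.map_ofNat_eq_zero, hD.map_one_eq_zero,
      hQ, hR, he,
      Nat.cast_ofNat, Nat.reduceSub]
    linear_combination (norm := (ring_nf; reduce_mod_char!)) 4354560 * r4 + (Q * R ^ 9 +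
        5 * Q * R ^ 5 + 6 * Q * R ^ 3 - Q * R ^ 2 - 4 * Q * R - 6 * Q - 3 * R ^ 12 - 2 * R ^ 10 +
            6 * R ^ 8 + 2 * R ^ 6 - 4 * R ^ 5 + 3 * R ^ 4 - 3 * R ^ 3 + R ^ 2 - 6 * R + 6) * hrel
  rw [h6, g5]
  simp only [map_sub, map_add, map_neg, hD _ _, hp, hq, hD.map_ofNat_eq_zero, hD.map_one_eq_zero,
    hQ, hR, he,
      Nat.cast_ofNat, Nat.reduceSub]
  linear_combination (norm := (ring_nf; reduce_mod_char!)) -479001600 * r5 + (5 * Q * R ^ 9 -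
      Q * R ^ 5 + 4 * Q * R ^ 3 - 6 * Q * R ^ 2 + 4 * Q * R + 3 * Q + 3 * R ^ 12 + 2 * R ^ 10 -
          6 * R ^ 8 - 2 * R ^ 6 - 5 * R ^ 5 - 3 * R ^ 4 + 6 * R ^ 3 - 5 * R ^ 2 + 2 * R - 4) * hrel

end FinalIdentitiesThirteen


/-! ### The iterates attached to spt, and their vanishing modulo 5, 7 and 13. -/

section TwistedIterates

open PowerSeries

/-- The iterates of the operators `twistedD` with parameters `j (j + 1)`, on the series of
`12 spt n + (24 n - 1) p n` without the generating function of the partition numbers. -/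
noncomputable def twistedIter (k : Type*) [Field k] : ℕ → k⟦X⟧
  | 0 => 12 * rankMoment k 0 + 36 * logLambert k 0 - 1
  | j + 1 => twistedD k (j * (j + 1)) (twistedIter k j)

theorem twistedIter_succ {k : Type*} [Field k] (j : ℕ) : twistedIter k (j + 1) =
    6 * eulerD k (twistedIter k j) + 6 * logLambert k 0 * twistedIter k j +
      ((j * (j + 1) : ℕ) : k⟦X⟧) * twistedIter k j := rfl

theorem charP_powerSeries (R : Type*) [CommRing R] (p : ℕ) [CharP R p] : CharP R⟦X⟧ p :=
  charP_of_injective_ringHom (C_injective (R := R)) p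

theorem zmod_ofNat_ne_zero (p n : ℕ) [n.AtLeastTwo] (h : ¬ p ∣ n) :
    (ofNat(n) : ZMod p) ≠ 0 := by
  intro h'
  exact h ((ZMod.natCast_eq_zero_iff n p).mp (by exact_mod_cast h'))

instance fact_prime_five : Fact (Nat.Prime 5) := ⟨by norm_num⟩

instance fact_prime_seven : Fact (Nat.Prime 7) := ⟨by norm_num⟩

instance fact_prime_thirteen : Fact (Nat.Prime 13) := ⟨by norm_num⟩

theorem twistedIter_five : twistedIter (ZMod 5) 2 = 0 := by
  have := charP_powerSeries (ZMod 5) 5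
  have h2 := zmod_ofNat_ne_zero 5 2 (by norm_num)
  have h3 := zmod_ofNat_ne_zero 5 3 (by norm_num)
  obtain ⟨E, e0, e, r⟩ := exists_rankMoment_recursion h2 h3
  have hF := eulerD_divisorSeries_card_sub_two 5 (by norm_num)
  simp only [← logLambert_zero, Nat.reduceSub, divisorSeries_three_eq, Function.iterate_succ,
    Function.iterate_zero, Function.comp_apply, id_eq] at hF
  have b0 := two_mul_eulerD_logLambert_zero h2
  have b1 := two_mul_eulerD_logLambert_succ h2 0
  have e1 := e 0
  have e2 := e 1
  have e3 := e 2
  have r0 := r 0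
  have r1 := r 1
  simp only [logLambertSq, Finset.Nat.sum_antidiagonal_eq_sum_range_succ_mk, Finset.sum_range_succ,
    Finset.sum_range_zero, zero_add, Nat.reduceAdd, Nat.reduceSub, Nat.sub_zero, Nat.sub_self, e0,
      mul_one,
    Nat.cast_zero, Nat.cast_one, Nat.cast_ofNat, mul_zero]
    at b0 b1 e1 e2 e3
  simp only [twistedD] at r0 r1
  push_cast at b0 b1 e1 e2 e3 r0 r1
  refine twisted_identity_five
    (a := logLambert _ 0) (b := logLambert _ 1) (c := logLambert _ 2)
    (β₀ := rankMoment _ 0) (β₁ := rankMoment _ 1) (β₂ := rankMoment _ 2)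
    (E₁ := E 1) (E₂ := E 2) (E₃ := E 3)
    (f₀ := twistedIter _ 0) (f₁ := twistedIter _ 1) (f₂ := twistedIter _ 2)
    (isLeibniz_eulerD _) ?_ ?_ ?_ ?_ ?_ ?_ ?_ ?_ rfl ?_ ?_
  · linear_combination b0
  · linear_combination b1
  · exact hF
  · linear_combination e1
  · linear_combination e2
  · linear_combination e3
  · linear_combination r0
  · linear_combination r1
  all_goals rw [twistedIter_succ]; push_cast; ring

theorem twistedIter_seven : twistedIter (ZMod 7) 3 = 0 := by
  have := charP_powerSeries (ZMod 7) 7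
  have h2 := zmod_ofNat_ne_zero 7 2 (by norm_num)
  have h3 := zmod_ofNat_ne_zero 7 3 (by norm_num)
  obtain ⟨E, e0, e, r⟩ := exists_rankMoment_recursion h2 h3
  have hF := eulerD_divisorSeries_card_sub_two 7 (by norm_num)
  simp only [← logLambert_zero, Nat.reduceSub, divisorSeries_five_eq, Function.iterate_succ,
    Function.iterate_zero, Function.comp_apply, id_eq] at hF
  have hQ := divisorSeries_seven (ZMod 7)
  rw [show divisorSeries (ZMod 7) 7 = divisorSeries (ZMod 7) 1 from
    divisorSeries_add_card_sub_one 7 1 one_ne_zero, ← logLambert_zero, divisorSeries_three_eq] at hQ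
  have b0 := two_mul_eulerD_logLambert_zero h2
  have b1 := two_mul_eulerD_logLambert_succ h2 0
  have b2 := two_mul_eulerD_logLambert_succ h2 1
  have e1 := e 0
  have e2 := e 1
  have e3 := e 2
  have e4 := e 3
  have r0 := r 0
  have r1 := r 1
  have r2 := r 2
  simp only [logLambertSq, Finset.Nat.sum_antidiagonal_eq_sum_range_succ_mk, Finset.sum_range_succ,
    Finset.sum_range_zero, zero_add, Nat.reduceAdd, Nat.reduceSub, Nat.sub_zero, Nat.sub_self, e0,
      mul_one,
    Nat.cast_zero, Nat.cast_one, Nat.cast_ofNat, mul_zero]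
    at b0 b1 b2 e1 e2 e3 e4
  simp only [twistedD] at r0 r1 r2
  push_cast at b0 b1 b2 e1 e2 e3 e4 r0 r1 r2
  refine twisted_identity_seven
    (a := logLambert _ 0) (b := logLambert _ 1) (c := logLambert _ 2) (d := logLambert _ 3)
    (β₀ := rankMoment _ 0) (β₁ := rankMoment _ 1) (β₂ := rankMoment _ 2) (β₃ := rankMoment _ 3)
    (E₁ := E 1) (E₂ := E 2) (E₃ := E 3) (E₄ := E 4)
    (f₀ := twistedIter _ 0) (f₁ := twistedIter _ 1) (f₂ := twistedIter _ 2) (f₃ := twistedIter _ 3)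
    (isLeibniz_eulerD _) ?_ ?_ ?_ ?_ ?_ ?_ ?_ ?_ ?_ ?_ ?_ ?_ rfl ?_ ?_ ?_
  · linear_combination b0
  · linear_combination b1
  · linear_combination b2
  · exact hF
  · linear_combination hQ
  · linear_combination e1
  · linear_combination e2
  · linear_combination e3
  · linear_combination e4
  · linear_combination r0
  · linear_combination r1
  · linear_combination r2
  all_goals rw [twistedIter_succ]; push_cast; ring

theorem twistedIter_thirteen : twistedIter (ZMod 13) 6 = 0 := by
  have := charP_powerSeries (ZMod 13) 13
  have h2 := zmod_ofNat_ne_zero 13 2 (by norm_num)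
  have h3 := zmod_ofNat_ne_zero 13 3 (by norm_num)
  obtain ⟨E, e0, e, r⟩ := exists_rankMoment_recursion h2 h3
  have hF := eulerD_divisorSeries_card_sub_two 13 (by norm_num)
  simp only [← logLambert_zero, Nat.reduceSub, divisorSeries_eleven_eq, Function.iterate_succ,
    Function.iterate_zero, Function.comp_apply, id_eq] at hF
  have hQ := divisorSeries_seven (ZMod 13)
  rw [divisorSeries_seven_eq, divisorSeries_three_eq] at hQ
  have b0 := two_mul_eulerD_logLambert_zero h2
  have b1 := two_mul_eulerD_logLambert_succ h2 0
  have b2 := two_mul_eulerD_logLambert_succ h2 1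
  have b3 := two_mul_eulerD_logLambert_succ h2 2
  have b4 := two_mul_eulerD_logLambert_succ h2 3
  have b5 := two_mul_eulerD_logLambert_succ h2 4
  have e1 := e 0
  have e2 := e 1
  have e3 := e 2
  have e4 := e 3
  have e5 := e 4
  have e6 := e 5
  have e7 := e 6
  have r0 := r 0
  have r1 := r 1
  have r2 := r 2
  have r3 := r 3
  have r4 := r 4
  have r5 := r 5
  simp only [logLambertSq, Finset.Nat.sum_antidiagonal_eq_sum_range_succ_mk, Finset.sum_range_succ,
    Finset.sum_range_zero, zero_add, Nat.reduceAdd, Nat.reduceSub, Nat.sub_zero, Nat.sub_self, e0,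
      mul_one,
    Nat.cast_zero, Nat.cast_one, Nat.cast_ofNat, mul_zero]
    at b0 b1 b2 b3 b4 b5 e1 e2 e3 e4 e5 e6 e7
  simp only [twistedD] at r0 r1 r2 r3 r4 r5
  push_cast at b0 b1 b2 b3 b4 b5 e1 e2 e3 e4 e5 e6 e7 r0 r1 r2 r3 r4 r5
  refine twisted_identity_thirteen
    (l₀ := logLambert _ 0) (l₁ := logLambert _ 1) (l₂ := logLambert _ 2) (l₃ :=
      logLambert _ 3) (l₄ := logLambert _ 4) (l₅ := logLambert _ 5) (l₆ := logLambert _ 6)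
    (β₀ := rankMoment _ 0) (β₁ := rankMoment _ 1) (β₂ := rankMoment _ 2) (β₃ :=
      rankMoment _ 3) (β₄ := rankMoment _ 4) (β₅ := rankMoment _ 5) (β₆ := rankMoment _ 6)
    (E₁ := E 1) (E₂ := E 2) (E₃ := E 3) (E₄ := E 4) (E₅ := E 5) (E₆ := E 6) (E₇ := E 7)
    (f₀ := twistedIter _ 0) (f₁ := twistedIter _ 1) (f₂ := twistedIter _ 2) (f₃ :=
      twistedIter _ 3) (f₄ := twistedIter _ 4) (f₅ := twistedIter _ 5) (f₆ := twistedIter _ 6)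
    (isLeibniz_eulerD _) ?_ ?_ ?_ ?_ ?_ ?_ ?_ ?_ ?_ ?_ ?_ ?_ ?_ ?_ ?_ ?_ ?_ ?_ ?_ ?_ ?_ rfl ?_ ?_
      ?_ ?_ ?_ ?_
  · linear_combination b0
  · linear_combination b1
  · linear_combination b2
  · linear_combination b3
  · linear_combination b4
  · linear_combination b5
  · exact hF
  · linear_combination hQ
  · linear_combination e1
  · linear_combination e2
  · linear_combination e3
  · linear_combination e4
  · linear_combination e5
  · linear_combination e6
  · linear_combination e7
  · linear_combination r0
  · linear_combination r1
  · linear_combination r2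
  · linear_combination r3
  · linear_combination r4
  · linear_combination r5
  all_goals rw [twistedIter_succ]; push_cast; ring

end TwistedIterates


/-! ### Finite q-series identities for the spt generating function. -/

section FiniteSums

/-- The `q`-factorial `∏_{i < n} (1 - x ^ (i + 1))`. -/
def qFactorial {A : Type*} [CommRing A] (x : A) (n : ℕ) : A :=
  ∏ i ∈ Finset.range n, (1 - x ^ (i + 1))

theorem qFactorial_succ {A : Type*} [CommRing A] (x : A) (n : ℕ) :
    qFactorial x (n + 1) = qFactorial x n * (1 - x ^ (n + 1)) :=
  Finset.prod_range_succ _ _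

/-- The sum of the terms `± s` of the pentagonal number series, with index shifted by one. -/
def pentagonalPair {A : Type*} [CommRing A] (x : A) (s : ℕ) : A :=
  (-1) ^ (s + 1) * x ^ (3 * (s + 1).choose 2 + (s + 1)) * (1 + x ^ (s + 1))

variable {K : Type*} [Field K] {x : K}

theorem qFactorial_ne_zero (hx : ∀ n : ℕ, 1 - x ^ (n + 1) ≠ 0) (n : ℕ) : qFactorial x n ≠ 0 :=
  Finset.prod_ne_zero_iff.mpr fun i _ => hx i

theorem sum_pentagonalPair_succ (hx : ∀ n : ℕ, 1 - x ^ (n + 1) ≠ 0) (n : ℕ) :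
    (1 - x ^ (n + 1)) * ∑ s ∈ Finset.range (n + 1), pentagonalPair x s *
      ((qFactorial x (n + 1 - (s + 1)))⁻¹ * (qFactorial x (n + 1 + (s + 1)))⁻¹) =
    (∑ s ∈ Finset.range n, pentagonalPair x s *
      ((qFactorial x (n - (s + 1)))⁻¹ * (qFactorial x (n + (s + 1)))⁻¹)) -
      x ^ (n + 1) * ((qFactorial x n)⁻¹ * (qFactorial x (n + 1))⁻¹) := by
  -- A telescoping certificate: a 0 is the boundary term on the right, and a n cancels the
  -- additional summand s = n.
  let a : ℕ → K := fun s => (-1) ^ (s + 1) * x ^ (n + 1 + 3 * (s + 1).choose 2) *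
    ((qFactorial x (n - s))⁻¹ * (qFactorial x (n + s + 1))⁻¹)
  have step : ∀ s ∈ Finset.range n, (1 - x ^ (n + 1)) * (pentagonalPair x s *
      ((qFactorial x (n + 1 - (s + 1)))⁻¹ * (qFactorial x (n + 1 + (s + 1)))⁻¹)) =
      pentagonalPair x s * ((qFactorial x (n - (s + 1)))⁻¹ * (qFactorial x (n + (s + 1)))⁻¹) +
        (a s - a (s + 1)) := by
    intro s hs
    obtain ⟨m, rfl⟩ := Nat.exists_eq_add_of_le (Finset.mem_range.mp hs)
    have e1 : s.succ + m + 1 - (s + 1) = m + 1 := by omega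
    have e2 : s.succ + m - (s + 1) = m := by omega
    have e3 : s.succ + m - s = m + 1 := by omega
    have e4 : s.succ + m + 1 + (s + 1) = s.succ + m + s + 1 + 1 := by omega
    have e5 : s.succ + m + (s + 1) = s.succ + m + s + 1 := by omega
    have e6 : s + 1 + 1 = s + 2 := rfl
    have h1 := hx m
    have h2 := hx (s.succ + m + s + 1)
    have h3 := qFactorial_ne_zero hx m
    have h4 := qFactorial_ne_zero hx (s.succ + m + s + 1)
    have c : (s + 2).choose 2 = (s + 1) + (s + 1).choose 2 := by
      rw [Nat.choose_succ_succ', Nat.choose_one_right]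
    simp only [a, pentagonalPair, e1, e2, e3, e4, e5, e6, c]
    simp only [qFactorial_succ]
    field_simp
    simp only [Nat.succ_eq_add_one]
    ring
  have last : (1 - x ^ (n + 1)) * (pentagonalPair x n *
      ((qFactorial x (n + 1 - (n + 1)))⁻¹ * (qFactorial x (n + 1 + (n + 1)))⁻¹)) = a n := by
    have h2 := hx (n + n + 1)
    have h4 := qFactorial_ne_zero hx (n + n + 1)
    simp only [a, pentagonalPair, Nat.sub_self, show n + 1 + (n + 1) = n + n + 1 + 1 by omega]
    simp only [qFactorial_succ]
    simp only [qFactorial, Finset.prod_range_zero]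
    field_simp
    ring
  rw [Finset.sum_range_succ, mul_add, last, Finset.mul_sum, Finset.sum_congr rfl step,
    Finset.sum_add_distrib, Finset.sum_range_sub']
  simp [a]
  ring

/-- The Bailey pair relative to 1 with β_n = 1/(q)_n, whose α-terms are the pentagonal pairs. -/
theorem inv_qFactorial_eq (hx : ∀ n : ℕ, 1 - x ^ (n + 1) ≠ 0) (n : ℕ) :
    (qFactorial x n)⁻¹ = (qFactorial x n)⁻¹ ^ 2 + ∑ s ∈ Finset.range n, pentagonalPair x s *
      ((qFactorial x (n - (s + 1)))⁻¹ * (qFactorial x (n + (s + 1)))⁻¹) := by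
  induction n with
  | zero => simp [qFactorial]
  | succ n ih =>
    have h := sum_pentagonalPair_succ hx n
    rw [← sub_eq_iff_eq_add'] at ih
    rw [← ih] at h
    apply mul_left_cancel₀ (hx n)
    rw [mul_add, h, qFactorial_succ]
    have h1 := hx n
    have h3 := qFactorial_ne_zero hx n
    field_simp
    ring

/-- Passing from N to N + 1 changes each pentagonal summand by a multiple of the corresponding term
of `inv_qFactorial_eq` at N + 1, the factor 1/(1 - x^(s+1))² being cancelled; the increments
therefore add up to the new term on the left. -/
theorem sum_qFactorial_eq (hx : ∀ n : ℕ, 1 - x ^ (n + 1) ≠ 0) (N : ℕ) :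
    ∑ s ∈ Finset.range N, qFactorial x s * x ^ (s + 1) * (1 - x ^ (s + 1))⁻¹ =
    (∑ s ∈ Finset.range N, x ^ (s + 1) * (1 - x ^ (s + 1))⁻¹ ^ 2) +
    ∑ s ∈ Finset.range N, pentagonalPair x s * (x ^ (s + 1) * (1 - x ^ (s + 1))⁻¹ ^ 2) *
      (qFactorial x N ^ 2 *
        ((qFactorial x (N - (s + 1)))⁻¹ * (qFactorial x (N + (s + 1)))⁻¹)) := by
  induction N with
  | zero => simp
  | succ N ih =>
    have step : ∀ s ∈ Finset.range N,
        pentagonalPair x s * (x ^ (s + 1) * (1 - x ^ (s + 1))⁻¹ ^ 2) * (qFactorial x (N + 1) ^ 2 *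
          ((qFactorial x (N + 1 - (s + 1)))⁻¹ * (qFactorial x (N + 1 + (s + 1)))⁻¹)) =
        pentagonalPair x s * (x ^ (s + 1) * (1 - x ^ (s + 1))⁻¹ ^ 2) * (qFactorial x N ^ 2 *
          ((qFactorial x (N - (s + 1)))⁻¹ * (qFactorial x (N + (s + 1)))⁻¹)) +
        qFactorial x N ^ 2 * x ^ (N + 1) * (pentagonalPair x s *
          ((qFactorial x (N + 1 - (s + 1)))⁻¹ * (qFactorial x (N + 1 + (s + 1)))⁻¹)) := by
      intro s hs
      obtain ⟨m, rfl⟩ := Nat.exists_eq_add_of_le (Finset.mem_range.mp hs)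
      have e1 : s.succ + m + 1 - (s + 1) = m + 1 := by omega
      have e2 : s.succ + m - (s + 1) = m := by omega
      have e4 : s.succ + m + 1 + (s + 1) = s.succ + m + s + 1 + 1 := by omega
      have e5 : s.succ + m + (s + 1) = s.succ + m + s + 1 := by omega
      have h1 := hx m
      have h2 := hx (s.succ + m + s + 1)
      have h3 := qFactorial_ne_zero hx m
      have h4 := qFactorial_ne_zero hx (s.succ + m + s + 1)
      have h5 := hx s
      simp only [e1, e2, e4, e5]
      simp only [qFactorial_succ]
      generalize pentagonalPair x s = p
      field_simp
      simp only [Nat.succ_eq_add_one]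
      ring
    have last : pentagonalPair x N * (x ^ (N + 1) * (1 - x ^ (N + 1))⁻¹ ^ 2) *
        (qFactorial x (N + 1) ^ 2 *
          ((qFactorial x (N + 1 - (N + 1)))⁻¹ * (qFactorial x (N + 1 + (N + 1)))⁻¹)) =
        qFactorial x N ^ 2 * x ^ (N + 1) * (pentagonalPair x N *
          ((qFactorial x (N + 1 - (N + 1)))⁻¹ * (qFactorial x (N + 1 + (N + 1)))⁻¹)) := by
      have h1 := hx N
      rw [qFactorial_succ x N]
      field_simp
    have h := inv_qFactorial_eq hx (N + 1)
    rw [Finset.sum_range_succ, ih, Finset.sum_range_succ _ N, Finset.sum_range_succ _ N,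
      Finset.sum_congr rfl step, last, Finset.sum_add_distrib, ← Finset.mul_sum]
    have key : qFactorial x N * x ^ (N + 1) * (1 - x ^ (N + 1))⁻¹ =
        x ^ (N + 1) * (1 - x ^ (N + 1))⁻¹ ^ 2 + qFactorial x N ^ 2 * x ^ (N + 1) *
          ∑ s ∈ Finset.range (N + 1), pentagonalPair x s * ((qFactorial x (N + 1 - (s + 1)))⁻¹ *
            (qFactorial x (N + 1 + (s + 1)))⁻¹) := by
      rw [eq_sub_of_add_eq' h.symm, qFactorial_succ x N]
      have h1 := hx N
      have h3 := qFactorial_ne_zero hx N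
      field_simp
      ring
    rw [key, Finset.sum_range_succ]
    ring

end FiniteSums


/-! ### Passage to the limit modulo powers of q. -/

section TruncatedSums

open PowerSeries

theorem X_pow_dvd_qFactorial_add_sub (R : Type*) [CommRing R] (n m : ℕ) :
    (X : R⟦X⟧) ^ (n + 1) ∣ qFactorial X (n + m) - qFactorial X n := by
  induction m with
  | zero => simp
  | succ m ih =>
    have e : qFactorial (X : R⟦X⟧) (n + (m + 1)) - qFactorial X n =
        (qFactorial X (n + m) - qFactorial X n) - X ^ (n + 1) * (X ^ m * qFactorial X (n + m)) := by
      rw [← add_assoc, qFactorial_succ]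
      ring
    rw [e]
    exact dvd_sub ih (dvd_mul_right _ _)

theorem sum_succ_mul_pow_mul_sq {R : Type*} [CommRing R] (y : R) (M : ℕ) :
    (∑ i ∈ Finset.range M, ((i : R) + 1) * y ^ (i + 1)) * (1 - y) ^ 2 =
      y - y ^ (M + 1) * ((M + 1) - M * y) := by
  induction M with
  | zero => simp
  | succ M ih =>
    rw [Finset.sum_range_succ, add_mul, ih]
    push_cast
    ring

theorem sum_two_mul_succ_mul_pow_mul_sq {R : Type*} [CommRing R] (y : R) (M : ℕ) :
    (∑ i ∈ Finset.range (M + 1), (2 * (i : R) + 1) * y ^ i) * (1 - y) ^ 2 =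
      1 + y - y ^ (M + 1) * ((2 * M + 3) - (2 * M + 1) * y) := by
  induction M with
  | zero => simp; ring
  | succ M ih =>
    rw [Finset.sum_range_succ, add_mul, ih]
    push_cast
    ring

theorem X_pow_dvd_sub_sum_succ {R : Type*} [CommRing R] (m N : ℕ) {w : R⟦X⟧}
    (hw : (1 - X ^ (m + 1)) * w = 1) : X ^ (N + 1) ∣ X ^ (m + 1) * w ^ 2 -
      ∑ i ∈ Finset.range (N + 1), ((i : R⟦X⟧) + 1) * (X ^ (m + 1)) ^ (i + 1) := by
  have h := sum_succ_mul_pow_mul_sq ((X : R⟦X⟧) ^ (m + 1)) (N + 1)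
  have e : X ^ (m + 1) * w ^ 2 -
      ∑ i ∈ Finset.range (N + 1), ((i : R⟦X⟧) + 1) * (X ^ (m + 1)) ^ (i + 1) =
      (X ^ (m + 1)) ^ (N + 1 + 1) *
        ((((N + 1 : ℕ) : R⟦X⟧) + 1 - ((N + 1 : ℕ) : R⟦X⟧) * X ^ (m + 1)) * w ^ 2) := by
    generalize (∑ i ∈ Finset.range (N + 1), ((i : R⟦X⟧) + 1) * (X ^ (m + 1)) ^ (i + 1)) = S at *
    linear_combination -w ^ 2 * h + S * ((1 - X ^ (m + 1)) * w + 1) * hw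
  rw [e, ← pow_mul]
  exact dvd_mul_of_dvd_left (pow_dvd_pow _ (by nlinarith)) _

theorem X_pow_dvd_sub_sum_two_mul_add_one {R : Type*} [CommRing R] (m N : ℕ) {w : R⟦X⟧}
    (hw : (1 - X ^ (m + 1)) * w = 1) : X ^ (N + 1) ∣ (1 + X ^ (m + 1)) * w ^ 2 -
      ∑ i ∈ Finset.range (N + 1), (2 * (i : R⟦X⟧) + 1) * (X ^ (m + 1)) ^ i := by
  have h := sum_two_mul_succ_mul_pow_mul_sq ((X : R⟦X⟧) ^ (m + 1)) N
  have e : (1 + X ^ (m + 1)) * w ^ 2 -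
      ∑ i ∈ Finset.range (N + 1), (2 * (i : R⟦X⟧) + 1) * (X ^ (m + 1)) ^ i =
      (X ^ (m + 1)) ^ (N + 1) *
        ((2 * (N : R⟦X⟧) + 3 - (2 * (N : R⟦X⟧) + 1) * X ^ (m + 1)) * w ^ 2) := by
    generalize (∑ i ∈ Finset.range (N + 1), (2 * (i : R⟦X⟧) + 1) * (X ^ (m + 1)) ^ i) = S at *
    linear_combination -w ^ 2 * h + S * ((1 - X ^ (m + 1)) * w + 1) * hw
  rw [e, ← pow_mul]
  exact dvd_mul_of_dvd_left (pow_dvd_pow _ (by nlinarith)) _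

theorem X_pow_dvd_divisorSeries_sub (R : Type*) [CommRing R] (N : ℕ) :
    (X : R⟦X⟧) ^ (N + 1) ∣ divisorSeries R 1 - ∑ s ∈ Finset.range N,
      ∑ i ∈ Finset.range (N + 1), ((i : R⟦X⟧) + 1) * (X ^ (s + 1)) ^ (i + 1) := by
  rw [X_pow_dvd_iff]
  intro n hn
  have e : ∀ s i : ℕ, coeff n (((i : R⟦X⟧) + 1) * (X ^ (s + 1)) ^ (i + 1)) =
      if n = (s + 1) * (i + 1) then (i : R) + 1 else 0 := fun s i => by
    rw [← pow_mul, ← Nat.cast_succ, ← map_natCast (C (R := R)), coeff_C_mul, coeff_X_pow]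
    simp
  simp only [map_sub, map_sum, e, divisorSeries, coeff_mk, pow_one]
  rw [sub_eq_zero, Finset.sum_comm]
  have h : ∀ i ∈ Finset.range (N + 1), (∑ s ∈ Finset.range N,
      if n = (s + 1) * (i + 1) then (i : R) + 1 else 0) =
      if i + 1 ∈ n.divisors then ((i + 1 : ℕ) : R) else 0 := by
    intro i _
    split_ifs with hi
    · obtain ⟨⟨c, hc⟩, h0⟩ := Nat.mem_divisors.mp hi
      obtain ⟨c, rfl⟩ : ∃ d, c = d + 1 := Nat.exists_eq_succ_of_ne_zero (by grind)
      rw [Finset.sum_eq_single c, if_pos (by rw [hc, mul_comm])]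
      · push_cast; rfl
      · intro s _ hs
        rw [if_neg]
        intro h
        rw [hc, mul_comm] at h
        exact hs (by simpa using (Nat.eq_of_mul_eq_mul_right (Nat.succ_pos i) h).symm)
      · intro h
        exact absurd (Finset.mem_range.mpr (by nlinarith)) h
    · refine Finset.sum_eq_zero fun s _ => if_neg fun h => hi ?_
      rw [Nat.mem_divisors]
      exact ⟨h ▸ dvd_mul_left _ _, by rw [h]; positivity⟩
  rw [Finset.sum_congr rfl h, ← Finset.sum_filter]
  symm
  refine Finset.sum_bij (fun i _ => i + 1) ?_ ?_ ?_ ?_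
  · intro i hi
    exact (Finset.mem_filter.mp hi).2
  · intro i _ j _ h
    exact Nat.succ_injective h
  · intro d hd
    have h1 := Nat.pos_of_mem_divisors hd
    have h2 := Nat.divisor_le hd
    refine ⟨d - 1, Finset.mem_filter.mpr ⟨Finset.mem_range.mpr (by omega), ?_⟩, by omega⟩
    rwa [Nat.sub_add_cancel h1]
  · intro i _
    rfl

theorem X_pow_dvd_appellSeries_sub {R : Type*} [CommRing R] (f : ℕ → R) (N : ℕ) :
    (X : R⟦X⟧) ^ (N + 1) ∣ appellSeries f - ∑ j ∈ Finset.range N,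
      (-1) ^ (j + 1) * X ^ (3 * (j + 1).choose 2 + 2 * (j + 1)) *
        ∑ i ∈ Finset.range (N + 1), C (f i) * (X ^ (j + 1)) ^ i := by
  rw [X_pow_dvd_iff]
  intro n hn
  have e : ∀ j i : ℕ, coeff n ((-1) ^ (j + 1) * X ^ (3 * (j + 1).choose 2 + 2 * (j + 1)) *
      (C (f i) * (X ^ (j + 1)) ^ i)) =
      if (j + 1) * (3 * (j + 1) + 1) + 2 * (j + 1) * i = 2 * n then (-1) ^ (j +
        1) * f i else 0 := by
    intro j i
    have e' : (-1) ^ (j + 1) * X ^ (3 * (j + 1).choose 2 + 2 * (j + 1)) *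
        (C (f i) * (X ^ (j + 1)) ^ i) = C ((-1) ^ (j + 1) * f i) *
          X ^ (3 * (j + 1).choose 2 + 2 * (j + 1) + (j + 1) * i) := by
      simp only [map_mul, map_pow, map_neg, map_one]
      ring
    have h := Nat.add_one_mul_choose_eq j 1
    rw [Nat.choose_one_right] at h
    rw [e', coeff_C_mul, coeff_X_pow, mul_ite, mul_one, mul_zero]
    refine if_congr ⟨fun h' => ?_, fun h' => ?_⟩ rfl rfl <;> grind
  simp only [map_sub, map_sum, Finset.mul_sum, e, appellSeries, coeff_mk]
  rw [sub_eq_zero]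
  have h1 : ∀ j ∈ Finset.range n, (∑ i ∈ Finset.range (n + 1),
      if (j + 1) * (3 * (j + 1) + 1) + 2 * (j + 1) * i = 2 * n then (-1) ^ (j + 1) * f i else 0) =
      ∑ i ∈ Finset.range (N + 1), if (j + 1) * (3 * (j + 1) + 1) + 2 * (j + 1) * i = 2 * n then
        (-1) ^ (j + 1) * f i else 0 := by
    intro j _
    refine Finset.sum_subset (Finset.range_mono (by omega)) fun i _ hi => if_neg fun h => hi ?_
    rw [Finset.mem_range]
    nlinarith
  rw [Finset.sum_congr rfl h1]
  refine Finset.sum_subset (Finset.range_mono (by omega)) fun j _ hj =>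
    Finset.sum_eq_zero fun i _ => if_neg fun h => hj ?_
  rw [Finset.mem_range]
  nlinarith

variable (k : Type*) [Field k]

theorem one_sub_X_pow_mul_inv (n : ℕ) :
    (1 - (X : k⟦X⟧) ^ (n + 1)) * (1 - (X : k⟦X⟧) ^ (n + 1))⁻¹ = 1 :=
  PowerSeries.mul_inv_cancel _ (by simp)

theorem constantCoeff_qFactorial (n : ℕ) : constantCoeff (qFactorial (X : k⟦X⟧) n) = 1 := by
  simp [qFactorial, map_prod]

theorem map_powerSeries_inv {L : Type*} [Field L] (φ : k⟦X⟧ →+* L) {f : k⟦X⟧}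
    (hf : constantCoeff f ≠ 0) : φ f⁻¹ = (φ f)⁻¹ := by
  apply eq_inv_of_mul_eq_one_right
  rw [← map_mul, PowerSeries.mul_inv_cancel _ hf, map_one]

theorem map_qFactorial {A B : Type*} [CommRing A] [CommRing B] (φ : A →+* B) (x : A) (n : ℕ) :
    φ (qFactorial x n) = qFactorial (φ x) n := by
  simp [qFactorial, map_prod]

/-- The field identity is applied in the fraction field; all denominators have constant term 1, so
it descends to power series. -/
theorem sum_qFactorial_X_eq (N : ℕ) :
    ∑ s ∈ Finset.range N, qFactorial X s * X ^ (s + 1) * (1 - (X : k⟦X⟧) ^ (s + 1))⁻¹ =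
    (∑ s ∈ Finset.range N, X ^ (s + 1) * (1 - X ^ (s + 1))⁻¹ ^ 2) +
    ∑ s ∈ Finset.range N, pentagonalPair X s * (X ^ (s + 1) * (1 - X ^ (s + 1))⁻¹ ^ 2) *
      (qFactorial X N ^ 2 * ((qFactorial X (N - (s + 1)))⁻¹ *
        (qFactorial X (N + (s + 1)))⁻¹)) := by
  let φ := algebraMap k⟦X⟧ (FractionRing k⟦X⟧)
  have hφ : Function.Injective φ := IsFractionRing.injective _ _
  have hx : ∀ n : ℕ, 1 - φ X ^ (n + 1) ≠ 0 := fun n h => by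
    have h' : φ (1 - X ^ (n + 1)) = 0 := by simpa using h
    rw [map_eq_zero_iff φ hφ] at h'
    simpa using congrArg constantCoeff h'
  have h1 : ∀ n : ℕ, φ (1 - X ^ (n + 1))⁻¹ = (1 - φ X ^ (n + 1))⁻¹ := fun n => by
    rw [map_powerSeries_inv k φ (by simp)]
    simp
  have h2 : ∀ n : ℕ, φ (qFactorial X n)⁻¹ = (qFactorial (φ X) n)⁻¹ := fun n => by
    rw [map_powerSeries_inv k φ (by simp [constantCoeff_qFactorial]), map_qFactorial]
  apply hφ
  simp only [map_sum, map_add, map_mul, map_pow, h1, h2, map_qFactorial, pentagonalPair, map_neg,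
    map_one]
  exact sum_qFactorial_eq hx N

/-- The ratio of q-factorials tends to 1, but (q)_{N-r} agrees with (q)_N only modulo X^(N-r+1); the
factor X^r restores the missing precision. -/
theorem X_pow_dvd_qFactorial_ratio_sub {N r : ℕ} (hr : r ≤ N) :
    (X : k⟦X⟧) ^ (N + 1) ∣ X ^ r * (qFactorial X N ^ 2 * ((qFactorial X (N - r))⁻¹ *
        (qFactorial X (N + r))⁻¹)) - X ^ r := by
  have h1 := X_pow_dvd_qFactorial_add_sub k (N - r) r
  rw [Nat.sub_add_cancel hr] at h1
  have h2 := (pow_dvd_pow (X : k⟦X⟧) (show N - r + 1 ≤ N + 1 by omega)).trans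
    (X_pow_dvd_qFactorial_add_sub k N r)
  have i1 : qFactorial (X : k⟦X⟧) (N - r) * (qFactorial X (N - r))⁻¹ = 1 :=
    PowerSeries.mul_inv_cancel _ (by simp [constantCoeff_qFactorial])
  have i2 : qFactorial (X : k⟦X⟧) (N + r) * (qFactorial X (N + r))⁻¹ = 1 :=
    PowerSeries.mul_inv_cancel _ (by simp [constantCoeff_qFactorial])
  have e : X ^ r * (qFactorial X N ^ 2 * ((qFactorial X (N - r))⁻¹ *
        (qFactorial X (N + r))⁻¹)) - X ^ r = X ^ r * ((qFactorial X N * (qFactorial X N -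
          qFactorial X (N - r)) - qFactorial X (N - r) * (qFactorial X (N + r) - qFactorial X N)) *
          ((qFactorial X (N - r))⁻¹ * (qFactorial (X : k⟦X⟧) (N + r))⁻¹)) := by
    linear_combination X ^ r * (qFactorial (X : k⟦X⟧) (N + r) * (qFactorial X (N + r))⁻¹ * i1 + i2)
  rw [e, show N + 1 = r + (N - r + 1) by omega, pow_add X r]
  exact mul_dvd_mul_left _ (dvd_mul_of_dvd_left
    (dvd_sub (dvd_mul_of_dvd_right h1 _) (dvd_mul_of_dvd_right h2 _)) _)

/-- In the limit y/(1 - y)² sums to the divisor series, while (1 + y)/(1 - y)² = Σ(2i + 1)y^i turns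
the pentagonal part into the Appell series. -/
theorem X_pow_dvd_sum_qFactorial_sub (N : ℕ) : (X : k⟦X⟧) ^ (N + 1) ∣
    (∑ s ∈ Finset.range N, qFactorial X s * X ^ (s + 1) * (1 - (X : k⟦X⟧) ^ (s + 1))⁻¹) -
      (divisorSeries k 1 + appellSeries fun i => 2 * (i : k) + 1) := by
  have h1 := X_pow_dvd_divisorSeries_sub k N
  have h2 := X_pow_dvd_appellSeries_sub (fun i => 2 * (i : k) + 1) N
  have h3 := Finset.dvd_sum fun s (_ : s ∈ Finset.range N) =>
    X_pow_dvd_sub_sum_succ s N (one_sub_X_pow_mul_inv k s)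
  have h4 : (X : k⟦X⟧) ^ (N + 1) ∣ ∑ s ∈ Finset.range N,
      (pentagonalPair X s * (X ^ (s + 1) * (1 - X ^ (s + 1))⁻¹ ^ 2) *
        (qFactorial X N ^ 2 * ((qFactorial X (N - (s + 1)))⁻¹ *
          (qFactorial X (N + (s + 1)))⁻¹)) -
      (-1) ^ (s + 1) * X ^ (3 * (s + 1).choose 2 + 2 * (s + 1)) *
        ∑ i ∈ Finset.range (N + 1), C (2 * (i : k) + 1) * (X ^ (s + 1)) ^ i) := by
    refine Finset.dvd_sum fun s hs => ?_
    have g1 := X_pow_dvd_qFactorial_ratio_sub k (Finset.mem_range.mp hs)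
    have g2 := X_pow_dvd_sub_sum_two_mul_add_one s N (one_sub_X_pow_mul_inv k s)
    simp only [map_add, map_mul, map_ofNat, map_natCast, map_one]
    have e := dvd_add (dvd_mul_of_dvd_right g1
      (pentagonalPair X s * (1 - (X : k⟦X⟧) ^ (s + 1))⁻¹ ^ 2)) (dvd_mul_of_dvd_right g2
      ((-1) ^ (s + 1) * X ^ (3 * (s + 1).choose 2 + 2 * (s + 1))))
    convert e using 1
    rw [pentagonalPair, Nat.succ_eq_add_one]
    ring
  rw [sum_qFactorial_X_eq]
  rw [Finset.sum_sub_distrib] at h3 h4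
  convert dvd_sub (dvd_add h3 h4) (dvd_add h1 h2) using 1
  ring

end TruncatedSums


/-! ### Generating functions of spt and of partitions. -/

section PartitionSeries

open PowerSeries

open scoped PowerSeries.WithPiTopology

/-- The weight counting the multiplicity of the part `s` in partitions into parts at least `s`. -/
def smallestWeight (R : Type*) [CommRing R] (g : ℕ → R) (s i c : ℕ) : R :=
  if i < s then 0 else if i = s then g c else 1

theorem prod_smallestWeight {R : Type*} [CommRing R] (g : ℕ → R) (s n : ℕ) (π : n.Partition) :
    π.parts.toFinsupp.prod (smallestWeight R g s) =
      if ∀ j ∈ π.parts, s ≤ j then (if s ∈ π.parts then g (π.parts.count s) else 1) else 0 := by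
  rw [Finsupp.prod, Multiset.toFinsupp_support]
  simp only [Multiset.toFinsupp_apply]
  split_ifs with h hs
  · rw [Finset.prod_eq_single s]
    · simp [smallestWeight]
    · intro i hi his
      have := h i (Multiset.mem_toFinset.mp hi)
      rw [smallestWeight, if_neg (by omega), if_neg his]
    · intro h
      exact absurd (Multiset.mem_toFinset.mpr hs) h
  · refine Finset.prod_eq_one fun i hi => ?_
    have := h i (Multiset.mem_toFinset.mp hi)
    rw [smallestWeight, if_neg (by omega), if_neg]
    rintro rfl
    exact hs (Multiset.mem_toFinset.mp hi)
  · push Not at h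
    obtain ⟨j, hj, hjs⟩ := h
    exact Finset.prod_eq_zero (Multiset.mem_toFinset.mpr hj) (if_pos hjs)

/-- The first weight counts s with multiplicity, but gives 1 when all parts exceed s; subtracting
the weight with g = 0 removes exactly these partitions, leaving those whose smallest part is s. -/
theorem spt_eq_sum (R : Type*) [CommRing R] {n N : ℕ} (hn : n ≤ N) :
    (spt n : R) = ∑ s ∈ Finset.range N,
      coeff n (Nat.Partition.genFun (smallestWeight R (fun c => (c : R)) (s + 1)) -
        Nat.Partition.genFun (smallestWeight R (fun _ => 0) (s + 1))) := by
  simp only [map_sub, Nat.Partition.coeff_genFun, ← Finset.sum_sub_distrib]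
  rw [Finset.sum_comm, spt, Nat.cast_sum]
  refine Finset.sum_congr rfl fun π _ => ?_
  have hp : ∀ a ∈ π.parts.filter (fun i => ∀ j ∈ π.parts, i ≤ j), a ∈ Finset.Icc 1 N := by
    intro a ha
    have ha' := Multiset.mem_of_mem_filter ha
    have := Multiset.single_le_sum (fun _ _ => Nat.zero_le _) a ha'
    rw [π.parts_sum] at this
    exact Finset.mem_Icc.mpr ⟨π.parts_pos ha', this.trans hn⟩
  rw [← Multiset.sum_count_eq_card hp, Nat.cast_sum, Finset.sum_bij (fun i _ => i - 1)]
  · intro a ha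
    rw [Finset.mem_Icc] at ha
    exact Finset.mem_range.mpr (by omega)
  · intro a ha b hb h
    rw [Finset.mem_Icc] at ha hb
    omega
  · intro b hb
    rw [Finset.mem_range] at hb
    exact ⟨b + 1, Finset.mem_Icc.mpr (by omega), by omega⟩
  · intro a ha
    rw [Finset.mem_Icc] at ha
    rw [prod_smallestWeight, prod_smallestWeight, Nat.sub_add_cancel ha.1, Multiset.count_filter]
    by_cases h1 : ∀ j ∈ π.parts, a ≤ j
    · by_cases h2 : a ∈ π.parts <;> simp [h2]
    · simp [h1]

variable {k : Type*} [Field k]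

theorem one_sub_mul_tsum_pow [TopologicalSpace k] [DiscreteTopology k] (i : ℕ) :
    (1 - (X : k⟦X⟧) ^ (i + 1)) * ∑' j : ℕ, X ^ ((i + 1) * (j + 1)) = X ^ (i + 1) := by
  have hs := Nat.Partition.summable_genFun_term (fun _ _ => (1 : k)) i
  simp only [one_smul] at hs
  have e := hs.tsum_eq_zero_add
  have h : ∑' j : ℕ, (X : k⟦X⟧) ^ ((i + 1) * (j + 1 + 1)) =
      X ^ (i + 1) * ∑' j : ℕ, X ^ ((i + 1) * (j + 1)) := by
    rw [← hs.tsum_mul_left]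
    exact tsum_congr fun j => by ring
  rw [h] at e
  rw [zero_add, mul_one] at e
  linear_combination e

theorem one_sub_mul_tsum_natCast_smul_pow [TopologicalSpace k] [DiscreteTopology k] (i : ℕ) :
    (1 - (X : k⟦X⟧) ^ (i + 1)) * ∑' j : ℕ, ((j + 1 : ℕ) : k) • X ^ ((i + 1) * (j + 1)) =
      ∑' j : ℕ, X ^ ((i + 1) * (j + 1)) := by
  have hs := Nat.Partition.summable_genFun_term (fun _ _ => (1 : k)) i
  simp only [one_smul] at hs
  have ht := Nat.Partition.summable_genFun_term (fun _ c => (c : k)) i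
  have e := ht.tsum_eq_zero_add
  have h : ∑' j : ℕ, ((j + 1 + 1 : ℕ) : k) • (X : k⟦X⟧) ^ ((i + 1) * (j + 1 + 1)) =
      X ^ (i + 1) * ∑' j : ℕ, ((j + 1 : ℕ) : k) • (X : k⟦X⟧) ^ ((i + 1) * (j + 1)) +
      X ^ (i + 1) * ∑' j : ℕ, X ^ ((i + 1) * (j + 1)) := by
    rw [← hs.tsum_mul_left, ← ht.tsum_mul_left, ← (ht.mul_left _).tsum_add (hs.mul_left _)]
    refine tsum_congr fun j => ?_
    rw [Nat.cast_succ (j + 1), add_smul, one_smul, mul_smul_comm]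
    ring_nf
  have h' := one_sub_mul_tsum_pow (k := k) i
  rw [h] at e
  simp only [zero_add, mul_one, Nat.cast_one, one_smul] at e
  linear_combination e - h'

/-- Parts larger than m + 1 are unrestricted, so their factors cancel against the infinite product;
a finite product remains. -/
theorem genFun_mul_pentagonalSeries_eq [TopologicalSpace k] [DiscreteTopology k] (m : ℕ)
    (g : ℕ → k) :
    Nat.Partition.genFun (smallestWeight k g (m + 1)) * pentagonalSeries k =
      qFactorial X m * ((1 + ∑' j : ℕ, g (j + 1) • (X : k⟦X⟧) ^ ((m + 1) * (j + 1))) *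
        (1 - X ^ (m + 1))) := by
  have h := (Nat.Partition.hasProd_genFun (smallestWeight k g (m + 1))).mul
    (PowerSeries.WithPiTopology.hasProd_one_sub_X_pow k)
  have h' : ∀ i ∉ Finset.range (m + 1), (1 + ∑' j : ℕ, smallestWeight k g (m + 1) (i + 1) (j + 1) •
      (X : k⟦X⟧) ^ ((i + 1) * (j + 1))) * (1 - X ^ (i + 1)) = 1 := by
    intro i hi
    rw [Finset.mem_range] at hi
    have h1 : ¬ i + 1 < m + 1 := by omega
    have h2 : ¬ i + 1 = m + 1 := by omega
    simp only [smallestWeight, if_neg h1, if_neg h2, one_smul]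
    linear_combination one_sub_mul_tsum_pow (k := k) i
  refine (h.unique (hasProd_prod_of_ne_finset_one h')).trans ?_
  rw [Finset.prod_range_succ, qFactorial]
  congr 1
  · refine Finset.prod_congr rfl fun i hi => ?_
    rw [Finset.mem_range] at hi
    simp [smallestWeight, hi]
  · simp [smallestWeight]

theorem genFun_sub_genFun_mul_pentagonalSeries (m : ℕ) :
    (Nat.Partition.genFun (smallestWeight k (fun c => (c : k)) (m + 1)) -
      Nat.Partition.genFun (smallestWeight k (fun _ => 0) (m + 1))) * pentagonalSeries k =
      qFactorial X m * X ^ (m + 1) * (1 - X ^ (m + 1))⁻¹ := by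
  let : TopologicalSpace k := ⊥
  have : DiscreteTopology k := ⟨rfl⟩
  rw [sub_mul, genFun_mul_pentagonalSeries_eq, genFun_mul_pentagonalSeries_eq]
  simp only [zero_smul, tsum_zero]
  linear_combination qFactorial X m * (one_sub_mul_tsum_natCast_smul_pow (k := k) m +
    (1 - X ^ (m + 1))⁻¹ * one_sub_mul_tsum_pow (k := k) m -
    (∑' j : ℕ, X ^ ((m + 1) * (j + 1))) * one_sub_X_pow_mul_inv k m)

theorem mk_partitionCount_mul_pentagonalSeries :
    (PowerSeries.mk fun n => (partitionCount n : k)) * pentagonalSeries k = 1 := by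
  let : TopologicalSpace k := ⊥
  have : DiscreteTopology k := ⟨rfl⟩
  have h := (Nat.Partition.hasProd_genFun (fun _ _ => (1 : k))).mul
    (PowerSeries.WithPiTopology.hasProd_one_sub_X_pow k)
  have e : (PowerSeries.mk fun n => (partitionCount n : k)) =
      Nat.Partition.genFun (fun _ _ => (1 : k)) := by
    ext n
    simp [Finsupp.prod, partitionCount]
  rw [e]
  refine h.unique ?_
  convert hasProd_one using 2 with i
  simp only [one_smul]
  linear_combination one_sub_mul_tsum_pow (k := k) i

/-- The generating function of `spt`. -/
theorem mk_spt_mul_pentagonalSeries :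
    (PowerSeries.mk fun n => (spt n : k)) * pentagonalSeries k =
      divisorSeries k 1 + appellSeries fun i => 2 * (i : k) + 1 := by
  ext N
  have h := X_pow_dvd_sum_qFactorial_sub k N
  simp only [← genFun_sub_genFun_mul_pentagonalSeries] at h
  rw [← Finset.sum_mul] at h
  have h' := X_pow_dvd_iff.mp h N (Nat.lt_succ_self N)
  rw [map_sub, sub_eq_zero] at h'
  rw [← h', coeff_mul, coeff_mul]
  refine Finset.sum_congr rfl fun p hp => ?_
  rw [coeff_mk, spt_eq_sum k (Finset.HasAntidiagonal.antidiagonal.fst_le hp), map_sum]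

end PartitionSeries


/-! ### From vanishing iterates to congruences. -/

section Congruences

open PowerSeries

variable {k : Type*} [Field k]

theorem eulerD_mk_partitionCount (h2 : (2 : k) ≠ 0) (h3 : (3 : k) ≠ 0) :
    eulerD k (PowerSeries.mk fun n => (partitionCount n : k)) =
      divisorSeries k 1 * PowerSeries.mk fun n => (partitionCount n : k) := by
  have h := mk_partitionCount_mul_pentagonalSeries (k := k)
  generalize (PowerSeries.mk fun n => (partitionCount n : k)) = P at *
  have h' := congrArg (eulerD k) h
  rw [isLeibniz_eulerD, eulerD_pentagonalSeries h2 h3, logLambert_zero,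
    (isLeibniz_eulerD k).map_one_eq_zero] at h'
  linear_combination P * h' - (eulerD k P - divisorSeries k 1 * P) * h

/-- Because DP = l₀P, multiplication by P turns `twistedD` into 6D + r, which acts on coefficients
by the scalar 6n + r. -/
theorem coeff_mul_twistedIter (h2 : (2 : k) ≠ 0) (h3 : (3 : k) ≠ 0) (J n : ℕ) :
    coeff n ((PowerSeries.mk fun n => (partitionCount n : k)) * twistedIter k J) =
      (∏ j ∈ Finset.range J, (6 * (n : k) + (j : k) * ((j : k) + 1))) *
        (12 * (spt n : k) + (24 * (n : k) - 1) * (partitionCount n : k)) := by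
  have hP := eulerD_mk_partitionCount h2 h3
  have h1 := mk_partitionCount_mul_pentagonalSeries (k := k)
  have hS := mk_spt_mul_pentagonalSeries (k := k)
  rw [← rankMoment_zero] at hS
  induction J with
  | zero =>
    have e : (PowerSeries.mk fun n => (partitionCount n : k)) * twistedIter k 0 =
        C 12 * (PowerSeries.mk fun n => (spt n : k)) +
        C 24 * eulerD k (PowerSeries.mk fun n => (partitionCount n : k)) -
        PowerSeries.mk fun n => (partitionCount n : k) := by
      rw [hP, twistedIter, logLambert_zero, map_ofNat, map_ofNat]
      linear_combination -12 * (PowerSeries.mk fun n => (partitionCount n : k)) * hS +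
        12 * (PowerSeries.mk fun n => (spt n : k)) * h1
    rw [e, map_sub, map_add, coeff_C_mul, coeff_C_mul, coeff_eulerD, coeff_mk, coeff_mk]
    simp
    ring
  | succ J ih =>
    have e : (PowerSeries.mk fun n => (partitionCount n : k)) * twistedIter k (J + 1) =
        C 6 * eulerD k ((PowerSeries.mk fun n => (partitionCount n : k)) * twistedIter k J) +
        C ((J * (J + 1) : ℕ) : k) *
          ((PowerSeries.mk fun n => (partitionCount n : k)) * twistedIter k J) := by
      rw [isLeibniz_eulerD, hP, twistedIter_succ, logLambert_zero, map_ofNat, map_natCast]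
      ring
    rw [e, map_add, coeff_C_mul, coeff_C_mul, coeff_eulerD, ih, Finset.prod_range_succ]
    push_cast
    ring

/-- Either the wanted factor vanishes or some 6n + j(j+1) does; in the second case 1 - 24n ≡
(2j+1)², contrary to hypothesis. -/
theorem dvd_of_twistedIter_eq_zero {t : ℕ} [Fact t.Prime] (h2 : (2 : ZMod t) ≠ 0)
    (h3 : (3 : ZMod t) ≠ 0) {J : ℕ} (hJ : 2 * J ≤ t) (h0 : twistedIter (ZMod t) J = 0) {n : ℕ}
    (hn : ¬ IsQuadraticResidue (1 - 24 * (n : ℤ)) t) :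
    (t : ℤ) ∣ 12 * (spt n : ℤ) + (24 * (n : ℤ) - 1) * (partitionCount n : ℤ) := by
  have h := coeff_mul_twistedIter h2 h3 J n
  rw [h0, mul_zero, map_zero, eq_comm, mul_eq_zero] at h
  rcases h with h | h
  · obtain ⟨j, hj, hj0⟩ := Finset.prod_eq_zero_iff.mp h
    rw [Finset.mem_range] at hj
    have hsq : ((2 * (j : ℤ) + 1) ^ 2) ≡ 1 - 24 * (n : ℤ) [ZMOD (t : ℤ)] := by
      rw [← ZMod.intCast_eq_intCast_iff]
      push_cast
      linear_combination 4 * hj0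
    refine absurd ⟨?_, _, hsq⟩ hn
    -- The bound `hJ` enters here: j < J gives 0 < 2j + 1 < t, so the square is prime to t.
    have hc : IsCoprime ((2 * (j : ℤ) + 1)) (t : ℤ) := by
      have : Nat.Coprime (2 * j + 1) t :=
        (Nat.coprime_of_lt_prime (by omega) (by omega) Fact.out).symm
      exact_mod_cast Nat.isCoprime_iff_coprime.mpr this
    obtain ⟨c, hc'⟩ := hsq.dvd
    rw [show 1 - 24 * (n : ℤ) = (2 * (j : ℤ) + 1) ^ 2 + t * c by linear_combination hc']
    exact IsCoprime.add_mul_left_left hc.pow_left c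
  · rw [← ZMod.intCast_zmod_eq_zero_iff_dvd]
    exact_mod_cast h

theorem not_isQuadraticResidue_of_dvd {t : ℕ} (ht : t ≠ 1) {a : ℤ} (h : (t : ℤ) ∣ a) :
    ¬ IsQuadraticResidue a t := fun ha => by
  have := Int.isUnit_iff.mp (ha.1.isUnit_of_dvd' h dvd_rfl)
  omega

end Congruences

theorem spt_modEq_of_not_isQuadraticResidue (t : ℕ) (ht : t = 5 ∨ t = 7 ∨ t = 13) (n : ℕ)
    (hn : ¬ IsQuadraticResidue (1 - 24 * (n : ℤ)) t) :
    (spt n : ℤ) ≡ -2 * ((n : ℤ) + ((t : ℤ) ^ 2 - 1) / 24) * (partitionCount n : ℤ)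
      [ZMOD (t : ℤ)] := by
  rw [Int.modEq_iff_dvd]
  rcases ht with rfl | rfl | rfl
  · have h := dvd_of_twistedIter_eq_zero (zmod_ofNat_ne_zero 5 2 (by norm_num))
      (zmod_ofNat_ne_zero 5 3 (by norm_num)) (by norm_num) twistedIter_five hn
    norm_num at h ⊢
    -- Isolating n·p(n) as one atom makes the rest linear; `omega` then divides by 12 modulo t, with
    -- (t² - 1)/24 equal to 1 here and to 2 and 7 for the other primes.
    rw [show (24 * (n : ℤ) - 1) * (partitionCount n : ℤ) =
      24 * (n * partitionCount n) - partitionCount n by ring] at h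
    rw [show -(2 * ((n : ℤ) + 1) * (partitionCount n : ℤ)) =
      -2 * (n * partitionCount n) - 2 * partitionCount n by ring]
    omega
  · have h := dvd_of_twistedIter_eq_zero (zmod_ofNat_ne_zero 7 2 (by norm_num))
      (zmod_ofNat_ne_zero 7 3 (by norm_num)) (by norm_num) twistedIter_seven hn
    norm_num at h ⊢
    rw [show (24 * (n : ℤ) - 1) * (partitionCount n : ℤ) =
      24 * (n * partitionCount n) - partitionCount n by ring] at h
    rw [show -(2 * ((n : ℤ) + 2) * (partitionCount n : ℤ)) =
      -2 * (n * partitionCount n) - 4 * partitionCount n by ring]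
    omega
  · have h := dvd_of_twistedIter_eq_zero (zmod_ofNat_ne_zero 13 2 (by norm_num))
      (zmod_ofNat_ne_zero 13 3 (by norm_num)) (by norm_num) twistedIter_thirteen hn
    norm_num at h ⊢
    rw [show (24 * (n : ℤ) - 1) * (partitionCount n : ℤ) =
      24 * (n * partitionCount n) - partitionCount n by ring] at h
    rw [show -(2 * ((n : ℤ) + 7) * (partitionCount n : ℤ)) =
      -2 * (n * partitionCount n) - 14 * partitionCount n by ring]
    omega


theorem theorem2p1 :
    (∀ t : ℕ, (t = 5 ∨ t = 7 ∨ t = 13) → ∀ n : ℕ,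
      ¬ IsQuadraticResidue (1 - 24 * (n : ℤ)) t →
        (spt n : ℤ) ≡ -2 * ((n : ℤ) + ((t : ℤ) ^ 2 - 1) / 24) * (partitionCount n : ℤ)
          [ZMOD (t : ℤ)]) ∧
    (∀ n : ℕ, spt (5 * n + 4) ≡ 0 [MOD 5]) ∧
    (∀ n : ℕ, spt (7 * n + 5) ≡ 0 [MOD 7]) ∧
    (∀ n : ℕ, spt (13 * n + 6) ≡ 0 [MOD 13]) := by
  refine ⟨spt_modEq_of_not_isQuadraticResidue, fun n => ?_, fun n => ?_, fun n => ?_⟩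
  · have h := spt_modEq_of_not_isQuadraticResidue 5 (by norm_num) (5 * n + 4)
      (not_isQuadraticResidue_of_dvd (by norm_num) ⟨-(24 * n + 19), by push_cast; ring⟩)
    rw [← Int.natCast_modEq_iff]
    -- In these progressions the linear factor is itself divisible by t: (5n + 4) + 1 = 5(n + 1),
    -- and likewise (7n + 5) + 2 and (13n + 6) + 7.
    refine h.trans (Int.modEq_zero_iff_dvd.mpr ⟨-2 * (n + 1) * partitionCount (5 * n + 4), ?_⟩)
    norm_num
    ring
  · have h := spt_modEq_of_not_isQuadraticResidue 7 (by norm_num) (7 * n + 5)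
      (not_isQuadraticResidue_of_dvd (by norm_num) ⟨-(24 * n + 17), by push_cast; ring⟩)
    rw [← Int.natCast_modEq_iff]
    refine h.trans (Int.modEq_zero_iff_dvd.mpr ⟨-2 * (n + 1) * partitionCount (7 * n + 5), ?_⟩)
    norm_num
    ring
  · have h := spt_modEq_of_not_isQuadraticResidue 13 (by norm_num) (13 * n + 6)
      (not_isQuadraticResidue_of_dvd (by norm_num) ⟨-(24 * n + 11), by push_cast; ring⟩)
    rw [← Int.natCast_modEq_iff]
    refine h.trans (Int.modEq_zero_iff_dvd.mpr ⟨-2 * (n + 1) * partitionCount (13 * n + 6), ?_⟩)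
    norm_num
    ring
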